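/- **Setting.** Let $\tilde A$ be an abelian group and $A\subset\tilde A$ a subgroup. Let $V$ be a strongly $A$-graded Möbius or conformal vertex algebra: $V=\coprod_{n\in\mathbb Z}V_{(n)}$ (eigenspaces of $L(0)$) $=\coprod_{\alpha\in A}V^{(\alpha)}$ compatibly, with $V_{(n)}\cap V^{(\alpha)}$ finite-dimensional and zero for $n$ sufficiently negative, $\mathbf 1\in V^{(0)}_{(0)}$, $v_lV^{(\beta)}\subset V^{(\alpha+\beta)}$ for $v\in V^{(\alpha)}$, $L(j)V^{(\alpha)}\subset V^{(\alpha)}$ for $j=0,\pm1$ and, in the conformal case, $\omega\in V^{(0)}_{(2)}$. Let $W_1,W_2,W_3$ be strongly $\tilde A$-graded generalized $V$-modules: $W_i=\coprod_{n\in\mathbb C}(W_i)_{[n]}$ (generalized eigenspaces of $L(0)$) $=\coprod_{\beta\in\tilde A}W_i^{(\beta)}$ compatibly, with $(W_i)_{[n]}\cap W_i^{(\beta)}$ finite-dimensional, $(W_i)_{[n+k]}\cap W_i^{(\beta)}=0$ for $k\in\mathbb Z$ sufficiently negative, $v_lW_i^{(\beta)}\subset W_i^{(\alpha+\beta)}$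 for $v\in V^{(\alpha)}$, and $L(j)W_i^{(\beta)}\subset W_i^{(\beta)}$ for $j=0,\pm1$. Let $\pi_n$ denote the projection onto weight $n$, and put $\overline{W_3}=\prod_{n\in\mathbb C}(W_3)_{[n]}$ and $\overline{W_3^{(\beta)}}=\prod_{n\in\mathbb C}\bigl((W_3)_{[n]}\cap W_3^{(\beta)}\bigr)$. Write $Y_i$ for the vertex operator map of $W_i$. Let $z\in\mathbb C^\times$, and put $l_p(z)=\log z+2\pi i p$ with $0\le\operatorname{Im}\log z<2\pi$. **Logarithmic intertwining operators.** Let $\mathcal V_{W_1W_2}^{W_3}$ be the vector space of linear maps $$\mathcal Y: W_1\otimes W_2\to W_3[\log x]\{x\},\qquad w_1\otimes w_2\mapsto\mathcal Y(w_1,x)w_2=\sum_{n\in\mathbb C}\sum_{k\in\mathbb N}(w_1)_{n;k}w_2\,x^{-n-1}(\log x)^k$$ (finitely many $k$ for each $n$) satisfying, for all $v\in V$, $w_1\in W_1$, $w_2\in W_2$: - lower truncation: for each $n\in\mathbb C$, $(w_1)_{n+m;k}w_2=0$ for $m\in\mathbb N$ sufficiently large, independently of $k$; - the Jacobi identity $$x_0^{-1}\delta\Bigl(\tfrac{x_1-x_2}{x_0}\Bigr)Y_3(v,x_1)\mathcal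 Y(w_1,x_2)w_2-x_0^{-1}\delta\Bigl(\tfrac{x_2-x_1}{-x_0}\Bigr)\mathcal Y(w_1,x_2)Y_2(v,x_1)w_2=x_2^{-1}\delta\Bigl(\tfrac{x_1-x_0}{x_2}\Bigr)\mathcal Y(Y_1(v,x_0)w_1,x_2)w_2;$$ - $\mathcal Y(L(-1)w_1,x)=\frac{d}{dx}\mathcal Y(w_1,x)$; - $[L(j),\mathcal Y(w_1,x)]=\sum_{i=0}^{j+1}\binom{j+1}{i}x^i\mathcal Y(L(j-i)w_1,x)$ for $j=-1,0,1$; - grading compatibility: $(w_1)_{n;k}w_2\in W_3^{(\beta+\gamma)}$ for $w_1\in W_1^{(\beta)}$, $w_2\in W_2^{(\gamma)}$ and all $n,k$. **$P(z)$-intertwining maps.** Let $\mathcal M_{W_1W_2}^{W_3}$ be the vector space of linear maps $I:W_1\otimes W_2\to\overline{W_3}$ satisfying, for all $v\in V$, $w_1\in W_1$, $w_2\in W_2$: - $I(w_1\otimes w_2)\in\overline{W_3^{(\beta+\gamma)}}$ for $w_1\in W_1^{(\beta)}$, $w_2\in W_2^{(\gamma)}$; - for each $n\in\mathbb C$, $\pi_{n-m}I(w_1\otimes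 w_2)=0$ for $m\in\mathbb N$ sufficiently large; - the Jacobi identity $$x_0^{-1}\delta\Bigl(\tfrac{x_1-z}{x_0}\Bigr)Y_3(v,x_1)I(w_1\otimes w_2)=z^{-1}\delta\Bigl(\tfrac{x_1-x_0}{z}\Bigr)I(Y_1(v,x_0)w_1\otimes w_2)+x_0^{-1}\delta\Bigl(\tfrac{z-x_1}{-x_0}\Bigr)I(w_1\otimes Y_2(v,x_1)w_2);$$ - $L(j)I(w_1\otimes w_2)=I(w_1\otimes L(j)w_2)+\sum_{i=0}^{j+1}\binom{j+1}{i}z^iI(L(j-i)w_1\otimes w_2)$ for $j=-1,0,1$. **The maps.** Let $p\in\mathbb Z$. For a formal series $f(x)$, let $f(e^\zeta)$ denote the result of substituting $x^n\mapsto e^{\zeta n}$ and $(\log x)^k\mapsto\zeta^k$. For $\mathcal Y\in\mathcal V_{W_1W_2}^{W_3}$ put $$I_{\mathcal Y,p}(w_1\otimes w_2)=\mathcal Y(w_1,e^{l_p(z)})w_2\in\overline{W_3}.$$ For $w$ of generalized weight $n$ put $x^{\pm L(0)}w=x^{\pm n}\sum_{i\ge0}\frac{(\pm\log x)^i}{i!}(L(0)-n)^iw$,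 and extend this linearly to $W_i$ and componentwise to $\overline{W_3}$. For $I\in\mathcal M_{W_1W_2}^{W_3}$ put $$\mathcal Y_{I,p}(w_1,x)w_2=y^{L(0)}x^{L(0)}I\bigl(y^{-L(0)}x^{-L(0)}w_1\otimes y^{-L(0)}x^{-L(0)}w_2\bigr)\Big|_{y=e^{-l_p(z)}}.$$ **Proposition 4.7.** For every $p\in\mathbb Z$, the element $\mathcal Y(w_1,e^{l_p(z)})w_2$ of $\overline{W_3}$ exists (each weight component is a finite sum), and $\mathcal Y\mapsto I_{\mathcal Y,p}$ is a linear isomorphism from $\mathcal V_{W_1W_2}^{W_3}$ onto $\mathcal M_{W_1W_2}^{W_3}$. Its inverse is $I\mapsto\mathcal Y_{I,p}$. -/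

import Mathlib

open scoped TensorProduct

noncomputable section

/-! ### Gradings and their projections -/

/-- `M` is the direct sum of the subspaces `G i`. -/
structure IsGrading {ι M : Type*} [AddCommGroup M] [Module ℂ M] (G : ι → Submodule ℂ M) :
    Prop where
  indep : iSupIndep G
  span : ⨆ i, G i = ⊤

open Classical in
theorem IsGrading.isInternal {ι M : Type*} [AddCommGroup M] [Module ℂ M]
    {G : ι → Submodule ℂ M} (h : IsGrading G) :
    Function.Bijective (DirectSum.coeLinearMap G) :=
  DirectSum.isInternal_submodule_of_iSupIndep_of_iSup_eq_top h.indep h.span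

open Classical in
/-- The projection of a graded space onto its component of degree `i`. -/
def IsGrading.proj {ι M : Type*} [AddCommGroup M] [Module ℂ M] {G : ι → Submodule ℂ M}
    (h : IsGrading G) (i : ι) : M →ₗ[ℂ] G i :=
  DirectSum.component ℂ ι (fun j => G j) i ∘ₗ
    (LinearEquiv.ofBijective (DirectSum.coeLinearMap G) h.isInternal).symm.toLinearMap

open Classical in
theorem IsGrading.proj_apply_of_ne {ι M : Type*} [AddCommGroup M] [Module ℂ M]
    {G : ι → Submodule ℂ M} (h : IsGrading G) {i j : ι} (hij : j ≠ i) {w : M} (hw : w ∈ G j) :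
    h.proj i w = 0 := by
  have key : (LinearEquiv.ofBijective (DirectSum.coeLinearMap G) h.isInternal).symm w
      = DirectSum.lof ℂ ι (fun j => G j) j ⟨w, hw⟩ := by
    rw [LinearEquiv.symm_apply_eq, LinearEquiv.ofBijective_apply, DirectSum.coeLinearMap_lof]
  rw [IsGrading.proj, LinearMap.comp_apply, LinearEquiv.coe_coe, key, DirectSum.component.of,
    dif_neg hij]

/-! ### Vertex algebras and their generalized modules

All identities between formal series are stated through their coefficients. In particular
`∑ᶠ` below always ranges over finitely many nonzero terms, by the truncation conditions. -/

/-- Operators of a vertex algebra `V` on a space `M`: the modes `mode n v = v_n` of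
`Y(v, x) = ∑ₙ v_n x^(-n-1)`, and `L(-1)`, `L(0)`, `L(1)`. -/
structure VertexAction (V M : Type*) [AddCommGroup V] [Module ℂ V]
    [AddCommGroup M] [Module ℂ M] where
  mode : ℤ → V →ₗ[ℂ] M →ₗ[ℂ] M
  Lneg : Module.End ℂ M
  Lzero : Module.End ℂ M
  Lpos : Module.End ℂ M

/-- Whether a vertex algebra is considered as a Möbius vertex algebra, or as a conformal vertex
algebra with conformal vector `ω` and central charge `c`. -/
inductive VertexKind (V : Type*)
  | mobius : VertexKind V
  | conformal (ω : V) (c : ℂ) : VertexKind V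

/-- The binomial coefficient `l (l-1) ⋯ (l-i+1) / i!` of an arbitrary integer `l`. -/
def binom (l : ℤ) (i : ℕ) : ℂ := ((Ring.choose l i : ℤ) : ℂ)

theorem binom_zero (i : ℕ) : binom 0 i = if i = 0 then 1 else 0 := by
  have h := Ring.choose_natCast (R := ℤ) 0 i
  rw [Nat.cast_zero] at h
  rw [binom, h]
  cases i <;> simp

theorem binom_one (i : ℕ) : binom 1 i = (Nat.choose 1 i : ℂ) := by
  have h := Ring.choose_natCast (R := ℤ) 1 i
  rw [Nat.cast_one] at h
  rw [binom, h]
  simp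

section Axioms

variable {V M : Type*} [AddCommGroup V] [Module ℂ V] [AddCommGroup M] [Module ℂ M]

/-- The Jacobi identity for the vertex operators `X` on `M` of elements of `V`, where `Y` are the
vertex operators on `V`: the coefficient of `x₀^(-l-1) x₁^(-m-1) x₂^(-n-1)` in
`x₀⁻¹ δ((x₁-x₂)/x₀) Y(u,x₁) Y(v,x₂) w - x₀⁻¹ δ((x₂-x₁)/(-x₀)) Y(v,x₂) Y(u,x₁) w
  = x₂⁻¹ δ((x₁-x₀)/x₂) Y(Y(u,x₀)v,x₂) w`. -/
def JacobiIdentity (Y : VertexAction V V) (X : VertexAction V M) : Prop :=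
  ∀ (u v : V) (w : M) (l m n : ℤ),
    (∑ᶠ i : ℕ, ((-1 : ℂ) ^ i * binom l i) •
        X.mode (l + m - i) u (X.mode (n + i) v w))
      - (∑ᶠ i : ℕ, ((-1 : ℂ) ^ l * (-1 : ℂ) ^ i * binom l i) •
        X.mode (l + n - i) v (X.mode (m + i) u w))
      = ∑ᶠ i : ℕ, binom m i • X.mode (m + n - i) (Y.mode (l + i) u v) w

/-- The `sl(2)` relations for `L(-1), L(0), L(1)` on `M`, and
`[L(j), Y(v,x)] = ∑ₖ (j+1 choose k) x^k Y(L(j-k)v, x)` for `j = -1, 0, 1`. -/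
structure MobiusAxioms (Y : VertexAction V V) (X : VertexAction V M) : Prop where
  zero_neg : X.Lzero * X.Lneg - X.Lneg * X.Lzero = X.Lneg
  zero_pos : X.Lzero * X.Lpos - X.Lpos * X.Lzero = -X.Lpos
  neg_pos : X.Lneg * X.Lpos - X.Lpos * X.Lneg = (-2 : ℂ) • X.Lzero
  bracket_neg : ∀ (v : V) (n : ℤ) (w : M),
    X.Lneg (X.mode n v w) - X.mode n v (X.Lneg w) = X.mode n (Y.Lneg v) w
  bracket_zero : ∀ (v : V) (n : ℤ) (w : M),
    X.Lzero (X.mode n v w) - X.mode n v (X.Lzero w)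
      = X.mode n (Y.Lzero v) w + X.mode (n + 1) (Y.Lneg v) w
  bracket_pos : ∀ (v : V) (n : ℤ) (w : M),
    X.Lpos (X.mode n v w) - X.mode n v (X.Lpos w)
      = X.mode n (Y.Lpos v) w + (2 : ℂ) • X.mode (n + 1) (Y.Lzero v) w
        + X.mode (n + 2) (Y.Lneg v) w

/-- `L(j) = ω_{j+1}` for `j = -1, 0, 1`, and the Virasoro relations of central charge `c` for the
operators `L(n) = ω_{n+1}` on `M`. -/
structure ConformalAxioms (ω : V) (c : ℂ) (X : VertexAction V M) : Prop where
  neg_eq : X.Lneg = X.mode 0 ω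
  zero_eq : X.Lzero = X.mode 1 ω
  pos_eq : X.Lpos = X.mode 2 ω
  virasoro : ∀ m n : ℤ,
    X.mode (m + 1) ω ∘ₗ X.mode (n + 1) ω - X.mode (n + 1) ω ∘ₗ X.mode (m + 1) ω
      = ((m : ℂ) - n) • X.mode (m + n + 1) ω
        + (if n + m = 0 then ((m : ℂ) ^ 3 - m) / 12 * c else 0) • LinearMap.id

def VertexKind.Axioms (κ : VertexKind V) (Y : VertexAction V V) (X : VertexAction V M) : Prop :=
  match κ with
  | .mobius => MobiusAxioms Y X
  | .conformal ω c => ConformalAxioms ω c X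

/-- The axioms common to a vertex algebra (`M = V`, `X = Y`) and to its modules. -/
structure ActionAxioms (κ : VertexKind V) (one : V) (Y : VertexAction V V)
    (X : VertexAction V M) : Prop where
  lower_truncation : ∀ (v : V) (w : M), ∃ N : ℤ, ∀ n ≥ N, X.mode n v w = 0
  vacuum : ∀ (n : ℤ) (w : M), X.mode n one w = if n = -1 then w else 0
  jacobi : JacobiIdentity Y X
  /-- `Y(L(-1)v, x) = (d/dx) Y(v, x)`. -/
  derivative : ∀ (v : V) (n : ℤ) (w : M), X.mode n (Y.Lneg v) w = (-(n : ℂ)) • X.mode (n - 1) v w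
  kind_axioms : κ.Axioms Y X

/-- The subspace of weight `k` of a vertex algebra: the `L(0)`-eigenspace. -/
def VertexAction.eigen (X : VertexAction V M) (k : ℤ) : Submodule ℂ M :=
  Module.End.eigenspace X.Lzero (k : ℂ)

/-- The subspace `M_[n]` of generalized weight `n`: the generalized `L(0)`-eigenspace. -/
def VertexAction.wt (X : VertexAction V M) (n : ℂ) : Submodule ℂ M :=
  Module.End.maxGenEigenspace X.Lzero n

end Axioms

/-- A Möbius or conformal vertex algebra. The grading by weights is the one by the
eigenspaces of `L(0)`. -/
structure MCVertexAlgebra (V : Type*) [AddCommGroup V] [Module ℂ V] extends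
    VertexAction V V where
  kind : VertexKind V
  one : V
  grading : IsGrading (fun k : ℤ => toVertexAction.eigen k)
  action_axioms : ActionAxioms kind one toVertexAction toVertexAction
  creation_regular : ∀ (v : V) (n : ℤ), 0 ≤ n → mode n v one = 0
  creation : ∀ v : V, mode (-1) v one = v
  one_mem : one ∈ toVertexAction.eigen 0
  omega_mem : ∀ (ω : V) (c : ℂ), kind = .conformal ω c → ω ∈ toVertexAction.eigen 2

/-- A generalized module for a Möbius or conformal vertex algebra. -/
structure GenModule {V : Type*} [AddCommGroup V] [Module ℂ V] (𝒱 : MCVertexAlgebra V)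
    (W : Type*) [AddCommGroup W] [Module ℂ W] extends VertexAction V W where
  grading : IsGrading (fun n : ℂ => toVertexAction.wt n)
  action_axioms : ActionAxioms 𝒱.kind 𝒱.one 𝒱.toVertexAction toVertexAction

/-- A Möbius or conformal vertex algebra strongly graded with respect to the abelian group `A`. -/
structure StronglyGradedVertexAlgebra {Atilde : Type*} [AddCommGroup Atilde]
    (A : AddSubgroup Atilde) (V : Type*) [AddCommGroup V] [Module ℂ V] extends
    MCVertexAlgebra V where
  gr : A → Submodule ℂ V
  gr_grading : IsGrading gr
  compatible : ∀ α, gr α = ⨆ k : ℤ, toVertexAction.eigen k ⊓ gr α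
  bounded_below : ∀ α, ∃ N : ℤ, ∀ k ≤ N, toVertexAction.eigen k ⊓ gr α = ⊥
  finite_dimensional : ∀ (α : A) (k : ℤ),
    FiniteDimensional ℂ (toVertexAction.eigen k ⊓ gr α : Submodule ℂ V)
  one_mem_gr : one ∈ gr 0
  mode_mem : ∀ (α β : A) (v w : V) (l : ℤ), v ∈ gr α → w ∈ gr β → mode l v w ∈ gr (α + β)
  Lneg_mem : ∀ (α : A) (v : V), v ∈ gr α → Lneg v ∈ gr α
  Lzero_mem : ∀ (α : A) (v : V), v ∈ gr α → Lzero v ∈ gr α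
  Lpos_mem : ∀ (α : A) (v : V), v ∈ gr α → Lpos v ∈ gr α
  omega_mem_gr : ∀ (ω : V) (c : ℂ), kind = .conformal ω c → ω ∈ gr 0

/-- A generalized module strongly graded with respect to the abelian group `Atilde`, which contains
`A` as a subgroup. -/
structure StronglyGradedGenModule {Atilde : Type*} [AddCommGroup Atilde]
    {A : AddSubgroup Atilde} {V : Type*} [AddCommGroup V] [Module ℂ V]
    (𝒱 : StronglyGradedVertexAlgebra A V) (W : Type*) [AddCommGroup W] [Module ℂ W] extends
    GenModule 𝒱.toMCVertexAlgebra W where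
  gr : Atilde → Submodule ℂ W
  gr_grading : IsGrading gr
  compatible : ∀ β, gr β = ⨆ n : ℂ, toVertexAction.wt n ⊓ gr β
  bounded_below : ∀ (β : Atilde) (n : ℂ), ∃ K : ℤ, ∀ k ≤ K,
    toVertexAction.wt (n + k) ⊓ gr β = ⊥
  finite_dimensional : ∀ (β : Atilde) (n : ℂ),
    FiniteDimensional ℂ (toVertexAction.wt n ⊓ gr β : Submodule ℂ W)
  mode_mem : ∀ (α : A) (β : Atilde) (v : V) (w : W) (l : ℤ), v ∈ 𝒱.gr α → w ∈ gr β →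
    mode l v w ∈ gr (α + β)
  Lneg_mem : ∀ (β : Atilde) (w : W), w ∈ gr β → Lneg w ∈ gr β
  Lzero_mem : ∀ (β : Atilde) (w : W), w ∈ gr β → Lzero w ∈ gr β
  Lpos_mem : ∀ (β : Atilde) (w : W), w ∈ gr β → Lpos w ∈ gr β

/-! ### Completions -/

section Completion

variable {V W : Type*} [AddCommGroup V] [Module ℂ V] [AddCommGroup W] [Module ℂ W]
  {𝒱 : MCVertexAlgebra V}

/-- The projection `π_n : W → W_[n]`. -/
def GenModule.π (𝒲 : GenModule 𝒱 W) (n : ℂ) : W →ₗ[ℂ] 𝒲.wt n := 𝒲.grading.proj n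

/-- The formal completion `∏ₙ W_[n]` of `W`. -/
abbrev GenModule.Completion (𝒲 : GenModule 𝒱 W) : Type _ := ∀ n : ℂ, 𝒲.wt n

/-- The inclusion of `W` into its completion. -/
def GenModule.toCompletion (𝒲 : GenModule 𝒱 W) (w : W) : 𝒲.Completion := fun n => 𝒲.π n w

/-- The extension to the completion of a mode `v_n` or of `L(j)`: the component of degree `r` of
`T (∑_q w_q)` is `∑_q π_r (T w_q)`, a finite sum because `T` changes weights by
finitely many values only. -/
def GenModule.extend (𝒲 : GenModule 𝒱 W) (T : Module.End ℂ W) (w : 𝒲.Completion) :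
    𝒲.Completion :=
  fun r => ∑ᶠ q : ℂ, 𝒲.π r (T (w q))

theorem GenModule.bracket_zero (𝒲 : GenModule 𝒱 W) (v : V) (n : ℤ) (w : W) :
    𝒲.Lzero (𝒲.mode n v w) - 𝒲.mode n v (𝒲.Lzero w)
      = 𝒲.mode n (𝒱.Lzero v) w + 𝒲.mode (n + 1) (𝒱.Lneg v) w := by
  have hW := 𝒲.action_axioms.kind_axioms
  have hV := 𝒱.action_axioms.kind_axioms
  cases hk : 𝒱.kind with
  | mobius =>
    rw [hk] at hW
    exact MobiusAxioms.bracket_zero hW v n w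
  | conformal ω c =>
    rw [hk] at hW hV
    have hW' : ConformalAxioms ω c 𝒲.toVertexAction := hW
    have hV' : ConformalAxioms ω c 𝒱.toVertexAction := hV
    have h := 𝒲.action_axioms.jacobi ω v w 0 1 n
    have e1 : ∀ f : ℕ → W, (∑ᶠ i : ℕ, ((-1 : ℂ) ^ i * binom 0 i) • f i) = f 0 := by
      intro f
      rw [finsum_eq_single _ 0]
      · simp [binom_zero]
      · intro i hi
        simp [binom_zero, hi]
    have e2 : ∀ f : ℕ → W,
        (∑ᶠ i : ℕ, ((-1 : ℂ) ^ (0 : ℤ) * (-1 : ℂ) ^ i * binom 0 i) • f i) = f 0 := by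
      intro f
      rw [finsum_eq_single _ 0]
      · simp [binom_zero]
      · intro i hi
        simp [binom_zero, hi]
    have e3 : ∀ f : ℕ → W, (∑ᶠ i : ℕ, binom 1 i • f i) = f 0 + f 1 := by
      intro f
      rw [finsum_eq_sum_of_support_subset (s := Finset.range 2)]
      · simp [Finset.sum_range_succ, binom_one]
      · intro i hi
        by_contra hn
        apply hi
        have : 1 < i := by
          simp only [Finset.coe_range, Set.mem_Iio] at hn
          omega
        simp [binom_one, Nat.choose_eq_zero_of_lt this]
    rw [e1, e2, e3] at h
    rw [hW'.zero_eq, hV'.zero_eq, hV'.neg_eq]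
    simp only [Nat.cast_zero, Nat.cast_one, zero_add, add_zero, sub_zero] at h
    rw [h, add_comm, add_comm (1 : ℤ) n, add_sub_cancel_right]

/-- `v_n` raises weights by `wt v - n - 1`. -/
theorem GenModule.mode_mem_wt (𝒲 : GenModule 𝒱 W) {k : ℤ} {v : V} (hv : v ∈ 𝒱.eigen k)
    (n : ℤ) {q : ℂ} {w : W} (hw : w ∈ 𝒲.wt q) : 𝒲.mode n v w ∈ 𝒲.wt (q + k - n - 1) := by
  have comm : ∀ w : W, (𝒲.Lzero - (q + k - n - 1) • (1 : Module.End ℂ W)) (𝒲.mode n v w)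
      = 𝒲.mode n v ((𝒲.Lzero - q • (1 : Module.End ℂ W)) w) := by
    intro w
    have h := 𝒲.bracket_zero v n w
    have hd := 𝒲.action_axioms.derivative v (n + 1) w
    have hL : 𝒱.Lzero v = (k : ℂ) • v := Module.End.mem_eigenspace_iff.mp hv
    rw [hd, hL, sub_eq_iff_eq_add] at h
    simp only [LinearMap.sub_apply, LinearMap.smul_apply, Module.End.one_apply, map_sub, map_smul,
      h, add_sub_cancel_right]
    push_cast
    module
  have pw : ∀ (t : ℕ) (w : W),
      ((𝒲.Lzero - (q + k - n - 1) • (1 : Module.End ℂ W)) ^ t) (𝒲.mode n v w)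
        = 𝒲.mode n v (((𝒲.Lzero - q • (1 : Module.End ℂ W)) ^ t) w) := by
    intro t
    induction t with
    | zero => intro w; simp
    | succ t ih =>
      intro w
      rw [pow_succ, pow_succ, Module.End.mul_apply, Module.End.mul_apply, comm, ih]
  obtain ⟨t, ht⟩ := (Module.End.mem_maxGenEigenspace _ _ _).mp hw
  refine (Module.End.mem_maxGenEigenspace _ _ _).mpr ⟨t, ?_⟩
  rw [pw, ht, map_zero]

/-- The modes of `v` change weights by `k - n - 1` with `k` in a finite set. -/
theorem GenModule.exists_finite_shift (𝒲 : GenModule 𝒱 W) (v : V) :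
    ∃ K : Set ℤ, K.Finite ∧ ∀ (n : ℤ) (q r : ℂ) (w : W), w ∈ 𝒲.wt q →
      (∀ k ∈ K, r ≠ q + k - n - 1) → 𝒲.π r (𝒲.mode n v w) = 0 := by
  have hv : v ∈ ⨆ k : ℤ, 𝒱.eigen k := by
    rw [𝒱.grading.span]; trivial
  induction hv using Submodule.iSup_induction' with
  | mem k v hv =>
    refine ⟨{k}, Set.finite_singleton k, ?_⟩
    intro n q r w hw hr
    exact 𝒲.grading.proj_apply_of_ne (hr k rfl).symm (𝒲.mode_mem_wt hv n hw)
  | zero => exact ⟨∅, Set.finite_empty, by intros; simp⟩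
  | add v v' _ _ h h' =>
    obtain ⟨K, hK, h⟩ := h
    obtain ⟨K', hK', h'⟩ := h'
    refine ⟨K ∪ K', hK.union hK', ?_⟩
    intro n q r w hw hr
    rw [map_add, LinearMap.add_apply, map_add,
      h n q r w hw (fun k hk => hr k (Or.inl hk)), h' n q r w hw (fun k hk => hr k (Or.inr hk)),
      add_zero]

/-- If `[L(0), T] = d T`, then `T` raises weights by `d`. -/
theorem GenModule.shift_mem_wt (𝒲 : GenModule 𝒱 W) {T : Module.End ℂ W} {d : ℂ}
    (hT : 𝒲.Lzero * T - T * 𝒲.Lzero = d • T) {q : ℂ} {w : W} (hw : w ∈ 𝒲.wt q) :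
    T w ∈ 𝒲.wt (q + d) := by
  have comm : ∀ w : W, (𝒲.Lzero - (q + d) • (1 : Module.End ℂ W)) (T w)
      = T ((𝒲.Lzero - q • (1 : Module.End ℂ W)) w) := by
    intro w
    have h := LinearMap.congr_fun hT w
    simp only [LinearMap.sub_apply, Module.End.mul_apply, LinearMap.smul_apply,
      sub_eq_iff_eq_add] at h
    simp only [LinearMap.sub_apply, LinearMap.smul_apply, Module.End.one_apply, map_sub, map_smul,
      h]
    module
  have pw : ∀ (t : ℕ) (w : W), ((𝒲.Lzero - (q + d) • (1 : Module.End ℂ W)) ^ t) (T w)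
      = T (((𝒲.Lzero - q • (1 : Module.End ℂ W)) ^ t) w) := by
    intro t
    induction t with
    | zero => intro w; simp
    | succ t ih =>
      intro w
      rw [pow_succ, pow_succ, Module.End.mul_apply, Module.End.mul_apply, comm, ih]
  obtain ⟨t, ht⟩ := (Module.End.mem_maxGenEigenspace _ _ _).mp hw
  refine (Module.End.mem_maxGenEigenspace _ _ _).mpr ⟨t, ?_⟩
  rw [pw, ht, map_zero]

/-- `[L(0), L(j)] = -j L(j)` for `j = -1, 0, 1`. -/
theorem GenModule.bracket_L (𝒲 : GenModule 𝒱 W) :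
    𝒲.Lzero * 𝒲.Lneg - 𝒲.Lneg * 𝒲.Lzero = (1 : ℂ) • 𝒲.Lneg ∧
      𝒲.Lzero * 𝒲.Lzero - 𝒲.Lzero * 𝒲.Lzero = (0 : ℂ) • 𝒲.Lzero ∧
      𝒲.Lzero * 𝒲.Lpos - 𝒲.Lpos * 𝒲.Lzero = (-1 : ℂ) • 𝒲.Lpos := by
  have hW := 𝒲.action_axioms.kind_axioms
  cases hk : 𝒱.kind with
  | mobius =>
    rw [hk] at hW
    have hW' : MobiusAxioms 𝒱.toVertexAction 𝒲.toVertexAction := hW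
    exact ⟨by rw [hW'.zero_neg, one_smul], by simp, by rw [hW'.zero_pos, neg_smul, one_smul]⟩
  | conformal ω c =>
    rw [hk] at hW
    have hW' : ConformalAxioms ω c 𝒲.toVertexAction := hW
    refine ⟨?_, by simp, ?_⟩
    · have h := hW'.virasoro 0 (-1)
      norm_num at h
      rw [hW'.zero_eq, hW'.neg_eq, one_smul]
      exact h
    · have h := hW'.virasoro 0 1
      norm_num at h
      rw [hW'.zero_eq, hW'.pos_eq, neg_smul, one_smul]
      exact h

/-- `T` changes weights by finitely many values only. -/
def GenModule.FiniteShift (𝒲 : GenModule 𝒱 W) (T : Module.End ℂ W) : Prop :=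
  ∀ r : ℂ, {q : ℂ | ∃ w ∈ 𝒲.wt q, 𝒲.π r (T w) ≠ 0}.Finite

theorem GenModule.finiteShift_mode (𝒲 : GenModule 𝒱 W) (n : ℤ) (v : V) :
    𝒲.FiniteShift (𝒲.mode n v) := by
  intro r
  obtain ⟨K, hK, h⟩ := 𝒲.exists_finite_shift v
  refine (hK.image (fun k : ℤ => r - k + n + 1)).subset ?_
  rintro q ⟨w, hw, hne⟩
  by_contra hq
  refine hne (h n q r w hw fun k hk hr => hq ⟨k, hk, ?_⟩)
  simp only [hr]
  ring

theorem GenModule.finiteShift_of_bracket (𝒲 : GenModule 𝒱 W) {T : Module.End ℂ W} {d : ℂ}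
    (hT : 𝒲.Lzero * T - T * 𝒲.Lzero = d • T) : 𝒲.FiniteShift T := by
  intro r
  refine (Set.finite_singleton (r - d)).subset ?_
  rintro q ⟨w, hw, hne⟩
  by_contra hq
  refine hne (𝒲.grading.proj_apply_of_ne (fun hr => hq ?_) (𝒲.shift_mem_wt hT hw))
  rw [Set.mem_singleton_iff, ← hr]
  ring

theorem GenModule.finiteShift_Lneg (𝒲 : GenModule 𝒱 W) : 𝒲.FiniteShift 𝒲.Lneg :=
  𝒲.finiteShift_of_bracket 𝒲.bracket_L.1

theorem GenModule.finiteShift_Lzero (𝒲 : GenModule 𝒱 W) : 𝒲.FiniteShift 𝒲.Lzero :=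
  𝒲.finiteShift_of_bracket 𝒲.bracket_L.2.1

theorem GenModule.finiteShift_Lpos (𝒲 : GenModule 𝒱 W) : 𝒲.FiniteShift 𝒲.Lpos :=
  𝒲.finiteShift_of_bracket 𝒲.bracket_L.2.2

theorem GenModule.FiniteShift.finite_support {𝒲 : GenModule 𝒱 W} {T : Module.End ℂ W}
    (hT : 𝒲.FiniteShift T) (w : 𝒲.Completion) (r : ℂ) :
    (Function.support fun q : ℂ => 𝒲.π r (T (w q))).Finite :=
  (hT r).subset fun q hq => ⟨w q, (w q).2, hq⟩

theorem GenModule.FiniteShift.extend_add {𝒲 : GenModule 𝒱 W} {T : Module.End ℂ W}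
    (hT : 𝒲.FiniteShift T) (w w' : 𝒲.Completion) :
    𝒲.extend T (w + w') = 𝒲.extend T w + 𝒲.extend T w' := by
  funext r
  simp only [GenModule.extend, Pi.add_apply]
  rw [← finsum_add_distrib (hT.finite_support w r) (hT.finite_support w' r)]
  simp

theorem GenModule.extend_smul (𝒲 : GenModule 𝒱 W) (T : Module.End ℂ W) (a : ℂ)
    (w : 𝒲.Completion) : 𝒲.extend T (a • w) = a • 𝒲.extend T w := by
  funext r
  simp only [GenModule.extend, Pi.smul_apply, smul_finsum]
  simp

theorem GenModule.extend_zero (𝒲 : GenModule 𝒱 W) (T : Module.End ℂ W) :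
    𝒲.extend T 0 = 0 := by
  funext r
  simp [GenModule.extend]

/-- Lower truncation in the completion: `π_{n-m} w = 0` for `m ∈ ℕ` sufficiently large. -/
def GenModule.LowerTruncated (𝒲 : GenModule 𝒱 W) (w : 𝒲.Completion) : Prop :=
  ∀ n : ℂ, ∃ M : ℕ, ∀ m ≥ M, w (n - (m : ℂ)) = 0

/-- An infinite linear combination of the `v_s` with `s` bounded above acts on lower truncated
elements of the completion. -/
theorem GenModule.LowerTruncated.finite_support {𝒲 : GenModule 𝒱 W} {w : 𝒲.Completion}
    (hw : 𝒲.LowerTruncated w) (v : V) (s : ℤ) (a : ℕ → ℂ) (r : ℂ) :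
    (Function.support fun i : ℕ => a i • 𝒲.extend (𝒲.mode (s - i) v) w r).Finite := by
  obtain ⟨K, hK, h⟩ := 𝒲.exists_finite_shift v
  choose M hM using hw
  refine (hK.biUnion (t := fun k : ℤ => Set.Iio (M (r - k + s + 1)))
    fun k _ => Set.finite_Iio _).subset ?_
  intro i hi
  by_contra hn
  apply hi
  have : 𝒲.extend (𝒲.mode (s - i) v) w r = 0 := by
    refine finsum_eq_zero_of_forall_eq_zero fun q => ?_
    by_cases hq : ∃ k ∈ K, r = q + k - ((s - i : ℤ) : ℂ) - 1
    · obtain ⟨k, hk, hr⟩ := hq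
      have hiM : M (r - k + s + 1) ≤ i := by
        by_contra hlt
        exact hn (Set.mem_biUnion hk (not_le.mp hlt))
      have hq' : q = r - k + s + 1 - (i : ℂ) := by
        rw [hr]; push_cast; ring
      have := hM _ i hiM
      rw [← hq'] at this
      simp [this]
    · push Not at hq
      exact h _ q r _ (w q).2 hq
  simp [this]

end Completion

/-! ### Logarithmic intertwining operators

The space `W[log x]{x}` of formal series `∑_{a ∈ ℂ} ∑_{k ∈ ℕ} f a k x^a (log x)^k`, with finitely
many powers of `log x` for each power of `x`, is `ℂ → ℕ →₀ W`. -/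

section Log

variable {V W₁ W₂ W₃ : Type*} [AddCommGroup V] [Module ℂ V] [AddCommGroup W₁] [Module ℂ W₁]
  [AddCommGroup W₂] [Module ℂ W₂] [AddCommGroup W₃] [Module ℂ W₃]

/-- The coefficient `(w₁)_{n;k} w₂` of `x^(-n-1) (log x)^k` in `𝒴(w₁, x) w₂`. -/
def logMode (𝒴 : W₁ ⊗[ℂ] W₂ →ₗ[ℂ] (ℂ → ℕ →₀ W₃)) (n : ℂ) (k : ℕ) (w₁ : W₁) (w₂ : W₂) : W₃ :=
  𝒴 (w₁ ⊗ₜ w₂) (-n - 1) k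

/-- `𝒴` is a logarithmic intertwining operator. -/
structure IsLogIntertwining {𝒱 : MCVertexAlgebra V} (𝒲₁ : GenModule 𝒱 W₁)
    (𝒲₂ : GenModule 𝒱 W₂) (𝒲₃ : GenModule 𝒱 W₃)
    (𝒴 : W₁ ⊗[ℂ] W₂ →ₗ[ℂ] (ℂ → ℕ →₀ W₃)) : Prop where
  lower_truncation : ∀ (w₁ : W₁) (w₂ : W₂) (n : ℂ), ∃ M : ℕ, ∀ m ≥ M, ∀ k : ℕ,
    logMode 𝒴 (n + (m : ℂ)) k w₁ w₂ = 0
  /-- The coefficient of `x₀^(-l-1) x₁^(-m-1) x₂^(-n-1) (log x₂)^k` in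
  `x₀⁻¹ δ((x₁-x₂)/x₀) Y₃(v,x₁) 𝒴(w₁,x₂) w₂ - x₀⁻¹ δ((x₂-x₁)/(-x₀)) 𝒴(w₁,x₂) Y₂(v,x₁) w₂
    = x₂⁻¹ δ((x₁-x₀)/x₂) 𝒴(Y₁(v,x₀)w₁,x₂) w₂`. -/
  jacobi : ∀ (v : V) (w₁ : W₁) (w₂ : W₂) (l m : ℤ) (n : ℂ) (k : ℕ),
    (∑ᶠ i : ℕ, ((-1 : ℂ) ^ i * binom l i) •
        𝒲₃.mode (l + m - i) v (logMode 𝒴 (n + (i : ℂ)) k w₁ w₂))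
      - (∑ᶠ i : ℕ, ((-1 : ℂ) ^ l * (-1 : ℂ) ^ i * binom l i) •
        logMode 𝒴 (n + l - (i : ℂ)) k w₁ (𝒲₂.mode (m + i) v w₂))
      = ∑ᶠ i : ℕ, binom m i • logMode 𝒴 (n + m - (i : ℂ)) k (𝒲₁.mode (l + i) v w₁) w₂
  /-- `𝒴(L(-1)w₁, x) = (d/dx) 𝒴(w₁, x)`, where `(d/dx) (log x)^k = k x⁻¹ (log x)^(k-1)`. -/
  derivative : ∀ (w₁ : W₁) (w₂ : W₂) (n : ℂ) (k : ℕ),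
    logMode 𝒴 n k (𝒲₁.Lneg w₁) w₂
      = (-n) • logMode 𝒴 (n - 1) k w₁ w₂ + ((k : ℂ) + 1) • logMode 𝒴 (n - 1) (k + 1) w₁ w₂
  bracket_neg : ∀ (w₁ : W₁) (w₂ : W₂) (n : ℂ) (k : ℕ),
    𝒲₃.Lneg (logMode 𝒴 n k w₁ w₂) - logMode 𝒴 n k w₁ (𝒲₂.Lneg w₂)
      = logMode 𝒴 n k (𝒲₁.Lneg w₁) w₂
  bracket_zero : ∀ (w₁ : W₁) (w₂ : W₂) (n : ℂ) (k : ℕ),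
    𝒲₃.Lzero (logMode 𝒴 n k w₁ w₂) - logMode 𝒴 n k w₁ (𝒲₂.Lzero w₂)
      = logMode 𝒴 n k (𝒲₁.Lzero w₁) w₂ + logMode 𝒴 (n + 1) k (𝒲₁.Lneg w₁) w₂
  bracket_pos : ∀ (w₁ : W₁) (w₂ : W₂) (n : ℂ) (k : ℕ),
    𝒲₃.Lpos (logMode 𝒴 n k w₁ w₂) - logMode 𝒴 n k w₁ (𝒲₂.Lpos w₂)
      = logMode 𝒴 n k (𝒲₁.Lpos w₁) w₂ + (2 : ℂ) • logMode 𝒴 (n + 1) k (𝒲₁.Lzero w₁) w₂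
        + logMode 𝒴 (n + 2) k (𝒲₁.Lneg w₁) w₂

theorem logMode_add (𝒴 𝒴' : W₁ ⊗[ℂ] W₂ →ₗ[ℂ] (ℂ → ℕ →₀ W₃)) (n : ℂ) (k : ℕ) (w₁ : W₁)
    (w₂ : W₂) : logMode (𝒴 + 𝒴') n k w₁ w₂ = logMode 𝒴 n k w₁ w₂ + logMode 𝒴' n k w₁ w₂ := rfl

theorem logMode_smul (a : ℂ) (𝒴 : W₁ ⊗[ℂ] W₂ →ₗ[ℂ] (ℂ → ℕ →₀ W₃)) (n : ℂ) (k : ℕ) (w₁ : W₁)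
    (w₂ : W₂) : logMode (a • 𝒴) n k w₁ w₂ = a • logMode 𝒴 n k w₁ w₂ := rfl

theorem logMode_zero (n : ℂ) (k : ℕ) (w₁ : W₁) (w₂ : W₂) :
    logMode (0 : W₁ ⊗[ℂ] W₂ →ₗ[ℂ] (ℂ → ℕ →₀ W₃)) n k w₁ w₂ = 0 := rfl

theorem logMode_zero_left (𝒴 : W₁ ⊗[ℂ] W₂ →ₗ[ℂ] (ℂ → ℕ →₀ W₃)) (n : ℂ) (k : ℕ) (w₂ : W₂) :
    logMode 𝒴 n k 0 w₂ = 0 := by simp [logMode]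

theorem logMode_zero_right (𝒴 : W₁ ⊗[ℂ] W₂ →ₗ[ℂ] (ℂ → ℕ →₀ W₃)) (n : ℂ) (k : ℕ) (w₁ : W₁) :
    logMode 𝒴 n k w₁ 0 = 0 := by simp [logMode]

theorem finite_support_of_eventually {M : Type*} [AddCommGroup M] [Module ℂ M] (a : ℕ → ℂ)
    (f : ℕ → M) (N : ℕ) (h : ∀ i ≥ N, f i = 0) :
    (Function.support fun i => a i • f i).Finite := by
  refine (Set.finite_Iio N).subset fun i hi => ?_
  by_contra hn
  exact hi (by simp [h i (not_lt.mp hn)])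

theorem GenModule.exists_nat_truncation {𝒱 : MCVertexAlgebra V} (𝒲₁ : GenModule 𝒱 W₁)
    (v : V) (w : W₁) (s : ℤ) : ∃ N : ℕ, ∀ i ≥ N, 𝒲₁.mode (s + (i : ℤ)) v w = 0 := by
  obtain ⟨N, hN⟩ := 𝒲₁.action_axioms.lower_truncation v w
  exact ⟨(N - s).toNat, fun i hi => hN _ (by omega)⟩

theorem IsLogIntertwining.add {𝒱 : MCVertexAlgebra V} {𝒲₁ : GenModule 𝒱 W₁}
    {𝒲₂ : GenModule 𝒱 W₂} {𝒲₃ : GenModule 𝒱 W₃} {𝒴 𝒴' : W₁ ⊗[ℂ] W₂ →ₗ[ℂ] (ℂ → ℕ →₀ W₃)}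
    (h : IsLogIntertwining 𝒲₁ 𝒲₂ 𝒲₃ 𝒴) (h' : IsLogIntertwining 𝒲₁ 𝒲₂ 𝒲₃ 𝒴') :
    IsLogIntertwining 𝒲₁ 𝒲₂ 𝒲₃ (𝒴 + 𝒴') where
  lower_truncation := by
    intro w₁ w₂ n
    obtain ⟨M, hM⟩ := h.lower_truncation w₁ w₂ n
    obtain ⟨M', hM'⟩ := h'.lower_truncation w₁ w₂ n
    refine ⟨max M M', fun m hm k => ?_⟩
    rw [logMode_add, hM m (le_trans (le_max_left _ _) hm), hM' m (le_trans (le_max_right _ _) hm),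
      add_zero]
  jacobi := by
    intro v w₁ w₂ l m n k
    have f1 : ∀ {𝒴 : W₁ ⊗[ℂ] W₂ →ₗ[ℂ] (ℂ → ℕ →₀ W₃)}, IsLogIntertwining 𝒲₁ 𝒲₂ 𝒲₃ 𝒴 →
        (Function.support fun i : ℕ => ((-1 : ℂ) ^ i * binom l i) •
          𝒲₃.mode (l + m - i) v (logMode 𝒴 (n + (i : ℂ)) k w₁ w₂)).Finite := by
      intro 𝒴 h
      obtain ⟨M, hM⟩ := h.lower_truncation w₁ w₂ n
      exact finite_support_of_eventually _ _ M fun i hi => by rw [hM i hi, map_zero]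
    have f2 : ∀ 𝒴 : W₁ ⊗[ℂ] W₂ →ₗ[ℂ] (ℂ → ℕ →₀ W₃),
        (Function.support fun i : ℕ => ((-1 : ℂ) ^ l * (-1 : ℂ) ^ i * binom l i) •
          logMode 𝒴 (n + l - (i : ℂ)) k w₁ (𝒲₂.mode (m + i) v w₂)).Finite := by
      intro 𝒴
      obtain ⟨N, hN⟩ := 𝒲₂.exists_nat_truncation v w₂ m
      exact finite_support_of_eventually _ _ N fun i hi => by rw [hN i hi, logMode_zero_right]
    have f3 : ∀ 𝒴 : W₁ ⊗[ℂ] W₂ →ₗ[ℂ] (ℂ → ℕ →₀ W₃),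
        (Function.support fun i : ℕ => binom m i •
          logMode 𝒴 (n + m - (i : ℂ)) k (𝒲₁.mode (l + i) v w₁) w₂).Finite := by
      intro 𝒴
      obtain ⟨N, hN⟩ := 𝒲₁.exists_nat_truncation v w₁ l
      exact finite_support_of_eventually _ _ N fun i hi => by rw [hN i hi, logMode_zero_left]
    simp only [logMode_add, map_add, smul_add]
    rw [finsum_add_distrib (f1 h) (f1 h'), finsum_add_distrib (f2 𝒴) (f2 𝒴'),
      finsum_add_distrib (f3 𝒴) (f3 𝒴'), ← h.jacobi, ← h'.jacobi]
    abel
  derivative := by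
    intro w₁ w₂ n k
    simp only [logMode_add, h.derivative, h'.derivative]
    module
  bracket_neg := by
    intro w₁ w₂ n k
    simp only [logMode_add, map_add, ← h.bracket_neg, ← h'.bracket_neg]
    abel
  bracket_zero := by
    intro w₁ w₂ n k
    have e := h.bracket_zero w₁ w₂ n k
    have e' := h'.bracket_zero w₁ w₂ n k
    simp only [logMode_add, map_add]
    rw [add_sub_add_comm, e, e']
    abel
  bracket_pos := by
    intro w₁ w₂ n k
    have e := h.bracket_pos w₁ w₂ n k
    have e' := h'.bracket_pos w₁ w₂ n k
    simp only [logMode_add, map_add]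
    rw [add_sub_add_comm, e, e']
    module

theorem IsLogIntertwining.smul {𝒱 : MCVertexAlgebra V} {𝒲₁ : GenModule 𝒱 W₁}
    {𝒲₂ : GenModule 𝒱 W₂} {𝒲₃ : GenModule 𝒱 W₃} {𝒴 : W₁ ⊗[ℂ] W₂ →ₗ[ℂ] (ℂ → ℕ →₀ W₃)}
    (a : ℂ) (h : IsLogIntertwining 𝒲₁ 𝒲₂ 𝒲₃ 𝒴) : IsLogIntertwining 𝒲₁ 𝒲₂ 𝒲₃ (a • 𝒴) where
  lower_truncation := by
    intro w₁ w₂ n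
    obtain ⟨M, hM⟩ := h.lower_truncation w₁ w₂ n
    exact ⟨M, fun m hm k => by rw [logMode_smul, hM m hm, smul_zero]⟩
  jacobi := by
    intro v w₁ w₂ l m n k
    have e := congrArg (a • ·) (h.jacobi v w₁ w₂ l m n k)
    simp only [smul_sub, smul_finsum] at e
    simp only [logMode_smul, map_smul]
    simpa only [smul_comm a] using e
  derivative := by
    intro w₁ w₂ n k
    simp only [logMode_smul, h.derivative]
    module
  bracket_neg := by
    intro w₁ w₂ n k
    simp only [logMode_smul, map_smul, ← h.bracket_neg, smul_sub]
  bracket_zero := by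
    intro w₁ w₂ n k
    simp only [logMode_smul, map_smul]
    rw [← smul_sub, h.bracket_zero, smul_add]
  bracket_pos := by
    intro w₁ w₂ n k
    simp only [logMode_smul, map_smul]
    rw [← smul_sub, h.bracket_pos]
    module

theorem IsLogIntertwining.zero {𝒱 : MCVertexAlgebra V} (𝒲₁ : GenModule 𝒱 W₁)
    (𝒲₂ : GenModule 𝒱 W₂) (𝒲₃ : GenModule 𝒱 W₃) : IsLogIntertwining 𝒲₁ 𝒲₂ 𝒲₃ 0 where
  lower_truncation := fun _ _ _ => ⟨0, fun _ _ _ => rfl⟩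
  jacobi := by simp [logMode_zero]
  derivative := by simp [logMode_zero]
  bracket_neg := by simp [logMode_zero]
  bracket_zero := by simp [logMode_zero]
  bracket_pos := by simp [logMode_zero]

variable {Atilde : Type*} [AddCommGroup Atilde] {A : AddSubgroup Atilde}
  {𝒱 : StronglyGradedVertexAlgebra A V}

/-- The space of grading-compatible logarithmic intertwining operators of type
`(W₃; W₁ W₂)`. -/
def LogIntertwiningSpace (𝒲₁ : StronglyGradedGenModule 𝒱 W₁)
    (𝒲₂ : StronglyGradedGenModule 𝒱 W₂) (𝒲₃ : StronglyGradedGenModule 𝒱 W₃) :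
    Submodule ℂ (W₁ ⊗[ℂ] W₂ →ₗ[ℂ] (ℂ → ℕ →₀ W₃)) where
  carrier := {𝒴 | IsLogIntertwining 𝒲₁.toGenModule 𝒲₂.toGenModule 𝒲₃.toGenModule 𝒴 ∧
    ∀ (β γ : Atilde) (w₁ : W₁) (w₂ : W₂), w₁ ∈ 𝒲₁.gr β → w₂ ∈ 𝒲₂.gr γ →
      ∀ (n : ℂ) (k : ℕ), logMode 𝒴 n k w₁ w₂ ∈ 𝒲₃.gr (β + γ)}
  add_mem' h h' := ⟨h.1.add h'.1, fun β γ w₁ w₂ h₁ h₂ n k =>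
    add_mem (h.2 β γ w₁ w₂ h₁ h₂ n k) (h'.2 β γ w₁ w₂ h₁ h₂ n k)⟩
  zero_mem' := ⟨IsLogIntertwining.zero _ _ _, fun _ _ _ _ _ _ _ _ => zero_mem _⟩
  smul_mem' a _ h := ⟨h.1.smul a, fun β γ w₁ w₂ h₁ h₂ n k =>
    Submodule.smul_mem _ a (h.2 β γ w₁ w₂ h₁ h₂ n k)⟩

/-! ### `P(z)`-intertwining maps -/

/-- `I` is a `P(z)`-intertwining map. -/
structure IsPIntertwining (z : ℂ) (𝒲₁ : StronglyGradedGenModule 𝒱 W₁)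
    (𝒲₂ : StronglyGradedGenModule 𝒱 W₂) (𝒲₃ : StronglyGradedGenModule 𝒱 W₃)
    (I : W₁ ⊗[ℂ] W₂ →ₗ[ℂ] 𝒲₃.Completion) : Prop where
  grading_compatible : ∀ (β γ : Atilde) (w₁ : W₁) (w₂ : W₂), w₁ ∈ 𝒲₁.gr β → w₂ ∈ 𝒲₂.gr γ →
    ∀ n : ℂ, (I (w₁ ⊗ₜ w₂) n : W₃) ∈ 𝒲₃.gr (β + γ)
  lower_truncation : ∀ (w₁ : W₁) (w₂ : W₂), 𝒲₃.LowerTruncated (I (w₁ ⊗ₜ w₂))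
  /-- The component of weight `r` of the coefficient of `x₀^(-l-1) x₁^(-m-1)` in
  `x₀⁻¹ δ((x₁-z)/x₀) Y₃(v,x₁) I(w₁ ⊗ w₂) = z⁻¹ δ((x₁-x₀)/z) I(Y₁(v,x₀)w₁ ⊗ w₂)
    + x₀⁻¹ δ((z-x₁)/(-x₀)) I(w₁ ⊗ Y₂(v,x₁)w₂)`. -/
  jacobi : ∀ (v : V) (w₁ : W₁) (w₂ : W₂) (l m : ℤ) (r : ℂ),
    (∑ᶠ i : ℕ, (binom l i * (-z) ^ i) •
        𝒲₃.extend (𝒲₃.mode (l + m - i) v) (I (w₁ ⊗ₜ w₂)) r)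
      = (∑ᶠ i : ℕ, (binom m i * z ^ (m - i)) • I (𝒲₁.mode (l + i) v w₁ ⊗ₜ w₂) r)
        + ∑ᶠ i : ℕ, ((-1 : ℂ) ^ l * (-1 : ℂ) ^ i * binom l i * z ^ (l - i)) •
          I (w₁ ⊗ₜ 𝒲₂.mode (m + i) v w₂) r
  bracket_neg : ∀ (w₁ : W₁) (w₂ : W₂),
    𝒲₃.extend 𝒲₃.Lneg (I (w₁ ⊗ₜ w₂)) = I (w₁ ⊗ₜ 𝒲₂.Lneg w₂) + I (𝒲₁.Lneg w₁ ⊗ₜ w₂)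
  bracket_zero : ∀ (w₁ : W₁) (w₂ : W₂),
    𝒲₃.extend 𝒲₃.Lzero (I (w₁ ⊗ₜ w₂))
      = I (w₁ ⊗ₜ 𝒲₂.Lzero w₂) + (I (𝒲₁.Lzero w₁ ⊗ₜ w₂) + z • I (𝒲₁.Lneg w₁ ⊗ₜ w₂))
  bracket_pos : ∀ (w₁ : W₁) (w₂ : W₂),
    𝒲₃.extend 𝒲₃.Lpos (I (w₁ ⊗ₜ w₂))
      = I (w₁ ⊗ₜ 𝒲₂.Lpos w₂) + (I (𝒲₁.Lpos w₁ ⊗ₜ w₂) + (2 * z) • I (𝒲₁.Lzero w₁ ⊗ₜ w₂)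
        + z ^ 2 • I (𝒲₁.Lneg w₁ ⊗ₜ w₂))

theorem IsPIntertwining.add {z : ℂ} {𝒲₁ : StronglyGradedGenModule 𝒱 W₁}
    {𝒲₂ : StronglyGradedGenModule 𝒱 W₂} {𝒲₃ : StronglyGradedGenModule 𝒱 W₃}
    {I I' : W₁ ⊗[ℂ] W₂ →ₗ[ℂ] 𝒲₃.Completion} (h : IsPIntertwining z 𝒲₁ 𝒲₂ 𝒲₃ I)
    (h' : IsPIntertwining z 𝒲₁ 𝒲₂ 𝒲₃ I') : IsPIntertwining z 𝒲₁ 𝒲₂ 𝒲₃ (I + I') where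
  grading_compatible β γ w₁ w₂ h₁ h₂ n :=
    add_mem (h.grading_compatible β γ w₁ w₂ h₁ h₂ n) (h'.grading_compatible β γ w₁ w₂ h₁ h₂ n)
  lower_truncation := by
    intro w₁ w₂ n
    obtain ⟨M, hM⟩ := h.lower_truncation w₁ w₂ n
    obtain ⟨M', hM'⟩ := h'.lower_truncation w₁ w₂ n
    refine ⟨max M M', fun m hm => ?_⟩
    rw [LinearMap.add_apply, Pi.add_apply, hM m (le_trans (le_max_left _ _) hm),
      hM' m (le_trans (le_max_right _ _) hm), add_zero]
  jacobi := by
    intro v w₁ w₂ l m r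
    have f2 : ∀ I : W₁ ⊗[ℂ] W₂ →ₗ[ℂ] 𝒲₃.Completion, (Function.support fun i : ℕ =>
        (binom m i * z ^ (m - i)) • I (𝒲₁.mode (l + i) v w₁ ⊗ₜ w₂) r).Finite := by
      intro I
      obtain ⟨N, hN⟩ := 𝒲₁.exists_nat_truncation v w₁ l
      exact finite_support_of_eventually _ _ N fun i hi => by simp [hN i hi]
    have f3 : ∀ I : W₁ ⊗[ℂ] W₂ →ₗ[ℂ] 𝒲₃.Completion, (Function.support fun i : ℕ =>
        ((-1 : ℂ) ^ l * (-1 : ℂ) ^ i * binom l i * z ^ (l - i)) •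
          I (w₁ ⊗ₜ 𝒲₂.mode (m + i) v w₂) r).Finite := by
      intro I
      obtain ⟨N, hN⟩ := 𝒲₂.exists_nat_truncation v w₂ m
      exact finite_support_of_eventually _ _ N fun i hi => by simp [hN i hi]
    simp only [LinearMap.add_apply, (𝒲₃.finiteShift_mode _ v).extend_add, Pi.add_apply, smul_add]
    rw [finsum_add_distrib ((h.lower_truncation w₁ w₂).finite_support v (l + m) _ r)
      ((h'.lower_truncation w₁ w₂).finite_support v (l + m) _ r),
      finsum_add_distrib (f2 I) (f2 I'), finsum_add_distrib (f3 I) (f3 I'), h.jacobi, h'.jacobi]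
    abel
  bracket_neg := by
    intro w₁ w₂
    simp only [LinearMap.add_apply, 𝒲₃.finiteShift_Lneg.extend_add, h.bracket_neg, h'.bracket_neg]
    abel
  bracket_zero := by
    intro w₁ w₂
    simp only [LinearMap.add_apply, 𝒲₃.finiteShift_Lzero.extend_add, h.bracket_zero,
      h'.bracket_zero, smul_add]
    abel
  bracket_pos := by
    intro w₁ w₂
    simp only [LinearMap.add_apply, 𝒲₃.finiteShift_Lpos.extend_add, h.bracket_pos,
      h'.bracket_pos, smul_add]
    abel

theorem IsPIntertwining.smul {z : ℂ} {𝒲₁ : StronglyGradedGenModule 𝒱 W₁}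
    {𝒲₂ : StronglyGradedGenModule 𝒱 W₂} {𝒲₃ : StronglyGradedGenModule 𝒱 W₃}
    {I : W₁ ⊗[ℂ] W₂ →ₗ[ℂ] 𝒲₃.Completion} (a : ℂ) (h : IsPIntertwining z 𝒲₁ 𝒲₂ 𝒲₃ I) :
    IsPIntertwining z 𝒲₁ 𝒲₂ 𝒲₃ (a • I) where
  grading_compatible β γ w₁ w₂ h₁ h₂ n :=
    Submodule.smul_mem _ a (h.grading_compatible β γ w₁ w₂ h₁ h₂ n)
  lower_truncation := by
    intro w₁ w₂ n
    obtain ⟨M, hM⟩ := h.lower_truncation w₁ w₂ n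
    exact ⟨M, fun m hm => by rw [LinearMap.smul_apply, Pi.smul_apply, hM m hm, smul_zero]⟩
  jacobi := by
    intro v w₁ w₂ l m r
    have e := congrArg (a • ·) (h.jacobi v w₁ w₂ l m r)
    simp only [smul_add, smul_finsum] at e
    simp only [LinearMap.smul_apply, GenModule.extend_smul, Pi.smul_apply]
    simpa only [smul_comm a] using e
  bracket_neg := by
    intro w₁ w₂
    simp only [LinearMap.smul_apply, GenModule.extend_smul, h.bracket_neg, smul_add]
  bracket_zero := by
    intro w₁ w₂
    simp only [LinearMap.smul_apply, GenModule.extend_smul, h.bracket_zero, smul_add,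
      smul_comm a]
  bracket_pos := by
    intro w₁ w₂
    simp only [LinearMap.smul_apply, GenModule.extend_smul, h.bracket_pos, smul_add,
      smul_comm a]

theorem IsPIntertwining.zero (z : ℂ) (𝒲₁ : StronglyGradedGenModule 𝒱 W₁)
    (𝒲₂ : StronglyGradedGenModule 𝒱 W₂) (𝒲₃ : StronglyGradedGenModule 𝒱 W₃) :
    IsPIntertwining z 𝒲₁ 𝒲₂ 𝒲₃ 0 where
  grading_compatible _ _ _ _ _ _ _ := zero_mem _
  lower_truncation _ _ _ := ⟨0, fun _ _ => rfl⟩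
  jacobi := by simp [GenModule.extend_zero]
  bracket_neg := by simp [GenModule.extend_zero]
  bracket_zero := by simp [GenModule.extend_zero]
  bracket_pos := by simp [GenModule.extend_zero]

/-- The space of `P(z)`-intertwining maps of type `(W₃; W₁ W₂)`. -/
def PIntertwiningSpace (z : ℂ) (𝒲₁ : StronglyGradedGenModule 𝒱 W₁)
    (𝒲₂ : StronglyGradedGenModule 𝒱 W₂) (𝒲₃ : StronglyGradedGenModule 𝒱 W₃) :
    Submodule ℂ (W₁ ⊗[ℂ] W₂ →ₗ[ℂ] 𝒲₃.Completion) where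
  carrier := {I | IsPIntertwining z 𝒲₁ 𝒲₂ 𝒲₃ I}
  add_mem' h h' := h.add h'
  zero_mem' := IsPIntertwining.zero z _ _ _
  smul_mem' a _ h := h.smul a

end Log

/-! ### The two correspondences -/

/-- `l_p(z) = log z + 2πip`, where `0 ≤ Im (log z) < 2π`. -/
def logBranch (p : ℤ) (z : ℂ) : ℂ :=
  (if 0 ≤ (Complex.log z).im then Complex.log z
    else Complex.log z + 2 * Real.pi * Complex.I) + 2 * Real.pi * Complex.I * p

section Correspondence

variable {V W : Type*} [AddCommGroup V] [Module ℂ V] [AddCommGroup W] [Module ℂ W]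
  {𝒱 : MCVertexAlgebra V}

/-- The substitution of `e^ζ` for `x` in `f(x) = ∑ f a k x^a (log x)^k`, that is, of `e^(ζa)` for
`x^a` and of `ζ^k` for `(log x)^k`, exists in the completion: each weight component is a finite
sum. -/
def GenModule.SubstExists (𝒲 : GenModule 𝒱 W) (f : ℂ → ℕ →₀ W) : Prop :=
  ∀ m : ℂ, (Function.support fun q : ℂ × ℕ => 𝒲.π m (f q.1 q.2)).Finite

/-- The element `f(e^ζ)` of the completion. -/
def GenModule.subst (𝒲 : GenModule 𝒱 W) (ζ : ℂ) (f : ℂ → ℕ →₀ W) : 𝒲.Completion :=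
  fun m => ∑ᶠ q : ℂ × ℕ, (Complex.exp (ζ * q.1) * ζ ^ q.2) • 𝒲.π m (f q.1 q.2)

/-- The coefficient of `x^a (log x)^i` in `x^(εL(0)) w`, for `w` in the completion and `ε = ±1`,
where `x^(±L(0)) w = x^(±n) e^(± log x (L(0) - n)) w` for `w` of weight `n`: only the component of
weight `n = εa` contributes. -/
def GenModule.xPow (𝒲 : GenModule 𝒱 W) (ε : ℤˣ) (w : 𝒲.Completion) (a : ℂ) (i : ℕ) : W :=
  (((ε : ℤ) : ℂ) ^ i / (i.factorial : ℂ)) •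
    ((𝒲.Lzero - (((ε : ℤ) : ℂ) * a) • (1 : Module.End ℂ W)) ^ i) (w (((ε : ℤ) : ℂ) * a))

/-- `y^(εL(0)) w` at `y = e^ζ`, for `w ∈ W` and `ε = ±1` (a finite sum). -/
def GenModule.yPow (𝒲 : GenModule 𝒱 W) (ε : ℤˣ) (ζ : ℂ) (w : W) : W :=
  ∑ᶠ q : ℂ × ℕ, (Complex.exp (ζ * q.1) * ζ ^ q.2) • 𝒲.xPow ε (𝒲.toCompletion w) q.1 q.2

/-- The coefficient of `x^a (log x)^k` in the product
`y^(L(0)) x^(L(0)) I(y^(-L(0)) x^(-L(0)) w₁ ⊗ y^(-L(0)) x^(-L(0)) w₂)` at `y = e^ζ`: the sum over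
`b₁ + b₂ + b₃ = a` and `i + j + l = k` of the contributions of `x^b₁ (log x)^i` in
`x^(-L(0)) w₁`, of `x^b₂ (log x)^j` in `x^(-L(0)) w₂` and of `x^b₃ (log x)^l` in the outer
`x^(L(0))`. Only finitely many pairs `(b₁, b₂)` contribute. -/
def conjugateCoeff {W₁ W₂ : Type*} [AddCommGroup W₁] [Module ℂ W₁] [AddCommGroup W₂]
    [Module ℂ W₂] (𝒲₁ : GenModule 𝒱 W₁) (𝒲₂ : GenModule 𝒱 W₂) (𝒲₃ : GenModule 𝒱 W)
    (ζ : ℂ) (I : W₁ ⊗[ℂ] W₂ →ₗ[ℂ] 𝒲₃.Completion) (w₁ : W₁) (w₂ : W₂) (a : ℂ) (k : ℕ) : W :=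
  ∑ᶠ b : ℂ × ℂ, ∑ s ∈ Finset.HasAntidiagonal.antidiagonal k,
    ∑ t ∈ Finset.HasAntidiagonal.antidiagonal s.1,
      𝒲₃.yPow 1 ζ (𝒲₃.xPow 1
      (I (𝒲₁.yPow (-1) ζ (𝒲₁.xPow (-1) (𝒲₁.toCompletion w₁) b.1 t.1) ⊗ₜ
        𝒲₂.yPow (-1) ζ (𝒲₂.xPow (-1) (𝒲₂.toCompletion w₂) b.2 t.2)))
      (a - b.1 - b.2) s.2)

end Correspondence

end

/-! Both kinds of maps are encoded by families `J a` of linear maps W₁ ⊗ W₂ → W₃, one for each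
degree a ∈ ℂ, where `J a` adds a to the total weight. For a P(z)-intertwining map I, `J a` collects
the weight components of I by degree, and the axioms for I become the identities `IsCoeffFamily z`
(`IsComponents.isCoeffFamily`, `IsComponents.isPIntertwining`).

For a logarithmic intertwining operator, let c(a,k) be the coefficient of x^a (log x)^k. The
L(0)-bracket and the L(-1)-derivative property together say that the commutator of L(0) with c(a,k)
is a c(a,k) + (k+1) c(a,k+1). Since only finitely many k occur for given a and given vectors,
descending induction on k shows that c(a,k) has degree a (`IsLogIntertwining.hasDegrees`). Write
L(0) = n + N on weight n, with N locally nilpotent, and let ad N be the operator `adNil`. Then (k+1)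
c(a,k+1) = ad N (c(a,k)), so that c(a,k) = (ad N)^k/k! c(a,0) (`IsLogIntertwining.logCoeff_eq`). The
operator is therefore determined by the family c(·,0), which satisfies `IsCoeffFamily 1`. Conversely
every such family arises, because N commutes with all modes and with all L(j), so that ad N
preserves coefficient families (`IsCoeffFamily.logOfCoeff_mem`).

Substituting e^ζ for x replaces c(a,0) by e^(ζa) exp(ζ ad N) c(a,0), which is conjugation by
e^(ζL(0)) (`finsum_divPow_adNil`, `expAd`). The exponential of the nilpotent part preserves the
identities, and the factor e^(ζa) changes the parameter u into u e^ζ (`IsCoeffFamily.expAd`). With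
e^ζ = z this carries families for u = 1 to families for u = z, and conjugation by e^(-ζL(0)) is the
inverse. Expanding the formula for the inverse into homogeneous parts gives exactly this last
conjugation (`conjugateCoeff_eq`). -/

noncomputable section

/-! ### Linear maps on graded spaces -/

section Grading

variable {ι M P : Type*} [AddCommGroup M] [Module ℂ M] [AddCommGroup P] [Module ℂ P]
  {G : ι → Submodule ℂ M}

open Classical in
theorem IsGrading.equiv_symm_apply_mem (h : IsGrading G) {i : ι} {w : M} (hw : w ∈ G i) :
    (LinearEquiv.ofBijective (DirectSum.coeLinearMap G) h.isInternal).symm w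
      = DirectSum.lof ℂ ι (fun j => G j) i ⟨w, hw⟩ := by
  rw [LinearEquiv.symm_apply_eq, LinearEquiv.ofBijective_apply, DirectSum.coeLinearMap_lof]

theorem IsGrading.proj_apply_of_mem (h : IsGrading G) {i : ι} {w : M} (hw : w ∈ G i) :
    (h.proj i w : M) = w := by
  rw [IsGrading.proj, LinearMap.comp_apply, LinearEquiv.coe_coe, h.equiv_symm_apply_mem hw,
    DirectSum.component.lof_self]

open Classical in
/-- The linear map that agrees with `f i` on the component of degree `i`. -/
def IsGrading.glue (h : IsGrading G) (f : ι → M →ₗ[ℂ] P) : M →ₗ[ℂ] P :=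
  DirectSum.toModule ℂ ι P (fun i => f i ∘ₗ (G i).subtype) ∘ₗ
    (LinearEquiv.ofBijective (DirectSum.coeLinearMap G) h.isInternal).symm.toLinearMap

theorem IsGrading.glue_apply (h : IsGrading G) (f : ι → M →ₗ[ℂ] P) {i : ι} {w : M}
    (hw : w ∈ G i) : h.glue f w = f i w := by
  rw [IsGrading.glue, LinearMap.comp_apply, LinearEquiv.coe_coe, h.equiv_symm_apply_mem hw,
    DirectSum.toModule_lof]
  rfl

/-- There is no case for 0: it is homogeneous of any chosen degree, which is what `Nonempty ι` is
for. Additive statements thus need to be checked on homogeneous vectors only. -/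
theorem IsGrading.induction [Nonempty ι] (h : IsGrading G) {p : M → Prop} (w : M)
    (hom : ∀ i, ∀ w ∈ G i, p w) (add : ∀ w w', p w → p w' → p (w + w')) : p w := by
  have hw : w ∈ ⨆ i, G i := by rw [h.span]; trivial
  induction hw using Submodule.iSup_induction' with
  | mem i w hw => exact hom i w hw
  | zero => exact hom (Classical.arbitrary ι) 0 (zero_mem _)
  | add w w' _ _ h h' => exact add w w' h h'

theorem IsGrading.finite_support_proj (h : IsGrading G) (w : M) :
    {i | h.proj i w ≠ 0}.Finite := by
  classical
  refine (DFinsupp.support ((LinearEquiv.ofBijective (DirectSum.coeLinearMap G)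
    h.isInternal).symm w)).finite_toSet.subset fun i hi => ?_
  exact (DFinsupp.mem_support_iff).mpr hi

end Grading

/-! ### Finite sums over antidiagonals -/

section Sums

variable {M : Type*} [AddCommGroup M]

/-- Regrouping by total degree is what turns a product of two exponential series into one series. -/
theorem finsum_antidiagonal (f : ℕ × ℕ → M) (hf : (Function.support f).Finite) :
    ∑ᶠ k : ℕ, ∑ q ∈ Finset.HasAntidiagonal.antidiagonal k, f q = ∑ᶠ q, f q := by
  classical
  -- Inside the finite support, the antidiagonals are the fibres of the map `q.1 + q.2`.
  have e : ∀ k : ℕ, ∑ q ∈ Finset.HasAntidiagonal.antidiagonal k, f q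
      = ∑ q ∈ hf.toFinset with q.1 + q.2 = k, f q := by
    intro k
    rw [← Finset.sum_filter_ne_zero]
    refine Finset.sum_congr ?_ fun _ _ => rfl
    ext q
    simp [and_comm]
  simp only [e]
  rw [finsum_eq_sum f hf, finsum_eq_sum_of_support_subset
    (s := hf.toFinset.image fun q => q.1 + q.2)]
  · exact Finset.sum_fiberwise_of_maps_to (fun q hq => Finset.mem_image_of_mem _ hq) f
  · intro k hk
    obtain ⟨q, hq, -⟩ := Finset.exists_ne_zero_of_sum_ne_zero hk
    rw [Finset.mem_filter] at hq
    exact Finset.mem_coe.mpr (Finset.mem_image.mpr ⟨q, hq.1, hq.2⟩)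

end Sums

/-! ### Exponentials of locally nilpotent operators -/

section LocExp

variable {M : Type*} [AddCommGroup M] [Module ℂ M]

/-- The divided power `N ^ k / k!`. -/
def divPow {R : Type*} [Ring R] [Algebra ℂ R] (N : R) (k : ℕ) : R :=
  (k.factorial : ℂ)⁻¹ • N ^ k

section Ring

variable {R : Type*} [Ring R] [Algebra ℂ R]

@[simp] theorem divPow_zero (N : R) : divPow N 0 = 1 := by simp [divPow]

theorem divPow_zero_left (k : ℕ) : divPow (0 : R) k = if k = 0 then 1 else 0 := by
  cases k <;> simp [divPow]

theorem divPow_smul (a : ℂ) (N : R) (k : ℕ) : divPow (a • N) k = a ^ k • divPow N k := by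
  rw [divPow, divPow, smul_pow, smul_comm]

/-- The factor k + 1 is the one that differentiating (log x)^(k+1) produces; divided powers are used
so that the two match. -/
theorem mul_divPow (N : R) (k : ℕ) : N * divPow N k = ((k : ℂ) + 1) • divPow N (k + 1) := by
  have h : (k : ℂ) + 1 ≠ 0 := Nat.cast_add_one_ne_zero k
  rw [divPow, divPow, smul_smul, Nat.factorial_succ, pow_succ', mul_smul_comm]
  congr 1
  push_cast
  rw [mul_inv, mul_inv_cancel_left₀ h]

/-- The binomial theorem; dividing by k! absorbs the binomial coefficients. -/
theorem divPow_add {A B : R} (h : Commute A B) (k : ℕ) :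
    divPow (A + B) k = ∑ q ∈ Finset.HasAntidiagonal.antidiagonal k, divPow A q.1 * divPow B q.2 := by
  rw [divPow, h.add_pow', Finset.smul_sum]
  refine Finset.sum_congr rfl fun q hq => ?_
  rw [Finset.HasAntidiagonal.mem_antidiagonal] at hq
  subst hq
  rw [divPow, divPow, smul_mul_smul_comm, ← Nat.cast_smul_eq_nsmul ℂ, smul_smul]
  congr 1
  have h1 := Nat.add_choose_mul_factorial_mul_factorial q.1 q.2
  rw [← Nat.choose_symm_add] at h1
  have h2 : ((q.1 + q.2).factorial : ℂ) ≠ 0 := Nat.cast_ne_zero.mpr (Nat.factorial_ne_zero _)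
  have h3 : (q.1.factorial : ℂ) ≠ 0 := Nat.cast_ne_zero.mpr (Nat.factorial_ne_zero _)
  have h4 : (q.2.factorial : ℂ) ≠ 0 := Nat.cast_ne_zero.mpr (Nat.factorial_ne_zero _)
  rw [← h1] at h2 ⊢
  push_cast at h2 ⊢
  have h5 := left_ne_zero_of_mul (left_ne_zero_of_mul h2)
  field_simp

end Ring

/-- Every vector is annihilated by a power of `N`. -/
def IsLocNilpotent (N : Module.End ℂ M) : Prop := ∀ w : M, ∃ K : ℕ, ∀ k ≥ K, (N ^ k) w = 0

theorem IsLocNilpotent.smul {N : Module.End ℂ M} (h : IsLocNilpotent N) (a : ℂ) :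
    IsLocNilpotent (a • N) := by
  intro w
  obtain ⟨K, hK⟩ := h w
  exact ⟨K, fun k hk => by rw [smul_pow, LinearMap.smul_apply, hK k hk, smul_zero]⟩

theorem IsLocNilpotent.exists_divPow_eq_zero {N : Module.End ℂ M} (h : IsLocNilpotent N) (w : M) :
    ∃ K : ℕ, ∀ k ≥ K, divPow N k w = 0 := by
  obtain ⟨K, hK⟩ := h w
  exact ⟨K, fun k hk => by rw [divPow, LinearMap.smul_apply, hK k hk, smul_zero]⟩

theorem IsLocNilpotent.finite_support {N : Module.End ℂ M} (h : IsLocNilpotent N) (w : M) :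
    (Function.support fun k : ℕ => divPow N k w).Finite := by
  obtain ⟨K, hK⟩ := h.exists_divPow_eq_zero w
  refine (Set.finite_Iio K).subset fun k hk => ?_
  by_contra hn
  exact hk (hK k (not_lt.mp hn))

/-- The double family of the divided powers of two locally nilpotent operators has finite
support, whatever is inserted between them. -/
theorem IsLocNilpotent.finite_support₂ {M' : Type*} [AddCommGroup M'] [Module ℂ M']
    {A : Module.End ℂ M} {B : Module.End ℂ M'}
    (hA : IsLocNilpotent A) (hB : IsLocNilpotent B) (f : M' →ₗ[ℂ] M) (w : M') :
    (Function.support fun q : ℕ × ℕ => divPow A q.1 (f (divPow B q.2 w))).Finite := by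
  obtain ⟨K, hK⟩ := hB.exists_divPow_eq_zero w
  -- Only j < K matter, and for each of them the vector f(B^j/j! w) is fixed, so that finitely many
  -- i remain.
  refine ((Set.finite_Iio K).biUnion (t := fun j => (fun i => (i, j)) ''
    (Function.support fun i => divPow A i (f (divPow B j w)))) fun j _ =>
      (hA.finite_support _).image _).subset ?_
  rintro ⟨i, j⟩ hq
  refine Set.mem_biUnion (x := j) ?_ ⟨i, hq, rfl⟩
  by_contra hn
  refine hq ?_
  change divPow A i (f (divPow B j w)) = 0
  rw [hK j (not_lt.mp hn), map_zero, map_zero]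

open Classical in
/-- The exponential of a locally nilpotent operator (and `0` for other operators). -/
def locExp (N : Module.End ℂ M) : Module.End ℂ M :=
  if h : IsLocNilpotent N then
    { toFun := fun w => ∑ᶠ k : ℕ, divPow N k w
      map_add' := fun w w' => by
        simp only [map_add]
        exact finsum_add_distrib (h.finite_support w) (h.finite_support w')
      map_smul' := fun a w => by
        simp only [map_smul, RingHom.id_apply, smul_finsum] }
  else 0

theorem IsLocNilpotent.locExp_apply {N : Module.End ℂ M} (h : IsLocNilpotent N) (w : M) :
    locExp N w = ∑ᶠ k : ℕ, divPow N k w := by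
  rw [locExp, dif_pos h]
  rfl

theorem IsLocNilpotent.locExp_smul_apply {N : Module.End ℂ M} (h : IsLocNilpotent N) (a : ℂ)
    (w : M) : locExp (a • N) w = ∑ᶠ k : ℕ, a ^ k • divPow N k w := by
  rw [(h.smul a).locExp_apply]
  simp only [divPow_smul, LinearMap.smul_apply]

/-- `e^A f e^B w` as the sum of a double series collected by total degree. -/
theorem IsLocNilpotent.locExp_comp {M' : Type*} [AddCommGroup M'] [Module ℂ M']
    {A : Module.End ℂ M} {B : Module.End ℂ M'}
    (hA : IsLocNilpotent A) (hB : IsLocNilpotent B) (f : M' →ₗ[ℂ] M) (w : M') :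
    ∑ᶠ k : ℕ, ∑ q ∈ Finset.HasAntidiagonal.antidiagonal k, divPow A q.1 (f (divPow B q.2 w))
      = locExp A (f (locExp B w)) := by
  have fin := hA.finite_support₂ hB f w
  rw [finsum_antidiagonal _ fin, finsum_curry _ fin, hA.locExp_apply, hB.locExp_apply]
  refine finsum_congr fun i => ?_
  change _ = (divPow A i ∘ₗ f) _
  rw [map_finsum _ (hB.finite_support w)]
  rfl

/-- In a binomial term A^i B^j with i + j ≥ K + K', either i ≥ K or j ≥ K'. Commutativity allows the
large power to act first on w. -/
theorem IsLocNilpotent.add {A B : Module.End ℂ M} (hA : IsLocNilpotent A)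
    (hB : IsLocNilpotent B) (h : Commute A B) : IsLocNilpotent (A + B) := by
  intro w
  obtain ⟨K, hK⟩ := hA w
  obtain ⟨K', hK'⟩ := hB w
  refine ⟨K + K', fun k hk => ?_⟩
  rw [h.add_pow', LinearMap.sum_apply]
  refine Finset.sum_eq_zero fun q hq => ?_
  rw [Finset.HasAntidiagonal.mem_antidiagonal] at hq
  have : (A ^ q.1 * B ^ q.2) w = 0 := by
    rcases le_or_gt K q.1 with hi | hi
    · rw [(h.pow_pow _ _).eq, Module.End.mul_apply, hK _ hi, map_zero]
    · rw [Module.End.mul_apply, hK' _ (by omega), map_zero]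
  rw [LinearMap.smul_apply, this, smul_zero]

theorem locExp_add {A B : Module.End ℂ M} (hA : IsLocNilpotent A)
    (hB : IsLocNilpotent B) (h : Commute A B) : locExp (A + B) = locExp A * locExp B := by
  ext w
  rw [(hA.add hB h).locExp_apply]
  simp only [divPow_add h, LinearMap.sum_apply, Module.End.mul_apply]
  exact hA.locExp_comp hB LinearMap.id w

theorem locExp_zero : locExp (0 : Module.End ℂ M) = 1 := by
  have h : IsLocNilpotent (0 : Module.End ℂ M) := fun w =>
    ⟨1, fun k hk => by rw [zero_pow (by omega), LinearMap.zero_apply]⟩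
  ext w
  rw [h.locExp_apply, finsum_eq_single _ 0 fun k hk => ?_]
  · simp
  · rw [divPow_zero_left, if_neg hk, LinearMap.zero_apply]

theorem locExp_neg_apply_locExp {N : Module.End ℂ M} (h : IsLocNilpotent N) (a : ℂ) (w : M) :
    locExp (a • N) (locExp ((-a) • N) w) = w := by
  have e := locExp_add (h.smul a) (h.smul (-a))
    (((Commute.refl N).smul_left a).smul_right (-a))
  rw [← add_smul, add_neg_cancel, zero_smul, locExp_zero] at e
  rw [← Module.End.mul_apply, ← e, Module.End.one_apply]

/-- Intertwiners of `N` and `N'` are intertwiners of their exponentials. -/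
theorem locExp_intertwine {M' : Type*} [AddCommGroup M'] [Module ℂ M']
    {N : Module.End ℂ M} {N' : Module.End ℂ M'} (hN : IsLocNilpotent N)
    (hN' : IsLocNilpotent N') (T : M →ₗ[ℂ] M') (hT : ∀ w, T (N w) = N' (T w)) (w : M) :
    T (locExp N w) = locExp N' (T w) := by
  have pw : ∀ (k : ℕ) (w : M), T ((N ^ k) w) = (N' ^ k) (T w) := by
    intro k
    induction k with
    | zero => intro w; simp
    | succ k ih =>
      intro w
      rw [pow_succ, pow_succ, Module.End.mul_apply, Module.End.mul_apply, ih, hT]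
  rw [hN.locExp_apply, hN'.locExp_apply, map_finsum _ (hN.finite_support w)]
  refine finsum_congr fun k => ?_
  rw [divPow, divPow, LinearMap.smul_apply, LinearMap.smul_apply, map_smul, pw]

end LocExp

/-! ### The nilpotent part of `L(0)` -/

section NilpotentPart

variable {V W : Type*} [AddCommGroup V] [Module ℂ V] [AddCommGroup W] [Module ℂ W]
  {𝒱 : MCVertexAlgebra V} (𝒲 : GenModule 𝒱 W)

/-- The locally nilpotent part of `L(0)`: it acts on `W_[n]` as `L(0) - n`. -/
def GenModule.nil : Module.End ℂ W :=
  𝒲.grading.glue fun n => 𝒲.Lzero - n • (1 : Module.End ℂ W)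

variable {𝒲}

theorem GenModule.nil_apply {n : ℂ} {w : W} (hw : w ∈ 𝒲.wt n) :
    𝒲.nil w = (𝒲.Lzero - n • (1 : Module.End ℂ W)) w :=
  𝒲.grading.glue_apply _ hw

theorem GenModule.Lzero_apply {n : ℂ} {w : W} (hw : w ∈ 𝒲.wt n) :
    𝒲.Lzero w = n • w + 𝒲.nil w := by
  rw [GenModule.nil_apply hw, LinearMap.sub_apply, LinearMap.smul_apply, Module.End.one_apply]
  abel

theorem GenModule.mem_wt_of_commute {φ : Module.End ℂ W}
    (h : ∀ w, φ (𝒲.Lzero w) = 𝒲.Lzero (φ w)) {n : ℂ} {w : W} (hw : w ∈ 𝒲.wt n) :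
    φ w ∈ 𝒲.wt n := by
  have e : 𝒲.Lzero * φ - φ * 𝒲.Lzero = (0 : ℂ) • φ := by
    ext w
    simp [h]
  simpa using 𝒲.shift_mem_wt e hw

theorem GenModule.nil_mem_wt {n : ℂ} {w : W} (hw : w ∈ 𝒲.wt n) : 𝒲.nil w ∈ 𝒲.wt n := by
  rw [GenModule.nil_apply hw, LinearMap.sub_apply]
  exact sub_mem (GenModule.mem_wt_of_commute (fun _ => rfl) hw) (Submodule.smul_mem _ n hw)

theorem GenModule.nil_pow_apply {n : ℂ} {w : W} (hw : w ∈ 𝒲.wt n) (k : ℕ) :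
    (𝒲.nil ^ k) w ∈ 𝒲.wt n ∧
      (𝒲.nil ^ k) w = ((𝒲.Lzero - n • (1 : Module.End ℂ W)) ^ k) w := by
  induction k with
  | zero => exact ⟨hw, rfl⟩
  | succ k ih =>
    rw [pow_succ', pow_succ', Module.End.mul_apply, Module.End.mul_apply, ← ih.2]
    exact ⟨GenModule.nil_mem_wt ih.1, GenModule.nil_apply ih.1⟩

theorem GenModule.divPow_nil_mem_wt {n : ℂ} {w : W} (hw : w ∈ 𝒲.wt n) (k : ℕ) :
    divPow 𝒲.nil k w ∈ 𝒲.wt n :=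
  Submodule.smul_mem _ _ (GenModule.nil_pow_apply hw k).1

-- The annihilating power depends on the vector: a generalized eigenvector of weight n is killed by
-- some power of L(0) - n, and a sum needs the larger of two exponents. No uniform bound on Jordan
-- blocks is available or needed.
variable (𝒲) in
theorem GenModule.isLocNilpotent_nil : IsLocNilpotent 𝒲.nil := by
  intro w
  induction w using 𝒲.grading.induction with
  | hom n w hw =>
    obtain ⟨K, hK⟩ := (Module.End.mem_maxGenEigenspace _ _ _).mp hw
    refine ⟨K, fun k hk => ?_⟩
    rw [(GenModule.nil_pow_apply hw k).2, ← Nat.sub_add_cancel hk, pow_add, Module.End.mul_apply,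
      hK, map_zero]
  | add w w' h h' =>
    obtain ⟨K, hK⟩ := h
    obtain ⟨K', hK'⟩ := h'
    refine ⟨max K K', fun k hk => ?_⟩
    rw [map_add, hK k (le_trans (le_max_left _ _) hk), hK' k (le_trans (le_max_right _ _) hk),
      add_zero]

/-- Although L(0) and T do not commute, their failure to commute is purely the weight shift: (L(0) -
(n + d)) T = T (L(0) - n) on weight n, and both brackets are the nilpotent part. -/
theorem GenModule.nil_comm_of_shift {T : Module.End ℂ W} {d : ℂ}
    (hT : 𝒲.Lzero * T - T * 𝒲.Lzero = d • T) (w : W) : 𝒲.nil (T w) = T (𝒲.nil w) := by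
  induction w using 𝒲.grading.induction with
  | hom n w hw =>
    rw [GenModule.nil_apply hw, GenModule.nil_apply (𝒲.shift_mem_wt hT hw)]
    have h := LinearMap.congr_fun hT w
    simp only [LinearMap.sub_apply, Module.End.mul_apply, LinearMap.smul_apply,
      sub_eq_iff_eq_add] at h
    simp only [LinearMap.sub_apply, LinearMap.smul_apply, Module.End.one_apply, map_sub, map_smul,
      h]
    module
  | add w w' h h' => simp only [map_add, h, h']

/-- The L(-1)-derivative property turns the term (L(-1)v)_{n+1} of the L(0)-bracket into -(n+1) v_n.
-/
theorem GenModule.bracket_mode (v : V) {h : ℤ} (hv : v ∈ 𝒱.eigen h) (n : ℤ) :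
    𝒲.Lzero * 𝒲.mode n v - 𝒲.mode n v * 𝒲.Lzero = ((h : ℂ) - n - 1) • 𝒲.mode n v := by
  ext w
  have e := 𝒲.bracket_zero v n w
  have hd := 𝒲.action_axioms.derivative v (n + 1) w
  have hL : 𝒱.Lzero v = (h : ℂ) • v := Module.End.mem_eigenspace_iff.mp hv
  rw [hd, hL] at e
  simp only [LinearMap.sub_apply, Module.End.mul_apply, LinearMap.smul_apply, e, map_smul,
    add_sub_cancel_right]
  push_cast
  module

/-- The weight shift depends on the weight of v, but the conclusion does not, so it extends to all v
by linearity. -/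
theorem GenModule.nil_mode (n : ℤ) (v : V) (w : W) :
    𝒲.nil (𝒲.mode n v w) = 𝒲.mode n v (𝒲.nil w) := by
  induction v using 𝒱.grading.induction with
  | hom h v hv => exact GenModule.nil_comm_of_shift (GenModule.bracket_mode v hv n) w
  | add v v' h h' => simp only [map_add, LinearMap.add_apply, h, h']

end NilpotentPart

/-! ### Module endomorphisms and the grading by `Atilde`. -/

section Strong

variable {Atilde : Type*} [AddCommGroup Atilde] {A : AddSubgroup Atilde}
  {V W : Type*} [AddCommGroup V] [Module ℂ V] [AddCommGroup W] [Module ℂ W]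
  {𝒱 : StronglyGradedVertexAlgebra A V} {𝒲 : StronglyGradedGenModule 𝒱 W}

/-- `φ` commutes with all operators of the module and preserves the grading by `Atilde`. -/
structure StronglyGradedGenModule.IsEndo (𝒲 : StronglyGradedGenModule 𝒱 W)
    (φ : Module.End ℂ W) : Prop where
  mode : ∀ (n : ℤ) (v : V) (w : W), φ (𝒲.mode n v w) = 𝒲.mode n v (φ w)
  Lneg : ∀ w, φ (𝒲.Lneg w) = 𝒲.Lneg (φ w)
  Lzero : ∀ w, φ (𝒲.Lzero w) = 𝒲.Lzero (φ w)
  Lpos : ∀ w, φ (𝒲.Lpos w) = 𝒲.Lpos (φ w)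
  mem_gr : ∀ β, ∀ w ∈ 𝒲.gr β, φ w ∈ 𝒲.gr β

theorem StronglyGradedGenModule.IsEndo.mem_wt {φ : Module.End ℂ W} (h : 𝒲.IsEndo φ) {n : ℂ}
    {w : W} (hw : w ∈ 𝒲.wt n) : φ w ∈ 𝒲.wt n :=
  GenModule.mem_wt_of_commute h.Lzero hw

/-- Compatibility of the two gradings reduces claims about an `Atilde`-component to doubly
homogeneous vectors. -/
theorem StronglyGradedGenModule.gr_induction {β : Atilde} {p : W → Prop} {w : W}
    (hw : w ∈ 𝒲.gr β) (hom : ∀ n, ∀ w ∈ 𝒲.wt n, w ∈ 𝒲.gr β → p w)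
    (add : ∀ w w', p w → p w' → p (w + w')) : p w := by
  rw [𝒲.compatible β] at hw
  induction hw using Submodule.iSup_induction' with
  | mem n w hw => exact hom n w hw.1 hw.2
  | zero => exact hom 0 0 (zero_mem _) (zero_mem _)
  | add w w' _ _ h h' => exact add w w' h h'

theorem StronglyGradedGenModule.isEndo_one : 𝒲.IsEndo 1 :=
  ⟨fun _ _ _ => rfl, fun _ => rfl, fun _ => rfl, fun _ => rfl, fun _ _ h => h⟩

theorem StronglyGradedGenModule.isEndo_nil : 𝒲.IsEndo 𝒲.nil where
  mode n v w := GenModule.nil_mode n v w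
  Lneg w := GenModule.nil_comm_of_shift 𝒲.bracket_L.1 w
  Lzero w := GenModule.nil_comm_of_shift 𝒲.bracket_L.2.1 w
  Lpos w := GenModule.nil_comm_of_shift 𝒲.bracket_L.2.2 w
  mem_gr β w hw := by
    refine StronglyGradedGenModule.gr_induction (p := fun w => 𝒲.nil w ∈ 𝒲.gr β) hw
      (fun n w hn hw => ?_)
      fun w w' h h' => by rw [map_add]; exact add_mem h h'
    rw [GenModule.nil_apply hn, LinearMap.sub_apply]
    exact sub_mem (𝒲.Lzero_mem β w hw) (Submodule.smul_mem _ _ hw)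

theorem StronglyGradedGenModule.IsEndo.pow {φ : Module.End ℂ W} (h : 𝒲.IsEndo φ) (k : ℕ) :
    𝒲.IsEndo (φ ^ k) := by
  induction k with
  | zero => exact StronglyGradedGenModule.isEndo_one
  | succ k ih =>
    simp only [pow_succ']
    exact ⟨fun n v w => by simp only [Module.End.mul_apply, ih.mode, h.mode],
      fun w => by simp only [Module.End.mul_apply, ih.Lneg, h.Lneg],
      fun w => by simp only [Module.End.mul_apply, ih.Lzero, h.Lzero],
      fun w => by simp only [Module.End.mul_apply, ih.Lpos, h.Lpos],
      fun β w hw => h.mem_gr β _ (ih.mem_gr β w hw)⟩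

theorem StronglyGradedGenModule.IsEndo.smul {φ : Module.End ℂ W} (h : 𝒲.IsEndo φ) (a : ℂ) :
    𝒲.IsEndo (a • φ) :=
  ⟨fun n v w => by simp only [LinearMap.smul_apply, map_smul, h.mode],
    fun w => by simp only [LinearMap.smul_apply, map_smul, h.Lneg],
    fun w => by simp only [LinearMap.smul_apply, map_smul, h.Lzero],
    fun w => by simp only [LinearMap.smul_apply, map_smul, h.Lpos],
    fun β w hw => Submodule.smul_mem _ a (h.mem_gr β w hw)⟩

/-- Whatever commutes with the nilpotent part commutes with its exponential. The grading is
preserved because the value at each vector is a finite sum of powers. -/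
theorem StronglyGradedGenModule.isEndo_locExp (a : ℂ) : 𝒲.IsEndo (locExp (a • 𝒲.nil)) := by
  have h := 𝒲.isLocNilpotent_nil.smul a
  have e : 𝒲.IsEndo (a • 𝒲.nil) := StronglyGradedGenModule.isEndo_nil.smul a
  refine ⟨fun n v w => (locExp_intertwine h h _ (fun w => (e.mode n v w).symm) w).symm,
    fun w => (locExp_intertwine h h _ (fun w => (e.Lneg w).symm) w).symm,
    fun w => (locExp_intertwine h h _ (fun w => (e.Lzero w).symm) w).symm,
    fun w => (locExp_intertwine h h _ (fun w => (e.Lpos w).symm) w).symm, fun β w hw => ?_⟩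
  rw [h.locExp_apply]
  exact finsum_induction (· ∈ 𝒲.gr β) (zero_mem _) (fun _ _ => add_mem)
    fun k => Submodule.smul_mem _ _ ((e.pow k).mem_gr β w hw)

end Strong

/-! ### Homogeneous coefficient families -/

section CoeffFamily

variable {Atilde : Type*} [AddCommGroup Atilde] {A : AddSubgroup Atilde}
  {V W₁ W₂ W₃ : Type*} [AddCommGroup V] [Module ℂ V] [AddCommGroup W₁] [Module ℂ W₁]
  [AddCommGroup W₂] [Module ℂ W₂] [AddCommGroup W₃] [Module ℂ W₃]
  {𝒱 : StronglyGradedVertexAlgebra A V}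

/-- `J a` is homogeneous of degree `a`. -/
def HasDegrees {𝒱 : MCVertexAlgebra V} (𝒲₁ : GenModule 𝒱 W₁) (𝒲₂ : GenModule 𝒱 W₂)
    (𝒲₃ : GenModule 𝒱 W₃) (J : ℂ → W₁ ⊗[ℂ] W₂ →ₗ[ℂ] W₃) : Prop :=
  ∀ (a n₁ n₂ : ℂ) (w₁ : W₁) (w₂ : W₂), w₁ ∈ 𝒲₁.wt n₁ → w₂ ∈ 𝒲₂.wt n₂ →
    J a (w₁ ⊗ₜ w₂) ∈ 𝒲₃.wt (n₁ + n₂ + a)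

/-- The identities satisfied by the family of the homogeneous components `J a`, of degree `a`, of
a `P(u)`-intertwining map. For `u = 1` these are also the identities satisfied by the coefficients
of `x^a (log x)^k`, for fixed `k`, of a logarithmic intertwining operator. -/
structure IsCoeffFamily (u : ℂ) (𝒲₁ : StronglyGradedGenModule 𝒱 W₁)
    (𝒲₂ : StronglyGradedGenModule 𝒱 W₂) (𝒲₃ : StronglyGradedGenModule 𝒱 W₃)
    (J : ℂ → W₁ ⊗[ℂ] W₂ →ₗ[ℂ] W₃) : Prop where
  degree : HasDegrees 𝒲₁.toGenModule 𝒲₂.toGenModule 𝒲₃.toGenModule J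
  mem_gr : ∀ (β γ : Atilde) (w₁ : W₁) (w₂ : W₂), w₁ ∈ 𝒲₁.gr β → w₂ ∈ 𝒲₂.gr γ →
    ∀ a, J a (w₁ ⊗ₜ w₂) ∈ 𝒲₃.gr (β + γ)
  lower_truncation : ∀ (w₁ : W₁) (w₂ : W₂) (a : ℂ), ∃ M : ℕ, ∀ m ≥ M,
    J (a - (m : ℂ)) (w₁ ⊗ₜ w₂) = 0
  jacobi : ∀ (v : V) (w₁ : W₁) (w₂ : W₂) (l m : ℤ) (a : ℂ),
    (∑ᶠ i : ℕ, (binom l i * (-u) ^ i) •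
        𝒲₃.mode (l + m - i) v (J (a - (i : ℂ)) (w₁ ⊗ₜ w₂)))
      - (∑ᶠ i : ℕ, ((-1 : ℂ) ^ l * (-1 : ℂ) ^ i * binom l i * u ^ (l - i)) •
        J (a - l + (i : ℂ)) (w₁ ⊗ₜ 𝒲₂.mode (m + i) v w₂))
      = ∑ᶠ i : ℕ, (binom m i * u ^ (m - i)) •
        J (a - m + (i : ℂ)) (𝒲₁.mode (l + i) v w₁ ⊗ₜ w₂)
  bracket_neg : ∀ (w₁ : W₁) (w₂ : W₂) (a : ℂ),
    𝒲₃.Lneg (J a (w₁ ⊗ₜ w₂)) = J a (w₁ ⊗ₜ 𝒲₂.Lneg w₂) + J a (𝒲₁.Lneg w₁ ⊗ₜ w₂)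
  bracket_zero : ∀ (w₁ : W₁) (w₂ : W₂) (a : ℂ),
    𝒲₃.Lzero (J a (w₁ ⊗ₜ w₂)) = J a (w₁ ⊗ₜ 𝒲₂.Lzero w₂) + (J a (𝒲₁.Lzero w₁ ⊗ₜ w₂)
      + u • J (a - 1) (𝒲₁.Lneg w₁ ⊗ₜ w₂))
  bracket_pos : ∀ (w₁ : W₁) (w₂ : W₂) (a : ℂ),
    𝒲₃.Lpos (J a (w₁ ⊗ₜ w₂)) = J a (w₁ ⊗ₜ 𝒲₂.Lpos w₂) + (J a (𝒲₁.Lpos w₁ ⊗ₜ w₂)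
      + (2 * u) • J (a - 1) (𝒲₁.Lzero w₁ ⊗ₜ w₂) + u ^ 2 • J (a - 2) (𝒲₁.Lneg w₁ ⊗ₜ w₂))

variable {u : ℂ} {𝒲₁ : StronglyGradedGenModule 𝒱 W₁} {𝒲₂ : StronglyGradedGenModule 𝒱 W₂}
  {𝒲₃ : StronglyGradedGenModule 𝒱 W₃} {J J' : ℂ → W₁ ⊗[ℂ] W₂ →ₗ[ℂ] W₃}

section FiniteSupport

variable {P : Type*} [AddCommGroup P] [Module ℂ P] {𝒱 : MCVertexAlgebra V}

theorem finite_support_mode_right (𝒲₂ : GenModule 𝒱 W₂) (f : ℕ → W₁ ⊗[ℂ] W₂ →ₗ[ℂ] P)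
    (c : ℕ → ℂ) (v : V) (w₁ : W₁) (w₂ : W₂) (m : ℤ) :
    (Function.support fun i : ℕ => c i • f i (w₁ ⊗ₜ 𝒲₂.mode (m + i) v w₂)).Finite := by
  obtain ⟨N, hN⟩ := 𝒲₂.exists_nat_truncation v w₂ m
  exact finite_support_of_eventually _ _ N fun i hi => by
    rw [hN i hi, TensorProduct.tmul_zero, map_zero]

theorem finite_support_mode_left (𝒲₁ : GenModule 𝒱 W₁) (f : ℕ → W₁ ⊗[ℂ] W₂ →ₗ[ℂ] P)
    (c : ℕ → ℂ) (v : V) (w₁ : W₁) (w₂ : W₂) (l : ℤ) :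
    (Function.support fun i : ℕ => c i • f i (𝒲₁.mode (l + i) v w₁ ⊗ₜ w₂)).Finite := by
  obtain ⟨N, hN⟩ := 𝒲₁.exists_nat_truncation v w₁ l
  exact finite_support_of_eventually _ _ N fun i hi => by
    rw [hN i hi, TensorProduct.zero_tmul, map_zero]

end FiniteSupport

theorem IsCoeffFamily.finite_support (h : IsCoeffFamily u 𝒲₁ 𝒲₂ 𝒲₃ J) (c : ℕ → ℂ) (s : ℕ → ℤ)
    (v : V) (w₁ : W₁) (w₂ : W₂) (a : ℂ) :
    (Function.support fun i : ℕ =>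
      c i • 𝒲₃.mode (s i) v (J (a - (i : ℂ)) (w₁ ⊗ₜ w₂))).Finite := by
  obtain ⟨M, hM⟩ := h.lower_truncation w₁ w₂ a
  exact finite_support_of_eventually _ _ M fun i hi => by rw [hM i hi, map_zero]

theorem IsCoeffFamily.add (h : IsCoeffFamily u 𝒲₁ 𝒲₂ 𝒲₃ J)
    (h' : IsCoeffFamily u 𝒲₁ 𝒲₂ 𝒲₃ J') : IsCoeffFamily u 𝒲₁ 𝒲₂ 𝒲₃ (J + J') where
  degree a n₁ n₂ w₁ w₂ h₁ h₂ :=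
    add_mem (h.degree a n₁ n₂ w₁ w₂ h₁ h₂) (h'.degree a n₁ n₂ w₁ w₂ h₁ h₂)
  mem_gr β γ w₁ w₂ h₁ h₂ a :=
    add_mem (h.mem_gr β γ w₁ w₂ h₁ h₂ a) (h'.mem_gr β γ w₁ w₂ h₁ h₂ a)
  lower_truncation w₁ w₂ a := by
    obtain ⟨M, hM⟩ := h.lower_truncation w₁ w₂ a
    obtain ⟨M', hM'⟩ := h'.lower_truncation w₁ w₂ a
    refine ⟨max M M', fun m hm => ?_⟩
    rw [Pi.add_apply, LinearMap.add_apply, hM m (le_trans (le_max_left _ _) hm),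
      hM' m (le_trans (le_max_right _ _) hm), add_zero]
  jacobi v w₁ w₂ l m a := by
    simp only [Pi.add_apply, LinearMap.add_apply, map_add, smul_add]
    rw [finsum_add_distrib (h.finite_support _ _ v w₁ w₂ a) (h'.finite_support _ _ v w₁ w₂ a),
      finsum_add_distrib (finite_support_mode_right _ (fun i : ℕ => J (a - l + (i : ℂ))) _ v w₁ w₂ m)
        (finite_support_mode_right _ (fun i : ℕ => J' (a - l + (i : ℂ))) _ v w₁ w₂ m),
      finsum_add_distrib (finite_support_mode_left _ (fun i : ℕ => J (a - m + (i : ℂ))) _ v w₁ w₂ l)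
        (finite_support_mode_left _ (fun i : ℕ => J' (a - m + (i : ℂ))) _ v w₁ w₂ l),
      ← h.jacobi, ← h'.jacobi]
    abel
  bracket_neg w₁ w₂ a := by
    simp only [Pi.add_apply, LinearMap.add_apply, map_add, h.bracket_neg, h'.bracket_neg]
    abel
  bracket_zero w₁ w₂ a := by
    simp only [Pi.add_apply, LinearMap.add_apply, map_add, h.bracket_zero, h'.bracket_zero]
    module
  bracket_pos w₁ w₂ a := by
    simp only [Pi.add_apply, LinearMap.add_apply, map_add, h.bracket_pos, h'.bracket_pos]
    module

/-- Rescaling the component of degree `a` by `e^(ζa)` changes `u` into `u e^ζ`. -/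
theorem IsCoeffFamily.rescale (h : IsCoeffFamily u 𝒲₁ 𝒲₂ 𝒲₃ J) (ζ : ℂ) :
    IsCoeffFamily (u * Complex.exp ζ) 𝒲₁ 𝒲₂ 𝒲₃ (fun a => Complex.exp (ζ * a) • J a) where
  degree a n₁ n₂ w₁ w₂ h₁ h₂ := Submodule.smul_mem _ _ (h.degree a n₁ n₂ w₁ w₂ h₁ h₂)
  mem_gr β γ w₁ w₂ h₁ h₂ a := Submodule.smul_mem _ _ (h.mem_gr β γ w₁ w₂ h₁ h₂ a)
  lower_truncation w₁ w₂ a := by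
    obtain ⟨M, hM⟩ := h.lower_truncation w₁ w₂ a
    exact ⟨M, fun m hm => by rw [LinearMap.smul_apply, hM m hm, smul_zero]⟩
  jacobi v w₁ w₂ l m a := by
    have e := congrArg (Complex.exp (ζ * a) • ·) (h.jacobi v w₁ w₂ l m a)
    simp only [smul_sub, smul_finsum, smul_smul] at e
    simp only [LinearMap.smul_apply, map_smul, smul_smul]
    -- Every term of the identity of degree a involves J in degree a - s together with u^s, up to
    -- sign, so that e^(ζ(a-s)) = e^(ζa) (e^ζ)^(-s) compensates the change of u^s and leaves the
    -- common factor e^(ζa).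
    have hne := Complex.exp_ne_zero ζ
    have hi : ∀ i : ℕ, Complex.exp (ζ * (a - i)) = Complex.exp (ζ * a) * (Complex.exp ζ ^ i)⁻¹ := by
      intro i
      rw [← Complex.exp_nat_mul, ← Complex.exp_neg, ← Complex.exp_add]
      congr 1
      ring
    have hl : ∀ (l : ℤ) (i : ℕ), Complex.exp (ζ * (a - l + i))
        = Complex.exp (ζ * a) * (Complex.exp ζ ^ (l - i))⁻¹ := by
      intro l i
      rw [← Complex.exp_int_mul, ← Complex.exp_neg, ← Complex.exp_add]
      congr 1
      push_cast
      ring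
    convert e using 3
    · funext i
      congr 1
      rw [hi, ← neg_mul, mul_pow]
      field_simp
    · funext i
      congr 1
      rw [hl, mul_zpow]
      have : Complex.exp ζ ^ (l - (i : ℤ)) ≠ 0 := zpow_ne_zero _ hne
      field_simp
    · rename_i i
      congr 1
      rw [hl, mul_zpow]
      have : Complex.exp ζ ^ (m - (i : ℤ)) ≠ 0 := zpow_ne_zero _ hne
      field_simp
  bracket_neg w₁ w₂ a := by
    simp only [LinearMap.smul_apply, map_smul, h.bracket_neg]
    module
  bracket_zero w₁ w₂ a := by
    have e : Complex.exp (ζ * a) = Complex.exp ζ * Complex.exp (ζ * (a - 1)) := by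
      rw [← Complex.exp_add]; congr 1; ring
    simp only [LinearMap.smul_apply, map_smul, h.bracket_zero, e]
    module
  bracket_pos w₁ w₂ a := by
    have e1 : Complex.exp (ζ * (a - 1)) = Complex.exp ζ * Complex.exp (ζ * (a - 2)) := by
      rw [← Complex.exp_add]; congr 1; ring
    have e : Complex.exp (ζ * a) = Complex.exp ζ * Complex.exp (ζ * (a - 1)) := by
      rw [← Complex.exp_add]; congr 1; ring
    simp only [LinearMap.smul_apply, map_smul, h.bracket_pos, e, e1]
    module

/-- Composition with endomorphisms of the three modules. -/
theorem IsCoeffFamily.conj (h : IsCoeffFamily u 𝒲₁ 𝒲₂ 𝒲₃ J) {φ₁ : Module.End ℂ W₁}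
    {φ₂ : Module.End ℂ W₂} {φ₃ : Module.End ℂ W₃} (h₁ : 𝒲₁.IsEndo φ₁) (h₂ : 𝒲₂.IsEndo φ₂)
    (h₃ : 𝒲₃.IsEndo φ₃) :
    IsCoeffFamily u 𝒲₁ 𝒲₂ 𝒲₃ (fun a => φ₃ ∘ₗ J a ∘ₗ TensorProduct.map φ₁ φ₂) where
  degree a n₁ n₂ w₁ w₂ hw₁ hw₂ :=
    h₃.mem_wt (h.degree a n₁ n₂ _ _ (h₁.mem_wt hw₁) (h₂.mem_wt hw₂))
  mem_gr β γ w₁ w₂ hw₁ hw₂ a :=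
    h₃.mem_gr _ _ (h.mem_gr β γ _ _ (h₁.mem_gr _ _ hw₁) (h₂.mem_gr _ _ hw₂) a)
  lower_truncation w₁ w₂ a := by
    obtain ⟨M, hM⟩ := h.lower_truncation (φ₁ w₁) (φ₂ w₂) a
    refine ⟨M, fun m hm => ?_⟩
    rw [LinearMap.comp_apply, LinearMap.comp_apply, TensorProduct.map_tmul, hM m hm, map_zero]
  jacobi v w₁ w₂ l m a := by
    have e := congrArg φ₃ (h.jacobi v (φ₁ w₁) (φ₂ w₂) l m a)
    rw [map_sub, map_finsum _ (h.finite_support _ _ v _ _ a),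
      map_finsum _ (finite_support_mode_right _ (fun i : ℕ => J (a - l + (i : ℂ))) _ v _ _ m),
      map_finsum _ (finite_support_mode_left _ (fun i : ℕ => J (a - m + (i : ℂ))) _ v _ _ l)] at e
    simp only [LinearMap.comp_apply, TensorProduct.map_tmul, h₁.mode, h₂.mode, ← h₃.mode]
    simpa only [map_smul] using e
  bracket_neg w₁ w₂ a := by
    simp only [LinearMap.comp_apply, TensorProduct.map_tmul, h₁.Lneg, h₂.Lneg, ← h₃.Lneg,
      h.bracket_neg, map_add]
  bracket_zero w₁ w₂ a := by
    simp only [LinearMap.comp_apply, TensorProduct.map_tmul, h₁.Lneg, h₁.Lzero, h₂.Lzero,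
      ← h₃.Lzero, h.bracket_zero, map_add, map_smul]
  bracket_pos w₁ w₂ a := by
    simp only [LinearMap.comp_apply, TensorProduct.map_tmul, h₁.Lneg, h₁.Lzero, h₁.Lpos, h₂.Lpos,
      ← h₃.Lpos, h.bracket_pos, map_add, map_smul]

end CoeffFamily

/-! ### The commutator with locally nilpotent operators -/

section AdNil

variable {X M : Type*} [AddCommGroup X] [Module ℂ X] [AddCommGroup M] [Module ℂ M]

/-- The operator `f ↦ N f - f D`. -/
def adOp (N : Module.End ℂ M) (D : Module.End ℂ X) : Module.End ℂ (X →ₗ[ℂ] M) :=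
  LinearMap.compRight ℂ N + LinearMap.lcomp ℂ M (-D)

theorem adOp_apply (N : Module.End ℂ M) (D : Module.End ℂ X) (f : X →ₗ[ℂ] M) (x : X) :
    adOp N D f x = N (f x) - f (D x) := by
  simp [adOp, sub_eq_add_neg]

/-- `adOp` is the sum of composition with N on the left and with -D on the right. These commute, so
`divPow_add` applies. -/
theorem divPow_adOp (N : Module.End ℂ M) (D : Module.End ℂ X) (k : ℕ) (f : X →ₗ[ℂ] M) (x : X) :
    divPow (adOp N D) k f x = ∑ q ∈ Finset.HasAntidiagonal.antidiagonal k,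
      divPow N q.1 (f (divPow (-D) q.2 x)) := by
  have hc : Commute (LinearMap.compRight ℂ N : Module.End ℂ (X →ₗ[ℂ] M))
      (LinearMap.lcomp ℂ M (-D)) := by
    ext f x
    rfl
  have h1 : ∀ (k : ℕ) (f : X →ₗ[ℂ] M) (x : X),
      ((LinearMap.compRight ℂ N : Module.End ℂ (X →ₗ[ℂ] M)) ^ k) f x = (N ^ k) (f x) := by
    intro k
    induction k with
    | zero => intro f x; rfl
    | succ k ih =>
      intro f x
      rw [pow_succ, pow_succ, Module.End.mul_apply, ih]
      rfl
  have h2 : ∀ (k : ℕ) (f : X →ₗ[ℂ] M) (x : X),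
      ((LinearMap.lcomp ℂ M (-D) : Module.End ℂ (X →ₗ[ℂ] M)) ^ k) f x = f (((-D) ^ k) x) := by
    intro k
    induction k with
    | zero => intro f x; rfl
    | succ k ih =>
      intro f x
      rw [pow_succ, pow_succ', Module.End.mul_apply, ih]
      rfl
  rw [adOp, divPow_add hc, LinearMap.sum_apply, LinearMap.sum_apply]
  refine Finset.sum_congr rfl fun q _ => ?_
  simp only [divPow, Module.End.mul_apply, LinearMap.smul_apply, h1, h2, map_smul]

theorem IsLocNilpotent.neg {N : Module.End ℂ M} (h : IsLocNilpotent N) :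
    IsLocNilpotent (-N) := by
  have e := h.smul (-1)
  rwa [neg_one_smul] at e

/-- The finiteness is pointwise in x. On the space of maps, `adOp N D` is in general not locally
nilpotent, so `locExp` is not applied to it; its exponential is only evaluated at vectors. -/
theorem finite_support_divPow_adOp {N : Module.End ℂ M} {D : Module.End ℂ X}
    (hN : IsLocNilpotent N) (hD : IsLocNilpotent D) (f : X →ₗ[ℂ] M) (x : X) :
    (Function.support fun k => divPow (adOp N D) k f x).Finite := by
  have fin := hN.finite_support₂ hD.neg f x
  refine (fin.image fun q => q.1 + q.2).subset fun k hk => ?_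
  rw [Function.mem_support, divPow_adOp] at hk
  obtain ⟨q, hq, hne⟩ := Finset.exists_ne_zero_of_sum_ne_zero hk
  exact ⟨q, hne, Finset.HasAntidiagonal.mem_antidiagonal.mp hq⟩

/-- The exponential of `f ↦ N f - f D` is conjugation by exponentials. -/
theorem finsum_divPow_adOp {N : Module.End ℂ M} {D : Module.End ℂ X}
    (hN : IsLocNilpotent N) (hD : IsLocNilpotent D) (ζ : ℂ) (f : X →ₗ[ℂ] M) (x : X) :
    ∑ᶠ k : ℕ, ζ ^ k • divPow (adOp N D) k f x
      = locExp (ζ • N) (f (locExp ((-ζ) • D) x)) := by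
  rw [← (hN.smul ζ).locExp_comp (hD.smul (-ζ)) f x]
  refine finsum_congr fun k => ?_
  rw [divPow_adOp, Finset.smul_sum]
  refine Finset.sum_congr rfl fun q hq => ?_
  rw [← Finset.HasAntidiagonal.mem_antidiagonal.mp hq, neg_smul, ← smul_neg, divPow_smul,
    divPow_smul, LinearMap.smul_apply, LinearMap.smul_apply, map_smul, map_smul, smul_smul,
    pow_add]

theorem divPow_adOp_succ (N : Module.End ℂ M) (D : Module.End ℂ X) (k : ℕ) (f : X →ₗ[ℂ] M) :
    divPow (adOp N D) (k + 1) f = ((k : ℂ) + 1)⁻¹ • adOp N D (divPow (adOp N D) k f) := by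
  rw [← Module.End.mul_apply, mul_divPow, LinearMap.smul_apply,
    inv_smul_smul₀ (Nat.cast_add_one_ne_zero k)]

variable {M₁ M₂ : Type*} [AddCommGroup M₁] [Module ℂ M₁] [AddCommGroup M₂] [Module ℂ M₂]

/-- The operator `N₁ ⊗ 1 + 1 ⊗ N₂`. -/
def tensorOp (N₁ : Module.End ℂ M₁) (N₂ : Module.End ℂ M₂) : Module.End ℂ (M₁ ⊗[ℂ] M₂) :=
  LinearMap.rTensor M₂ N₁ + LinearMap.lTensor M₁ N₂

theorem tensorOp_tmul (N₁ : Module.End ℂ M₁) (N₂ : Module.End ℂ M₂) (w₁ : M₁) (w₂ : M₂) :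
    tensorOp N₁ N₂ (w₁ ⊗ₜ w₂) = N₁ w₁ ⊗ₜ w₂ + w₁ ⊗ₜ N₂ w₂ := rfl

theorem tensorOp_smul (a : ℂ) (N₁ : Module.End ℂ M₁) (N₂ : Module.End ℂ M₂) :
    tensorOp (a • N₁) (a • N₂) = a • tensorOp N₁ N₂ := by
  rw [tensorOp, tensorOp, LinearMap.rTensor_smul, LinearMap.lTensor_smul, smul_add]

theorem commute_rTensor_lTensor (N₁ : Module.End ℂ M₁) (N₂ : Module.End ℂ M₂) :
    Commute (LinearMap.rTensor M₂ N₁ : Module.End ℂ (M₁ ⊗[ℂ] M₂)) (LinearMap.lTensor M₁ N₂) := by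
  refine TensorProduct.ext' fun x y => ?_
  rfl

theorem divPow_rTensor (N₁ : Module.End ℂ M₁) (k : ℕ) :
    divPow (LinearMap.rTensor M₂ N₁ : Module.End ℂ (M₁ ⊗[ℂ] M₂)) k
      = LinearMap.rTensor M₂ (divPow N₁ k) := by
  rw [divPow, divPow, LinearMap.rTensor_pow, LinearMap.rTensor_smul]

theorem divPow_lTensor (N₂ : Module.End ℂ M₂) (k : ℕ) :
    divPow (LinearMap.lTensor M₁ N₂ : Module.End ℂ (M₁ ⊗[ℂ] M₂)) k
      = LinearMap.lTensor M₁ (divPow N₂ k) := by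
  rw [divPow, divPow, LinearMap.lTensor_pow, LinearMap.lTensor_smul]

theorem divPow_tensorOp_tmul (N₁ : Module.End ℂ M₁) (N₂ : Module.End ℂ M₂) (k : ℕ) (w₁ : M₁)
    (w₂ : M₂) : divPow (tensorOp N₁ N₂) k (w₁ ⊗ₜ w₂)
      = ∑ q ∈ Finset.HasAntidiagonal.antidiagonal k, divPow N₁ q.1 w₁ ⊗ₜ divPow N₂ q.2 w₂ := by
  rw [tensorOp, divPow_add (commute_rTensor_lTensor N₁ N₂), LinearMap.sum_apply]
  simp only [divPow_rTensor, divPow_lTensor]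
  rfl

theorem IsLocNilpotent.rTensor {N₁ : Module.End ℂ M₁} (h : IsLocNilpotent N₁) :
    IsLocNilpotent (LinearMap.rTensor M₂ N₁ : Module.End ℂ (M₁ ⊗[ℂ] M₂)) := by
  intro t
  induction t with
  | zero => exact ⟨0, fun k _ => map_zero _⟩
  | tmul x y =>
    obtain ⟨K, hK⟩ := h x
    exact ⟨K, fun k hk => by
      rw [LinearMap.rTensor_pow, LinearMap.rTensor_tmul, hK k hk, TensorProduct.zero_tmul]⟩
  | add s t hs ht =>
    obtain ⟨K, hK⟩ := hs
    obtain ⟨K', hK'⟩ := ht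
    exact ⟨max K K', fun k hk => by
      rw [map_add, hK k (le_trans (le_max_left _ _) hk), hK' k (le_trans (le_max_right _ _) hk),
        add_zero]⟩

theorem IsLocNilpotent.lTensor {N₂ : Module.End ℂ M₂} (h : IsLocNilpotent N₂) :
    IsLocNilpotent (LinearMap.lTensor M₁ N₂ : Module.End ℂ (M₁ ⊗[ℂ] M₂)) := by
  intro t
  induction t with
  | zero => exact ⟨0, fun k _ => map_zero _⟩
  | tmul x y =>
    obtain ⟨K, hK⟩ := h y
    exact ⟨K, fun k hk => by
      rw [LinearMap.lTensor_pow, LinearMap.lTensor_tmul, hK k hk, TensorProduct.tmul_zero]⟩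
  | add s t hs ht =>
    obtain ⟨K, hK⟩ := hs
    obtain ⟨K', hK'⟩ := ht
    exact ⟨max K K', fun k hk => by
      rw [map_add, hK k (le_trans (le_max_left _ _) hk), hK' k (le_trans (le_max_right _ _) hk),
        add_zero]⟩

theorem IsLocNilpotent.tensorOp {N₁ : Module.End ℂ M₁} {N₂ : Module.End ℂ M₂}
    (h₁ : IsLocNilpotent N₁) (h₂ : IsLocNilpotent N₂) : IsLocNilpotent (tensorOp N₁ N₂) :=
  h₁.rTensor.add h₂.lTensor (commute_rTensor_lTensor N₁ N₂)

/-- The exponential splits over the two commuting summands. Each factor is then computed by viewing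
x ⊗ · or · ⊗ y as an intertwiner. -/
theorem locExp_tensorOp {N₁ : Module.End ℂ M₁} {N₂ : Module.End ℂ M₂}
    (h₁ : IsLocNilpotent N₁) (h₂ : IsLocNilpotent N₂) :
    locExp (_root_.tensorOp N₁ N₂) = TensorProduct.map (locExp N₁) (locExp N₂) := by
  rw [_root_.tensorOp, locExp_add h₁.rTensor h₂.lTensor (commute_rTensor_lTensor N₁ N₂)]
  refine TensorProduct.ext' fun x y => ?_
  have e : locExp (LinearMap.lTensor M₁ N₂ : Module.End ℂ (M₁ ⊗[ℂ] M₂)) (x ⊗ₜ y)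
      = x ⊗ₜ locExp N₂ y :=
    (locExp_intertwine h₂ h₂.lTensor (TensorProduct.mk ℂ M₁ M₂ x) (fun _ => rfl) y).symm
  rw [Module.End.mul_apply, TensorProduct.map_tmul, e]
  exact (locExp_intertwine h₁ h₁.rTensor ((TensorProduct.mk ℂ M₁ M₂).flip (locExp N₂ y))
    (fun _ => rfl) x).symm

end AdNil

/-! ### Coefficient families under the commutator with the nilpotent part. -/

section CoeffFamily

variable {Atilde : Type*} [AddCommGroup Atilde] {A : AddSubgroup Atilde}
  {V W₁ W₂ W₃ : Type*} [AddCommGroup V] [Module ℂ V] [AddCommGroup W₁] [Module ℂ W₁]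
  [AddCommGroup W₂] [Module ℂ W₂] [AddCommGroup W₃] [Module ℂ W₃]

/-- The operator `f ↦ N₃ f - f (N₁ ⊗ 1 + 1 ⊗ N₂)`, where `Nᵢ` is the nilpotent part of `L(0)`. -/
def adNil {𝒱 : MCVertexAlgebra V} (𝒲₁ : GenModule 𝒱 W₁) (𝒲₂ : GenModule 𝒱 W₂)
    (𝒲₃ : GenModule 𝒱 W₃) : Module.End ℂ (W₁ ⊗[ℂ] W₂ →ₗ[ℂ] W₃) :=
  adOp 𝒲₃.nil (tensorOp 𝒲₁.nil 𝒲₂.nil)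

/-- The exponential of `ζ` times `adNil`. -/
def expConj {𝒱 : MCVertexAlgebra V} (𝒲₁ : GenModule 𝒱 W₁) (𝒲₂ : GenModule 𝒱 W₂)
    (𝒲₃ : GenModule 𝒱 W₃) (ζ : ℂ) (f : W₁ ⊗[ℂ] W₂ →ₗ[ℂ] W₃) : W₁ ⊗[ℂ] W₂ →ₗ[ℂ] W₃ :=
  locExp (ζ • 𝒲₃.nil) ∘ₗ f ∘ₗ
    TensorProduct.map (locExp ((-ζ) • 𝒲₁.nil)) (locExp ((-ζ) • 𝒲₂.nil))

/-- The left side is what remains of the powers of log x after substituting ζ for log x; it is a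
conjugation by exponentials, hence invertible. -/
theorem finsum_divPow_adNil {𝒱 : MCVertexAlgebra V} (𝒲₁ : GenModule 𝒱 W₁)
    (𝒲₂ : GenModule 𝒱 W₂) (𝒲₃ : GenModule 𝒱 W₃) (ζ : ℂ) (f : W₁ ⊗[ℂ] W₂ →ₗ[ℂ] W₃)
    (t : W₁ ⊗[ℂ] W₂) :
    ∑ᶠ k : ℕ, ζ ^ k • divPow (adNil 𝒲₁ 𝒲₂ 𝒲₃) k f t = expConj 𝒲₁ 𝒲₂ 𝒲₃ ζ f t := by
  rw [adNil, finsum_divPow_adOp 𝒲₃.isLocNilpotent_nil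
    (𝒲₁.isLocNilpotent_nil.tensorOp 𝒲₂.isLocNilpotent_nil), ← tensorOp_smul,
    locExp_tensorOp (𝒲₁.isLocNilpotent_nil.smul _) (𝒲₂.isLocNilpotent_nil.smul _)]
  rfl

theorem finite_support_divPow_adNil {𝒱 : MCVertexAlgebra V} (𝒲₁ : GenModule 𝒱 W₁)
    (𝒲₂ : GenModule 𝒱 W₂) (𝒲₃ : GenModule 𝒱 W₃) (f : W₁ ⊗[ℂ] W₂ →ₗ[ℂ] W₃) (t : W₁ ⊗[ℂ] W₂) :
    (Function.support fun k => divPow (adNil 𝒲₁ 𝒲₂ 𝒲₃) k f t).Finite :=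
  finite_support_divPow_adOp 𝒲₃.isLocNilpotent_nil
    (𝒲₁.isLocNilpotent_nil.tensorOp 𝒲₂.isLocNilpotent_nil) f t

theorem expConj_neg_expConj {𝒱 : MCVertexAlgebra V} (𝒲₁ : GenModule 𝒱 W₁)
    (𝒲₂ : GenModule 𝒱 W₂) (𝒲₃ : GenModule 𝒱 W₃) (ζ : ℂ) (f : W₁ ⊗[ℂ] W₂ →ₗ[ℂ] W₃) :
    expConj 𝒲₁ 𝒲₂ 𝒲₃ ζ (expConj 𝒲₁ 𝒲₂ 𝒲₃ (-ζ) f) = f := by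
  refine TensorProduct.ext' fun x y => ?_
  simp only [expConj, LinearMap.comp_apply, TensorProduct.map_tmul, neg_neg,
    locExp_neg_apply_locExp (GenModule.isLocNilpotent_nil _)]

variable {𝒱 : StronglyGradedVertexAlgebra A V}
  {u : ℂ} {𝒲₁ : StronglyGradedGenModule 𝒱 W₁} {𝒲₂ : StronglyGradedGenModule 𝒱 W₂}
  {𝒲₃ : StronglyGradedGenModule 𝒱 W₃} {J : ℂ → W₁ ⊗[ℂ] W₂ →ₗ[ℂ] W₃}

theorem IsCoeffFamily.expConj (h : IsCoeffFamily u 𝒲₁ 𝒲₂ 𝒲₃ J) (ζ : ℂ) :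
    IsCoeffFamily u 𝒲₁ 𝒲₂ 𝒲₃ fun a =>
      _root_.expConj 𝒲₁.toGenModule 𝒲₂.toGenModule 𝒲₃.toGenModule ζ (J a) :=
  h.conj (StronglyGradedGenModule.isEndo_locExp _) (StronglyGradedGenModule.isEndo_locExp _)
    (StronglyGradedGenModule.isEndo_locExp _)

/-- A scalar is an endomorphism of W₃. -/
theorem IsCoeffFamily.smul (h : IsCoeffFamily u 𝒲₁ 𝒲₂ 𝒲₃ J) (c : ℂ) :
    IsCoeffFamily u 𝒲₁ 𝒲₂ 𝒲₃ fun a => c • J a := by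
  convert h.conj StronglyGradedGenModule.isEndo_one StronglyGradedGenModule.isEndo_one
    (StronglyGradedGenModule.isEndo_one.smul c) using 2 with a
  exact TensorProduct.ext' fun x y => rfl

theorem IsCoeffFamily.adNil (h : IsCoeffFamily u 𝒲₁ 𝒲₂ 𝒲₃ J) :
    IsCoeffFamily u 𝒲₁ 𝒲₂ 𝒲₃ fun a =>
      _root_.adNil 𝒲₁.toGenModule 𝒲₂.toGenModule 𝒲₃.toGenModule (J a) := by
  have one₁ := StronglyGradedGenModule.isEndo_one (𝒲 := 𝒲₁)
  have one₂ := StronglyGradedGenModule.isEndo_one (𝒲 := 𝒲₂)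
  have one₃ := StronglyGradedGenModule.isEndo_one (𝒲 := 𝒲₃)
  -- The three terms N₃ J, -J (N₁ ⊗ 1) and -J (1 ⊗ N₂) are each compositions with endomorphisms; the
  -- signs are carried by -1 on W₃.
  convert ((h.conj one₁ one₂ StronglyGradedGenModule.isEndo_nil).add
    (h.conj StronglyGradedGenModule.isEndo_nil one₂ (one₃.smul (-1)))).add
    (h.conj one₁ StronglyGradedGenModule.isEndo_nil (one₃.smul (-1))) using 1
  funext a
  refine TensorProduct.ext' fun x y => ?_
  rw [_root_.adNil, adOp_apply, tensorOp_tmul, map_add]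
  simp only [Pi.add_apply, LinearMap.add_apply, LinearMap.comp_apply, TensorProduct.map_tmul,
    LinearMap.smul_apply, Module.End.one_apply]
  module

/-- Consequently the coefficients of each power of log x satisfy the same identities as those of
(log x)^0. -/
theorem IsCoeffFamily.divPow_adNil (h : IsCoeffFamily u 𝒲₁ 𝒲₂ 𝒲₃ J) (k : ℕ) :
    IsCoeffFamily u 𝒲₁ 𝒲₂ 𝒲₃ fun a =>
      divPow (_root_.adNil 𝒲₁.toGenModule 𝒲₂.toGenModule 𝒲₃.toGenModule) k (J a) := by
  induction k with
  | zero => simpa using h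
  | succ k ih =>
    have e := fun a => divPow_adOp_succ 𝒲₃.nil (tensorOp 𝒲₁.nil 𝒲₂.nil) k (J a)
    simp only [_root_.adNil, e]
    exact ih.adNil.smul _

theorem IsCoeffFamily.lower_truncation_tensor (h : IsCoeffFamily u 𝒲₁ 𝒲₂ 𝒲₃ J)
    (t : W₁ ⊗[ℂ] W₂) (a : ℂ) : ∃ M : ℕ, ∀ m ≥ M, J (a - (m : ℂ)) t = 0 := by
  induction t with
  | zero => exact ⟨0, fun m _ => map_zero _⟩
  | tmul x y => exact h.lower_truncation x y a
  | add s t hs ht =>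
    obtain ⟨M, hM⟩ := hs
    obtain ⟨M', hM'⟩ := ht
    exact ⟨max M M', fun m hm => by
      rw [map_add, hM m (le_trans (le_max_left _ _) hm), hM' m (le_trans (le_max_right _ _) hm),
        add_zero]⟩

/-- The lower truncation of the divided powers of `adNil` is uniform. -/
theorem IsCoeffFamily.lower_truncation_uniform (h : IsCoeffFamily u 𝒲₁ 𝒲₂ 𝒲₃ J)
    (t : W₁ ⊗[ℂ] W₂) (a : ℂ) : ∃ M : ℕ, ∀ m ≥ M, ∀ k,
      divPow (_root_.adNil 𝒲₁.toGenModule 𝒲₂.toGenModule 𝒲₃.toGenModule) k (J (a - (m : ℂ))) t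
        = 0 := by
  have hD := (𝒲₁.isLocNilpotent_nil.tensorOp 𝒲₂.isLocNilpotent_nil).neg
  -- Uniformity in k: only the finitely many vectors D^j t with j < K reach `J`, whatever k is, and
  -- the powers of the nilpotent part on W₃ act afterwards, preserving 0. The supremum of the bounds
  -- for these j works.
  obtain ⟨K, hK⟩ := hD.exists_divPow_eq_zero t
  choose M hM using fun j : ℕ =>
    h.lower_truncation_tensor (divPow (-tensorOp 𝒲₁.nil 𝒲₂.nil) j t) a
  refine ⟨(Finset.range K).sup M, fun m hm k => ?_⟩
  rw [_root_.adNil, divPow_adOp]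
  refine Finset.sum_eq_zero fun q _ => ?_
  rcases lt_or_ge q.2 K with hq | hq
  · have := hM q.2 m (le_trans (Finset.le_sup (Finset.mem_range.mpr hq)) hm)
    rw [this, map_zero]
  · have := hK q.2 hq
    rw [this, map_zero, map_zero]

end CoeffFamily

/-! ### Reduction of trilinear identities to homogeneous vectors. -/

section Triadditive

variable {X Y Z P : Type*} [AddCommGroup X] [AddCommGroup Y] [AddCommGroup Z] [AddCommGroup P]

/-- `F` is additive in each of its three variables. -/
structure IsTriadditive (F : X → Y → Z → P) : Prop where
  left : ∀ x x' y z, F (x + x') y z = F x y z + F x' y z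
  mid : ∀ x y y' z, F x (y + y') z = F x y z + F x y' z
  right : ∀ x y z z', F x y (z + z') = F x y z + F x y z'

theorem IsTriadditive.sub {F G : X → Y → Z → P} (hF : IsTriadditive F) (hG : IsTriadditive G) :
    IsTriadditive fun x y z => F x y z - G x y z :=
  ⟨fun _ _ _ _ => by simp only [hF.left, hG.left, add_sub_add_comm],
    fun _ _ _ _ => by simp only [hF.mid, hG.mid, add_sub_add_comm],
    fun _ _ _ _ => by simp only [hF.right, hG.right, add_sub_add_comm]⟩

theorem IsTriadditive.finsum {ι : Type*} {F : ι → X → Y → Z → P} (hF : ∀ i, IsTriadditive (F i))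
    (fin : ∀ x y z, (Function.support fun i => F i x y z).Finite) :
    IsTriadditive fun x y z => ∑ᶠ i, F i x y z :=
  ⟨fun x x' y z => by
      simp only [(hF _).left]; exact finsum_add_distrib (fin x y z) (fin x' y z),
    fun x y y' z => by
      simp only [(hF _).mid]; exact finsum_add_distrib (fin x y z) (fin x y' z),
    fun x y z z' => by
      simp only [(hF _).right]; exact finsum_add_distrib (fin x y z) (fin x y z')⟩

theorem IsTriadditive.eq_zero [Module ℂ X] [Module ℂ Y] [Module ℂ Z] {ι₁ ι₂ ι₃ : Type*}
    [Nonempty ι₁] [Nonempty ι₂] [Nonempty ι₃]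
    {G₁ : ι₁ → Submodule ℂ X} {G₂ : ι₂ → Submodule ℂ Y} {G₃ : ι₃ → Submodule ℂ Z}
    (g₁ : IsGrading G₁) (g₂ : IsGrading G₂) (g₃ : IsGrading G₃)
    {F : X → Y → Z → P} (hF : IsTriadditive F)
    (h : ∀ i j k, ∀ x ∈ G₁ i, ∀ y ∈ G₂ j, ∀ z ∈ G₃ k, F x y z = 0) (x : X) (y : Y) (z : Z) :
    F x y z = 0 := by
  induction x using g₁.induction with
  | add x x' e e' => rw [hF.left, e, e', add_zero]
  | hom i x hx =>
    induction y using g₂.induction with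
    | add y y' e e' => rw [hF.mid, e, e', add_zero]
    | hom j y hy =>
      induction z using g₃.induction with
      | add z z' e e' => rw [hF.right, e, e', add_zero]
      | hom k z hz => exact h i j k x hx y hy z hz

end Triadditive

/-! ### Operators on the completion. -/

section Extend

variable {V W : Type*} [AddCommGroup V] [Module ℂ V] [AddCommGroup W] [Module ℂ W]
  {𝒱 : MCVertexAlgebra V} {𝒲 : GenModule 𝒱 W}

/-- For an operator of a single weight d, only the component of weight r - d reaches weight r. -/
theorem GenModule.extend_shift_apply {T : Module.End ℂ W} {d : ℂ}
    (hT : 𝒲.Lzero * T - T * 𝒲.Lzero = d • T) (w : 𝒲.Completion) (r : ℂ) :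
    (𝒲.extend T w r : W) = T (w (r - d)) := by
  rw [GenModule.extend, finsum_eq_single _ (r - d)]
  · refine 𝒲.grading.proj_apply_of_mem ?_
    have := 𝒲.shift_mem_wt hT (w (r - d)).2
    rwa [sub_add_cancel] at this
  · intro q hq
    refine 𝒲.grading.proj_apply_of_ne (fun h => hq ?_) (𝒲.shift_mem_wt hT (w q).2)
    rw [← h, add_sub_cancel_right]

theorem GenModule.extend_add_left {T T' : Module.End ℂ W} (hT : 𝒲.FiniteShift T)
    (hT' : 𝒲.FiniteShift T') (w : 𝒲.Completion) :
    𝒲.extend (T + T') w = 𝒲.extend T w + 𝒲.extend T' w := by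
  funext r
  simp only [GenModule.extend, Pi.add_apply, LinearMap.add_apply, map_add]
  exact finsum_add_distrib (hT.finite_support w r) (hT'.finite_support w r)

theorem GenModule.LowerTruncated.add {w w' : 𝒲.Completion} (h : 𝒲.LowerTruncated w)
    (h' : 𝒲.LowerTruncated w') : 𝒲.LowerTruncated (w + w') := by
  intro n
  obtain ⟨M, hM⟩ := h n
  obtain ⟨M', hM'⟩ := h' n
  refine ⟨max M M', fun m hm => ?_⟩
  rw [Pi.add_apply, hM m (le_trans (le_max_left _ _) hm), hM' m (le_trans (le_max_right _ _) hm),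
    add_zero]

end Extend

/-! ### Homogeneous components of maps into the completion. -/

section Components

variable {V W₁ W₂ W₃ : Type*} [AddCommGroup V] [Module ℂ V] [AddCommGroup W₁] [Module ℂ W₁]
  [AddCommGroup W₂] [Module ℂ W₂] [AddCommGroup W₃] [Module ℂ W₃]

section Glue

variable {𝒱 : MCVertexAlgebra V} (𝒲₁ : GenModule 𝒱 W₁) (𝒲₂ : GenModule 𝒱 W₂)
  (𝒲₃ : GenModule 𝒱 W₃) {P : Type*} [AddCommGroup P] [Module ℂ P]

/-- The linear map that agrees with `f n₁ n₂` on elements of weights `n₁` and `n₂`. -/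
def glueTensor (f : ℂ → ℂ → W₁ ⊗[ℂ] W₂ →ₗ[ℂ] P) : W₁ ⊗[ℂ] W₂ →ₗ[ℂ] P :=
  TensorProduct.lift (𝒲₁.grading.glue fun n₁ =>
    (𝒲₂.grading.glue fun n₂ => (TensorProduct.curry (f n₁ n₂)).flip).flip)

variable {𝒲₁ 𝒲₂} in
theorem glueTensor_tmul (f : ℂ → ℂ → W₁ ⊗[ℂ] W₂ →ₗ[ℂ] P) {n₁ n₂ : ℂ} {w₁ : W₁} {w₂ : W₂}
    (h₁ : w₁ ∈ 𝒲₁.wt n₁) (h₂ : w₂ ∈ 𝒲₂.wt n₂) :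
    glueTensor 𝒲₁ 𝒲₂ f (w₁ ⊗ₜ w₂) = f n₁ n₂ (w₁ ⊗ₜ w₂) := by
  rw [glueTensor, TensorProduct.lift.tmul, 𝒲₁.grading.glue_apply _ h₁, LinearMap.flip_apply,
    𝒲₂.grading.glue_apply _ h₂]
  rfl

theorem tensor_ext_wt {f g : W₁ ⊗[ℂ] W₂ →ₗ[ℂ] P}
    (h : ∀ n₁ n₂, ∀ w₁ ∈ 𝒲₁.wt n₁, ∀ w₂ ∈ 𝒲₂.wt n₂, f (w₁ ⊗ₜ w₂) = g (w₁ ⊗ₜ w₂)) : f = g := by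
  refine TensorProduct.ext' fun x y => ?_
  induction x using 𝒲₁.grading.induction with
  | add x x' e e' => rw [TensorProduct.add_tmul, map_add, map_add, e, e']
  | hom n₁ x hx =>
    induction y using 𝒲₂.grading.induction with
    | add y y' e e' => rw [TensorProduct.tmul_add, map_add, map_add, e, e']
    | hom n₂ y hy => exact h n₁ n₂ x hx y hy

/-- `J a` is the component of degree `a` of `I`. -/
def IsComponents (I : W₁ ⊗[ℂ] W₂ →ₗ[ℂ] 𝒲₃.Completion) (J : ℂ → W₁ ⊗[ℂ] W₂ →ₗ[ℂ] W₃) : Prop :=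
  ∀ (n₁ n₂ : ℂ) (w₁ : W₁) (w₂ : W₂), w₁ ∈ 𝒲₁.wt n₁ → w₂ ∈ 𝒲₂.wt n₂ →
    ∀ m, (I (w₁ ⊗ₜ w₂) m : W₃) = J (m - n₁ - n₂) (w₁ ⊗ₜ w₂)

/-- The components of `I`. -/
def components (I : W₁ ⊗[ℂ] W₂ →ₗ[ℂ] 𝒲₃.Completion) (a : ℂ) : W₁ ⊗[ℂ] W₂ →ₗ[ℂ] W₃ :=
  glueTensor 𝒲₁ 𝒲₂ fun n₁ n₂ =>
    (𝒲₃.wt (n₁ + n₂ + a)).subtype ∘ₗ LinearMap.proj (n₁ + n₂ + a) ∘ₗ I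

theorem isComponents_components (I : W₁ ⊗[ℂ] W₂ →ₗ[ℂ] 𝒲₃.Completion) :
    IsComponents 𝒲₁ 𝒲₂ 𝒲₃ I (components 𝒲₁ 𝒲₂ 𝒲₃ I) := by
  intro n₁ n₂ w₁ w₂ h₁ h₂ m
  rw [components, glueTensor_tmul _ h₁ h₂]
  have : n₁ + n₂ + (m - n₁ - n₂) = m := by ring
  rw [this]
  rfl

/-- The map with components `J`. -/
def assemble (J : ℂ → W₁ ⊗[ℂ] W₂ →ₗ[ℂ] W₃) : W₁ ⊗[ℂ] W₂ →ₗ[ℂ] 𝒲₃.Completion :=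
  LinearMap.pi fun m => glueTensor 𝒲₁ 𝒲₂ fun n₁ n₂ => 𝒲₃.π m ∘ₗ J (m - n₁ - n₂)

/-- The projection in `assemble` only supplies membership in the weight space; `HasDegrees` makes it
act as the identity here. -/
theorem isComponents_assemble {J : ℂ → W₁ ⊗[ℂ] W₂ →ₗ[ℂ] W₃} (hJ : HasDegrees 𝒲₁ 𝒲₂ 𝒲₃ J) :
    IsComponents 𝒲₁ 𝒲₂ 𝒲₃ (assemble 𝒲₁ 𝒲₂ 𝒲₃ J) J := by
  intro n₁ n₂ w₁ w₂ h₁ h₂ m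
  rw [assemble, LinearMap.pi_apply, glueTensor_tmul _ h₁ h₂, LinearMap.comp_apply]
  refine 𝒲₃.grading.proj_apply_of_mem ?_
  have := hJ (m - n₁ - n₂) n₁ n₂ w₁ w₂ h₁ h₂
  rwa [show n₁ + n₂ + (m - n₁ - n₂) = m by ring] at this

variable {𝒲₁ 𝒲₂ 𝒲₃} {I I' : W₁ ⊗[ℂ] W₂ →ₗ[ℂ] 𝒲₃.Completion}
  {J J' : ℂ → W₁ ⊗[ℂ] W₂ →ₗ[ℂ] W₃}

theorem IsComponents.apply_add (h : IsComponents 𝒲₁ 𝒲₂ 𝒲₃ I J) {n₁ n₂ : ℂ} {w₁ : W₁} {w₂ : W₂}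
    (h₁ : w₁ ∈ 𝒲₁.wt n₁) (h₂ : w₂ ∈ 𝒲₂.wt n₂) (a : ℂ) :
    J a (w₁ ⊗ₜ w₂) = I (w₁ ⊗ₜ w₂) (n₁ + n₂ + a) := by
  rw [h n₁ n₂ w₁ w₂ h₁ h₂]
  congr 2
  ring

theorem IsComponents.hasDegrees (h : IsComponents 𝒲₁ 𝒲₂ 𝒲₃ I J) : HasDegrees 𝒲₁ 𝒲₂ 𝒲₃ J := by
  intro a n₁ n₂ w₁ w₂ h₁ h₂
  rw [h.apply_add h₁ h₂]
  exact (I (w₁ ⊗ₜ w₂) _).2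

/-- Together with `unique_left`, this makes maps and families determine each other; linearity of the
final equivalence and the inverse laws are deduced from it. -/
theorem IsComponents.unique_right (h : IsComponents 𝒲₁ 𝒲₂ 𝒲₃ I J)
    (h' : IsComponents 𝒲₁ 𝒲₂ 𝒲₃ I J') : J = J' := by
  funext a
  refine tensor_ext_wt 𝒲₁ 𝒲₂ fun n₁ n₂ w₁ h₁ w₂ h₂ => ?_
  rw [h.apply_add h₁ h₂, h'.apply_add h₁ h₂]

theorem IsComponents.unique_left (h : IsComponents 𝒲₁ 𝒲₂ 𝒲₃ I J)
    (h' : IsComponents 𝒲₁ 𝒲₂ 𝒲₃ I' J) : I = I' := by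
  refine tensor_ext_wt 𝒲₁ 𝒲₂ fun n₁ n₂ w₁ h₁ w₂ h₂ => ?_
  funext m
  refine Subtype.ext ?_
  rw [h n₁ n₂ w₁ w₂ h₁ h₂, h' n₁ n₂ w₁ w₂ h₁ h₂]

theorem IsComponents.lowerTruncated (h : IsComponents 𝒲₁ 𝒲₂ 𝒲₃ I J)
    (hJ : ∀ (w₁ : W₁) (w₂ : W₂) (a : ℂ), ∃ M : ℕ, ∀ m ≥ M, J (a - (m : ℂ)) (w₁ ⊗ₜ w₂) = 0)
    (w₁ : W₁) (w₂ : W₂) : 𝒲₃.LowerTruncated (I (w₁ ⊗ₜ w₂)) := by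
  induction w₁ using 𝒲₁.grading.induction with
  | add x x' e e' => rw [TensorProduct.add_tmul, map_add]; exact e.add e'
  | hom n₁ x hx =>
    induction w₂ using 𝒲₂.grading.induction with
    | add y y' e e' => rw [TensorProduct.tmul_add, map_add]; exact e.add e'
    | hom n₂ y hy =>
      intro n
      obtain ⟨M, hM⟩ := hJ x y (n - n₁ - n₂)
      refine ⟨M, fun m hm => Subtype.ext ?_⟩
      rw [h n₁ n₂ x y hx hy, show n - (m : ℂ) - n₁ - n₂ = n - n₁ - n₂ - m by ring, hM m hm]
      rfl

theorem IsComponents.lower_truncation (h : IsComponents 𝒲₁ 𝒲₂ 𝒲₃ I J)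
    (hI : ∀ (w₁ : W₁) (w₂ : W₂), 𝒲₃.LowerTruncated (I (w₁ ⊗ₜ w₂)))
    (w₁ : W₁) (w₂ : W₂) (a : ℂ) : ∃ M : ℕ, ∀ m ≥ M, J (a - (m : ℂ)) (w₁ ⊗ₜ w₂) = 0 := by
  induction w₁ using 𝒲₁.grading.induction with
  | add x x' e e' =>
    obtain ⟨M, hM⟩ := e
    obtain ⟨M', hM'⟩ := e'
    exact ⟨max M M', fun m hm => by
      rw [TensorProduct.add_tmul, map_add, hM m (le_trans (le_max_left _ _) hm),
        hM' m (le_trans (le_max_right _ _) hm), add_zero]⟩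
  | hom n₁ x hx =>
    induction w₂ using 𝒲₂.grading.induction with
    | add y y' e e' =>
      obtain ⟨M, hM⟩ := e
      obtain ⟨M', hM'⟩ := e'
      exact ⟨max M M', fun m hm => by
        rw [TensorProduct.tmul_add, map_add, hM m (le_trans (le_max_left _ _) hm),
          hM' m (le_trans (le_max_right _ _) hm), add_zero]⟩
    | hom n₂ y hy =>
      obtain ⟨M, hM⟩ := hI x y (n₁ + n₂ + a)
      refine ⟨M, fun m hm => ?_⟩
      rw [h.apply_add hx hy, ← add_sub_assoc, hM m hm]
      rfl

/-! The Jacobi identities for `I` and for `J`, and their three terms. -/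

variable (I J) in
/-- The defect of the Jacobi identity for `I`. -/
def jacobiDefect (𝒲₁ : GenModule 𝒱 W₁) (𝒲₂ : GenModule 𝒱 W₂) (z : ℂ) (l m : ℤ) (r : ℂ) (v : V)
    (w₁ : W₁) (w₂ : W₂) : 𝒲₃.wt r :=
  (∑ᶠ i : ℕ, (binom l i * (-z) ^ i) • 𝒲₃.extend (𝒲₃.mode (l + m - i) v) (I (w₁ ⊗ₜ w₂)) r)
    - (∑ᶠ i : ℕ, ((-1 : ℂ) ^ l * (-1 : ℂ) ^ i * binom l i * z ^ (l - i)) •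
      I (w₁ ⊗ₜ 𝒲₂.mode (m + i) v w₂) r)
    - ∑ᶠ i : ℕ, (binom m i * z ^ (m - i)) • I (𝒲₁.mode (l + i) v w₁ ⊗ₜ w₂) r

variable (J) in
/-- The defect of the Jacobi identity for `J`. -/
def coeffJacobiDefect (𝒲₁ : GenModule 𝒱 W₁) (𝒲₂ : GenModule 𝒱 W₂) (𝒲₃ : GenModule 𝒱 W₃)
    (z : ℂ) (l m : ℤ) (a : ℂ) (v : V) (w₁ : W₁) (w₂ : W₂) : W₃ :=
  (∑ᶠ i : ℕ, (binom l i * (-z) ^ i) • 𝒲₃.mode (l + m - i) v (J (a - (i : ℂ)) (w₁ ⊗ₜ w₂)))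
    - (∑ᶠ i : ℕ, ((-1 : ℂ) ^ l * (-1 : ℂ) ^ i * binom l i * z ^ (l - i)) •
      J (a - l + (i : ℂ)) (w₁ ⊗ₜ 𝒲₂.mode (m + i) v w₂))
    - ∑ᶠ i : ℕ, (binom m i * z ^ (m - i)) • J (a - m + (i : ℂ)) (𝒲₁.mode (l + i) v w₁ ⊗ₜ w₂)

variable {z : ℂ}

theorem isTriadditive_mode_right (f : ℕ → W₁ ⊗[ℂ] W₂ →ₗ[ℂ] P) (c : ℕ → ℂ) (m : ℤ) :
    IsTriadditive fun (v : V) w₁ w₂ => ∑ᶠ i : ℕ, c i • f i (w₁ ⊗ₜ 𝒲₂.mode (m + i) v w₂) :=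
  IsTriadditive.finsum (F := fun i (v : V) w₁ w₂ => c i • f i (w₁ ⊗ₜ 𝒲₂.mode (m + i) v w₂))
    (fun i => ⟨fun _ _ _ _ => by
        simp only [map_add, LinearMap.add_apply, TensorProduct.tmul_add, smul_add],
      fun _ _ _ _ => by simp only [map_add, TensorProduct.add_tmul, smul_add],
      fun _ _ _ _ => by simp only [map_add, TensorProduct.tmul_add, smul_add]⟩)
    fun v w₁ w₂ => finite_support_mode_right 𝒲₂ f c v w₁ w₂ m

theorem isTriadditive_mode_left (f : ℕ → W₁ ⊗[ℂ] W₂ →ₗ[ℂ] P) (c : ℕ → ℂ) (l : ℤ) :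
    IsTriadditive fun (v : V) w₁ w₂ => ∑ᶠ i : ℕ, c i • f i (𝒲₁.mode (l + i) v w₁ ⊗ₜ w₂) :=
  IsTriadditive.finsum (F := fun i (v : V) w₁ w₂ => c i • f i (𝒲₁.mode (l + i) v w₁ ⊗ₜ w₂))
    (fun i => ⟨fun _ _ _ _ => by
        simp only [map_add, LinearMap.add_apply, TensorProduct.add_tmul, smul_add],
      fun _ _ _ _ => by simp only [map_add, TensorProduct.add_tmul, smul_add],
      fun _ _ _ _ => by simp only [map_add, TensorProduct.tmul_add, smul_add]⟩)
    fun v w₁ w₂ => finite_support_mode_left 𝒲₁ f c v w₁ w₂ l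

/-- Splitting the infinite sums requires finite supports: lower truncation of I gives it for the sum
with modes on W₃, and truncation of the modes gives it for the other two. -/
theorem isTriadditive_jacobiDefect
    (hI : ∀ (w₁ : W₁) (w₂ : W₂), 𝒲₃.LowerTruncated (I (w₁ ⊗ₜ w₂))) (l m : ℤ) (r : ℂ) :
    IsTriadditive (jacobiDefect I 𝒲₁ 𝒲₂ z l m r) := by
  refine (IsTriadditive.sub ?_ (isTriadditive_mode_right (𝒲₂ := 𝒲₂)
    (fun _ => LinearMap.proj r ∘ₗ I) _ m)).sub
    (isTriadditive_mode_left (𝒲₁ := 𝒲₁) (fun _ => LinearMap.proj r ∘ₗ I) _ l)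
  refine IsTriadditive.finsum (F := fun (i : ℕ) (v : V) (w₁ : W₁) (w₂ : W₂) =>
    (binom l i * (-z) ^ i) • 𝒲₃.extend (𝒲₃.mode (l + m - i) v) (I (w₁ ⊗ₜ w₂)) r) (fun i => ?_)
    fun v w₁ w₂ => (hI w₁ w₂).finite_support v (l + m) _ r
  refine ⟨fun v v' w₁ w₂ => ?_, fun v w₁ w₁' w₂ => ?_, fun v w₁ w₂ w₂' => ?_⟩
  · rw [map_add, GenModule.extend_add_left (𝒲₃.finiteShift_mode _ v) (𝒲₃.finiteShift_mode _ v'),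
      Pi.add_apply, smul_add]
  · rw [TensorProduct.add_tmul, map_add, (𝒲₃.finiteShift_mode _ v).extend_add, Pi.add_apply,
      smul_add]
  · rw [TensorProduct.tmul_add, map_add, (𝒲₃.finiteShift_mode _ v).extend_add, Pi.add_apply,
      smul_add]

theorem isTriadditive_coeffJacobiDefect
    (hJ : ∀ (w₁ : W₁) (w₂ : W₂) (a : ℂ), ∃ M : ℕ, ∀ m ≥ M, J (a - (m : ℂ)) (w₁ ⊗ₜ w₂) = 0)
    (l m : ℤ) (a : ℂ) : IsTriadditive (coeffJacobiDefect J 𝒲₁ 𝒲₂ 𝒲₃ z l m a) := by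
  refine (IsTriadditive.sub ?_ (isTriadditive_mode_right (𝒲₂ := 𝒲₂)
    (fun i : ℕ => J (a - l + (i : ℂ))) _ m)).sub
    (isTriadditive_mode_left (𝒲₁ := 𝒲₁) (fun i : ℕ => J (a - m + (i : ℂ))) _ l)
  refine IsTriadditive.finsum (F := fun (i : ℕ) (v : V) (w₁ : W₁) (w₂ : W₂) =>
    (binom l i * (-z) ^ i) • 𝒲₃.mode (l + m - i) v (J (a - (i : ℂ)) (w₁ ⊗ₜ w₂))) (fun i => ?_)
    fun v w₁ w₂ => ?_
  · exact ⟨fun _ _ _ _ => by simp only [map_add, LinearMap.add_apply, smul_add],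
      fun _ _ _ _ => by simp only [map_add, TensorProduct.add_tmul, smul_add],
      fun _ _ _ _ => by simp only [map_add, TensorProduct.tmul_add, smul_add]⟩
  · obtain ⟨M, hM⟩ := hJ w₁ w₂ a
    exact finite_support_of_eventually _ _ M fun i hi => by rw [hM i hi, map_zero]

/-- On homogeneous vectors all terms of the identity in degree a have the same weight. For instance,
the mode of index l + m - i adds k - (l + m - i) - 1 and J in degree a - i adds a - i, so i cancels
and the weight is r. For general v several weights mix, which is why homogeneity is imposed first.
-/
theorem IsComponents.jacobiDefect_eq (h : IsComponents 𝒲₁ 𝒲₂ 𝒲₃ I J)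
    (hI : ∀ (w₁ : W₁) (w₂ : W₂), 𝒲₃.LowerTruncated (I (w₁ ⊗ₜ w₂)))
    (l m : ℤ) (r a : ℂ) {k : ℤ} {n₁ n₂ : ℂ} {v : V} {w₁ : W₁} {w₂ : W₂} (hv : v ∈ 𝒱.eigen k)
    (h₁ : w₁ ∈ 𝒲₁.wt n₁) (h₂ : w₂ ∈ 𝒲₂.wt n₂) (hr : r = a + k - l - m - 1 + n₁ + n₂) :
    (jacobiDefect I 𝒲₁ 𝒲₂ z l m r v w₁ w₂ : W₃)
      = coeffJacobiDefect J 𝒲₁ 𝒲₂ 𝒲₃ z l m a v w₁ w₂ := by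
  have s : ∀ g : ℕ → 𝒲₃.wt r, (Function.support g).Finite →
      ((∑ᶠ i, g i : 𝒲₃.wt r) : W₃) = ∑ᶠ i, (g i : W₃) := fun g hg =>
    map_finsum (𝒲₃.wt r).subtype hg
  have e₂ := s (fun i : ℕ => ((-1 : ℂ) ^ l * (-1 : ℂ) ^ i * binom l i * z ^ (l - i)) •
      I (w₁ ⊗ₜ 𝒲₂.mode (m + i) v w₂) r)
    (finite_support_mode_right 𝒲₂ (fun _ => LinearMap.proj r ∘ₗ I) _ v w₁ w₂ m)
  have e₃ := s (fun i : ℕ => (binom m i * z ^ (m - i)) • I (𝒲₁.mode (l + i) v w₁ ⊗ₜ w₂) r)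
    (finite_support_mode_left 𝒲₁ (fun _ => LinearMap.proj r ∘ₗ I) _ v w₁ w₂ l)
  rw [jacobiDefect, coeffJacobiDefect, Submodule.coe_sub, Submodule.coe_sub,
    s _ ((hI w₁ w₂).finite_support v (l + m) _ r), e₂, e₃]
  congr 1
  · congr 1
    · refine finsum_congr fun i => ?_
      rw [Submodule.coe_smul, GenModule.extend_shift_apply (GenModule.bracket_mode v hv _),
        h n₁ n₂ w₁ w₂ h₁ h₂]
      congr 4
      rw [hr]
      push_cast
      ring
    · refine finsum_congr fun i => ?_
      rw [Submodule.coe_smul, h _ _ _ _ h₁ (𝒲₂.mode_mem_wt hv _ h₂)]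
      congr 3
      rw [hr]
      push_cast
      ring
  · refine finsum_congr fun i => ?_
    rw [Submodule.coe_smul, h _ _ _ _ (𝒲₁.mode_mem_wt hv _ h₁) h₂]
    congr 3
    rw [hr]
    push_cast
    ring

end Glue

end Components

/-! ### Intertwining maps versus coefficient families. -/

section Equivalence

variable {Atilde : Type*} [AddCommGroup Atilde] {A : AddSubgroup Atilde}
  {V W₁ W₂ W₃ : Type*} [AddCommGroup V] [Module ℂ V] [AddCommGroup W₁] [Module ℂ W₁]
  [AddCommGroup W₂] [Module ℂ W₂] [AddCommGroup W₃] [Module ℂ W₃]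

theorem GenModule.Lneg_mem_wt {W : Type*} [AddCommGroup W] [Module ℂ W] {𝒱 : MCVertexAlgebra V}
    {𝒲 : GenModule 𝒱 W} {n : ℂ} {w : W} (hw : w ∈ 𝒲.wt n) : 𝒲.Lneg w ∈ 𝒲.wt (n + 1) :=
  𝒲.shift_mem_wt 𝒲.bracket_L.1 hw

theorem GenModule.Lzero_mem_wt {W : Type*} [AddCommGroup W] [Module ℂ W] {𝒱 : MCVertexAlgebra V}
    {𝒲 : GenModule 𝒱 W} {n : ℂ} {w : W} (hw : w ∈ 𝒲.wt n) : 𝒲.Lzero w ∈ 𝒲.wt n :=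
  GenModule.mem_wt_of_commute (fun _ => rfl) hw

theorem GenModule.Lpos_mem_wt {W : Type*} [AddCommGroup W] [Module ℂ W] {𝒱 : MCVertexAlgebra V}
    {𝒲 : GenModule 𝒱 W} {n : ℂ} {w : W} (hw : w ∈ 𝒲.wt n) : 𝒲.Lpos w ∈ 𝒲.wt (n - 1) := by
  have := 𝒲.shift_mem_wt 𝒲.bracket_L.2.2 hw
  rwa [← sub_eq_add_neg] at this

section Homogeneous

variable {𝒱 : MCVertexAlgebra V} {𝒲₁ : GenModule 𝒱 W₁} {𝒲₂ : GenModule 𝒱 W₂}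
  {𝒲₃ : GenModule 𝒱 W₃} {I : W₁ ⊗[ℂ] W₂ →ₗ[ℂ] 𝒲₃.Completion}
  {J : ℂ → W₁ ⊗[ℂ] W₂ →ₗ[ℂ] W₃}

/-- The weight m occurs in the type of the component, so the equation for m is kept as a hypothesis
instead of being rewritten at each use. -/
theorem IsComponents.apply_of_eq (h : IsComponents 𝒲₁ 𝒲₂ 𝒲₃ I J) {n₁ n₂ m a : ℂ} {w₁ : W₁}
    {w₂ : W₂} (h₁ : w₁ ∈ 𝒲₁.wt n₁) (h₂ : w₂ ∈ 𝒲₂.wt n₂) (hm : m = n₁ + n₂ + a) :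
    (I (w₁ ⊗ₜ w₂) m : W₃) = J a (w₁ ⊗ₜ w₂) := by
  rw [hm, h.apply_add h₁ h₂]

/-- L(j) changes weights by -j, which explains r here and in the two analogues for L(0) and L(1).
There, a term with L(j-i)w₁ gains i in weight relative to L(j)w₁, so its degree drops to a - i. -/
theorem IsComponents.bracket_neg_iff (h : IsComponents 𝒲₁ 𝒲₂ 𝒲₃ I J) {n₁ n₂ : ℂ} {w₁ : W₁} {w₂ : W₂}
    (h₁ : w₁ ∈ 𝒲₁.wt n₁) (h₂ : w₂ ∈ 𝒲₂.wt n₂) {a r : ℂ} (hr : r = n₁ + n₂ + a + 1) :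
    𝒲₃.extend 𝒲₃.Lneg (I (w₁ ⊗ₜ w₂)) r = (I (w₁ ⊗ₜ 𝒲₂.Lneg w₂) + I (𝒲₁.Lneg w₁ ⊗ₜ w₂)) r ↔
      𝒲₃.Lneg (J a (w₁ ⊗ₜ w₂)) = J a (w₁ ⊗ₜ 𝒲₂.Lneg w₂) + J a (𝒲₁.Lneg w₁ ⊗ₜ w₂) := by
  rw [Subtype.ext_iff, GenModule.extend_shift_apply 𝒲₃.bracket_L.1, Pi.add_apply,
    Submodule.coe_add, h.apply_of_eq (a := a) h₁ h₂ (by rw [hr]; ring),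
    h.apply_of_eq (a := a) h₁ (GenModule.Lneg_mem_wt h₂) (by rw [hr]; ring),
    h.apply_of_eq (a := a) (GenModule.Lneg_mem_wt h₁) h₂ (by rw [hr]; ring)]

theorem IsComponents.bracket_zero_iff (h : IsComponents 𝒲₁ 𝒲₂ 𝒲₃ I J) {n₁ n₂ : ℂ} {w₁ : W₁} {w₂ : W₂}
    (h₁ : w₁ ∈ 𝒲₁.wt n₁) (h₂ : w₂ ∈ 𝒲₂.wt n₂) {a r : ℂ} (hr : r = n₁ + n₂ + a) (z : ℂ) :
    𝒲₃.extend 𝒲₃.Lzero (I (w₁ ⊗ₜ w₂)) r = (I (w₁ ⊗ₜ 𝒲₂.Lzero w₂)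
        + (I (𝒲₁.Lzero w₁ ⊗ₜ w₂) + z • I (𝒲₁.Lneg w₁ ⊗ₜ w₂))) r ↔
      𝒲₃.Lzero (J a (w₁ ⊗ₜ w₂)) = J a (w₁ ⊗ₜ 𝒲₂.Lzero w₂)
        + (J a (𝒲₁.Lzero w₁ ⊗ₜ w₂) + z • J (a - 1) (𝒲₁.Lneg w₁ ⊗ₜ w₂)) := by
  rw [Subtype.ext_iff, GenModule.extend_shift_apply 𝒲₃.bracket_L.2.1, Pi.add_apply, Pi.add_apply,
    Pi.smul_apply, Submodule.coe_add, Submodule.coe_add, Submodule.coe_smul,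
    h.apply_of_eq (a := a) h₁ h₂ (by rw [hr]; ring),
    h.apply_of_eq (a := a) h₁ (GenModule.Lzero_mem_wt h₂) (by rw [hr]),
    h.apply_of_eq (a := a) (GenModule.Lzero_mem_wt h₁) h₂ (by rw [hr]),
    h.apply_of_eq (a := a - 1) (GenModule.Lneg_mem_wt h₁) h₂ (by rw [hr]; ring)]

theorem IsComponents.bracket_pos_iff (h : IsComponents 𝒲₁ 𝒲₂ 𝒲₃ I J) {n₁ n₂ : ℂ} {w₁ : W₁} {w₂ : W₂}
    (h₁ : w₁ ∈ 𝒲₁.wt n₁) (h₂ : w₂ ∈ 𝒲₂.wt n₂) {a r : ℂ} (hr : r = n₁ + n₂ + a - 1) (z : ℂ) :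
    𝒲₃.extend 𝒲₃.Lpos (I (w₁ ⊗ₜ w₂)) r = (I (w₁ ⊗ₜ 𝒲₂.Lpos w₂)
        + (I (𝒲₁.Lpos w₁ ⊗ₜ w₂) + (2 * z) • I (𝒲₁.Lzero w₁ ⊗ₜ w₂)
          + z ^ 2 • I (𝒲₁.Lneg w₁ ⊗ₜ w₂))) r ↔
      𝒲₃.Lpos (J a (w₁ ⊗ₜ w₂)) = J a (w₁ ⊗ₜ 𝒲₂.Lpos w₂)
        + (J a (𝒲₁.Lpos w₁ ⊗ₜ w₂) + (2 * z) • J (a - 1) (𝒲₁.Lzero w₁ ⊗ₜ w₂)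
          + z ^ 2 • J (a - 2) (𝒲₁.Lneg w₁ ⊗ₜ w₂)) := by
  rw [Subtype.ext_iff, GenModule.extend_shift_apply 𝒲₃.bracket_L.2.2, Pi.add_apply, Pi.add_apply,
    Pi.add_apply, Pi.smul_apply, Pi.smul_apply, Submodule.coe_add, Submodule.coe_add,
    Submodule.coe_add, Submodule.coe_smul, Submodule.coe_smul,
    h.apply_of_eq (a := a) h₁ h₂ (by rw [hr]; ring),
    h.apply_of_eq (a := a) h₁ (GenModule.Lpos_mem_wt h₂) (by rw [hr]; ring),
    h.apply_of_eq (a := a) (GenModule.Lpos_mem_wt h₁) h₂ (by rw [hr]; ring),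
    h.apply_of_eq (a := a - 1) (GenModule.Lzero_mem_wt h₁) h₂ (by rw [hr]; ring),
    h.apply_of_eq (a := a - 2) (GenModule.Lneg_mem_wt h₁) h₂ (by rw [hr]; ring)]

theorem bilinear_induction (𝒲₁ : GenModule 𝒱 W₁) (𝒲₂ : GenModule 𝒱 W₂) {p : W₁ → W₂ → Prop}
    (hom : ∀ n₁ n₂, ∀ w₁ ∈ 𝒲₁.wt n₁, ∀ w₂ ∈ 𝒲₂.wt n₂, p w₁ w₂)
    (left : ∀ w₁ w₁' w₂, p w₁ w₂ → p w₁' w₂ → p (w₁ + w₁') w₂)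
    (right : ∀ w₁ w₂ w₂', p w₁ w₂ → p w₁ w₂' → p w₁ (w₂ + w₂')) (w₁ : W₁) (w₂ : W₂) :
    p w₁ w₂ := by
  induction w₁ using 𝒲₁.grading.induction with
  | add x x' e e' => exact left _ _ _ e e'
  | hom n₁ x hx =>
    induction w₂ using 𝒲₂.grading.induction with
    | add y y' e e' => exact right _ _ _ e e'
    | hom n₂ y hy => exact hom n₁ n₂ x hx y hy

end Homogeneous

variable {𝒱 : StronglyGradedVertexAlgebra A V} {z : ℂ} {𝒲₁ : StronglyGradedGenModule 𝒱 W₁}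
  {𝒲₂ : StronglyGradedGenModule 𝒱 W₂} {𝒲₃ : StronglyGradedGenModule 𝒱 W₃}
  {I : W₁ ⊗[ℂ] W₂ →ₗ[ℂ] 𝒲₃.Completion} {J : ℂ → W₁ ⊗[ℂ] W₂ →ₗ[ℂ] W₃}

/-- The components of a `P(z)`-intertwining map form a coefficient family. -/
theorem IsComponents.isCoeffFamily
    (h : IsComponents 𝒲₁.toGenModule 𝒲₂.toGenModule 𝒲₃.toGenModule I J)
    (hI : IsPIntertwining z 𝒲₁ 𝒲₂ 𝒲₃ I) : IsCoeffFamily z 𝒲₁ 𝒲₂ 𝒲₃ J where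
  degree := h.hasDegrees
  mem_gr β γ w₁ w₂ hw₁ hw₂ a := by
    refine StronglyGradedGenModule.gr_induction (p := fun w₁ => J a (w₁ ⊗ₜ w₂) ∈ 𝒲₃.gr (β + γ))
      hw₁ (fun n₁ w₁ h₁ hw₁ => ?_)
      fun w w' e e' => by rw [TensorProduct.add_tmul, map_add]; exact add_mem e e'
    refine StronglyGradedGenModule.gr_induction (p := fun w₂ => J a (w₁ ⊗ₜ w₂) ∈ 𝒲₃.gr (β + γ))
      hw₂ (fun n₂ w₂ h₂ hw₂ => ?_)
      fun w w' e e' => by rw [TensorProduct.tmul_add, map_add]; exact add_mem e e'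
    rw [h.apply_add h₁ h₂]
    exact hI.grading_compatible β γ w₁ w₂ hw₁ hw₂ _
  lower_truncation := h.lower_truncation hI.lower_truncation
  jacobi v w₁ w₂ l m a := by
    refine sub_eq_zero.mp ?_
    refine (isTriadditive_coeffJacobiDefect (h.lower_truncation hI.lower_truncation) l m
      a).eq_zero 𝒱.grading 𝒲₁.grading 𝒲₂.grading (fun k n₁ n₂ v hv w₁ h₁ w₂ h₂ => ?_) v w₁ w₂
    -- The weight at which the identity for I is used is fixed by unification with the final `rfl`.
    rw [← h.jacobiDefect_eq hI.lower_truncation l m _ a hv h₁ h₂ rfl, jacobiDefect,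
      hI.jacobi, add_sub_cancel_right, sub_self]
    rfl
  bracket_neg w₁ w₂ a := by
    induction w₁, w₂ using bilinear_induction 𝒲₁.toGenModule 𝒲₂.toGenModule with
    | hom n₁ n₂ w₁ h₁ w₂ h₂ =>
      exact (h.bracket_neg_iff h₁ h₂ rfl).mp (congrFun (hI.bracket_neg w₁ w₂) _)
    | left x x' y e e' =>
      simp only [TensorProduct.add_tmul, map_add, e, e']
      abel
    | right x y y' e e' =>
      simp only [TensorProduct.tmul_add, map_add, e, e']
      abel
  bracket_zero w₁ w₂ a := by
    induction w₁, w₂ using bilinear_induction 𝒲₁.toGenModule 𝒲₂.toGenModule with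
    | hom n₁ n₂ w₁ h₁ w₂ h₂ =>
      exact (h.bracket_zero_iff h₁ h₂ rfl z).mp (congrFun (hI.bracket_zero w₁ w₂) _)
    | left x x' y e e' =>
      simp only [TensorProduct.add_tmul, map_add, e, e', smul_add]
      abel
    | right x y y' e e' =>
      simp only [TensorProduct.tmul_add, map_add, e, e', smul_add]
      abel
  bracket_pos w₁ w₂ a := by
    induction w₁, w₂ using bilinear_induction 𝒲₁.toGenModule 𝒲₂.toGenModule with
    | hom n₁ n₂ w₁ h₁ w₂ h₂ =>
      exact (h.bracket_pos_iff h₁ h₂ rfl z).mp (congrFun (hI.bracket_pos w₁ w₂) _)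
    | left x x' y e e' =>
      simp only [TensorProduct.add_tmul, map_add, e, e', smul_add]
      abel
    | right x y y' e e' =>
      simp only [TensorProduct.tmul_add, map_add, e, e', smul_add]
      abel

/-- A map whose components form a coefficient family is a `P(z)`-intertwining map. -/
theorem IsComponents.isPIntertwining
    (h : IsComponents 𝒲₁.toGenModule 𝒲₂.toGenModule 𝒲₃.toGenModule I J)
    (hJ : IsCoeffFamily z 𝒲₁ 𝒲₂ 𝒲₃ J) : IsPIntertwining z 𝒲₁ 𝒲₂ 𝒲₃ I where
  grading_compatible β γ w₁ w₂ hw₁ hw₂ m := by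
    refine StronglyGradedGenModule.gr_induction
      (p := fun w₁ => (I (w₁ ⊗ₜ w₂) m : W₃) ∈ 𝒲₃.gr (β + γ)) hw₁ (fun n₁ w₁ h₁ hw₁ => ?_)
      fun w w' e e' => by rw [TensorProduct.add_tmul, map_add]; exact add_mem e e'
    refine StronglyGradedGenModule.gr_induction
      (p := fun w₂ => (I (w₁ ⊗ₜ w₂) m : W₃) ∈ 𝒲₃.gr (β + γ)) hw₂ (fun n₂ w₂ h₂ hw₂ => ?_)
      fun w w' e e' => by rw [TensorProduct.tmul_add, map_add]; exact add_mem e e'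
    rw [h n₁ n₂ w₁ w₂ h₁ h₂]
    exact hJ.mem_gr β γ w₁ w₂ hw₁ hw₂ _
  lower_truncation := h.lowerTruncated hJ.lower_truncation
  jacobi v w₁ w₂ l m r := by
    refine sub_eq_zero.mp ?_
    -- The two sums on the right are exchanged to match the order in `jacobiDefect`.
    rw [← sub_sub, sub_right_comm]
    refine (isTriadditive_jacobiDefect (h.lowerTruncated hJ.lower_truncation) l m
      r).eq_zero 𝒱.grading 𝒲₁.grading 𝒲₂.grading (fun k n₁ n₂ v hv w₁ h₁ w₂ h₂ => ?_) v w₁ w₂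
    refine Subtype.ext ?_
    -- The degree is obtained by solving r = a + k - l - m - 1 + n₁ + n₂ for a.
    rw [h.jacobiDefect_eq (h.lowerTruncated hJ.lower_truncation) l m r
      (r - k + l + m + 1 - n₁ - n₂) hv h₁ h₂ (by ring), coeffJacobiDefect, hJ.jacobi, sub_self]
    rfl
  bracket_neg w₁ w₂ := by
    induction w₁, w₂ using bilinear_induction 𝒲₁.toGenModule 𝒲₂.toGenModule with
    | hom n₁ n₂ w₁ h₁ w₂ h₂ =>
      funext r
      exact (h.bracket_neg_iff (a := r - n₁ - n₂ - 1) h₁ h₂ (by ring)).mpr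
        (hJ.bracket_neg w₁ w₂ _)
    | left x x' y e e' =>
      simp only [TensorProduct.add_tmul, map_add, 𝒲₃.finiteShift_Lneg.extend_add, e, e']
      abel
    | right x y y' e e' =>
      simp only [TensorProduct.tmul_add, map_add, 𝒲₃.finiteShift_Lneg.extend_add, e, e']
      abel
  bracket_zero w₁ w₂ := by
    induction w₁, w₂ using bilinear_induction 𝒲₁.toGenModule 𝒲₂.toGenModule with
    | hom n₁ n₂ w₁ h₁ w₂ h₂ =>
      funext r
      exact (h.bracket_zero_iff (a := r - n₁ - n₂) h₁ h₂ (by ring) z).mpr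
        (hJ.bracket_zero w₁ w₂ _)
    | left x x' y e e' =>
      simp only [TensorProduct.add_tmul, map_add, 𝒲₃.finiteShift_Lzero.extend_add, e, e', smul_add]
      abel
    | right x y y' e e' =>
      simp only [TensorProduct.tmul_add, map_add, 𝒲₃.finiteShift_Lzero.extend_add, e, e', smul_add]
      abel
  bracket_pos w₁ w₂ := by
    induction w₁, w₂ using bilinear_induction 𝒲₁.toGenModule 𝒲₂.toGenModule with
    | hom n₁ n₂ w₁ h₁ w₂ h₂ =>
      funext r
      exact (h.bracket_pos_iff (a := r - n₁ - n₂ + 1) h₁ h₂ (by ring) z).mpr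
        (hJ.bracket_pos w₁ w₂ _)
    | left x x' y e e' =>
      simp only [TensorProduct.add_tmul, map_add, 𝒲₃.finiteShift_Lpos.extend_add, e, e', smul_add]
      abel
    | right x y y' e e' =>
      simp only [TensorProduct.tmul_add, map_add, 𝒲₃.finiteShift_Lpos.extend_add, e, e', smul_add]
      abel

end Equivalence

/-! ### Coefficients of logarithmic intertwining operators. -/

section LogCoefficients

variable {V W₁ W₂ W₃ : Type*} [AddCommGroup V] [Module ℂ V] [AddCommGroup W₁] [Module ℂ W₁]
  [AddCommGroup W₂] [Module ℂ W₂] [AddCommGroup W₃] [Module ℂ W₃]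

/-- The coefficient of `x^a (log x)^k`. -/
def logCoeff (𝒴 : W₁ ⊗[ℂ] W₂ →ₗ[ℂ] (ℂ → ℕ →₀ W₃)) (k : ℕ) (a : ℂ) : W₁ ⊗[ℂ] W₂ →ₗ[ℂ] W₃ :=
  Finsupp.lapply k ∘ₗ LinearMap.proj a ∘ₗ 𝒴

theorem logCoeff_apply (𝒴 : W₁ ⊗[ℂ] W₂ →ₗ[ℂ] (ℂ → ℕ →₀ W₃)) (k : ℕ) (a : ℂ)
    (t : W₁ ⊗[ℂ] W₂) : logCoeff 𝒴 k a t = 𝒴 t a k := rfl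

theorem logCoeff_tmul (𝒴 : W₁ ⊗[ℂ] W₂ →ₗ[ℂ] (ℂ → ℕ →₀ W₃)) (k : ℕ) (a : ℂ) (w₁ : W₁)
    (w₂ : W₂) : logCoeff 𝒴 k a (w₁ ⊗ₜ w₂) = logMode 𝒴 (-a - 1) k w₁ w₂ := by
  rw [logMode, logCoeff_apply, show -(-a - 1) - 1 = a by ring]

theorem logMode_eq_logCoeff (𝒴 : W₁ ⊗[ℂ] W₂ →ₗ[ℂ] (ℂ → ℕ →₀ W₃)) (k : ℕ) {a n : ℂ}
    (h : a = -n - 1) (w₁ : W₁) (w₂ : W₂) :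
    logMode 𝒴 n k w₁ w₂ = logCoeff 𝒴 k a (w₁ ⊗ₜ w₂) := by
  rw [logMode, logCoeff_apply, h]

section Degrees

variable {𝒱 : MCVertexAlgebra V} {𝒲₁ : GenModule 𝒱 W₁} {𝒲₂ : GenModule 𝒱 W₂}
  {𝒲₃ : GenModule 𝒱 W₃}

/-- For `f` of degree `a`, the commutator with `L(0)` is multiplication by `a` plus the commutator
with the nilpotent part. -/
theorem Lzero_apply_of_degree {f : W₁ ⊗[ℂ] W₂ →ₗ[ℂ] W₃} {a : ℂ}
    (hf : ∀ n₁ n₂, ∀ w₁ ∈ 𝒲₁.wt n₁, ∀ w₂ ∈ 𝒲₂.wt n₂, f (w₁ ⊗ₜ w₂) ∈ 𝒲₃.wt (n₁ + n₂ + a))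
    (w₁ : W₁) (w₂ : W₂) :
    𝒲₃.Lzero (f (w₁ ⊗ₜ w₂)) = f (w₁ ⊗ₜ 𝒲₂.Lzero w₂) + f (𝒲₁.Lzero w₁ ⊗ₜ w₂)
      + a • f (w₁ ⊗ₜ w₂) + adNil 𝒲₁ 𝒲₂ 𝒲₃ f (w₁ ⊗ₜ w₂) := by
  induction w₁, w₂ using bilinear_induction 𝒲₁ 𝒲₂ with
  | hom n₁ n₂ w₁ h₁ w₂ h₂ =>
    rw [GenModule.Lzero_apply (hf n₁ n₂ w₁ h₁ w₂ h₂), GenModule.Lzero_apply h₁,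
      GenModule.Lzero_apply h₂, adNil, adOp_apply, tensorOp_tmul]
    simp only [TensorProduct.add_tmul, TensorProduct.tmul_add, ← TensorProduct.smul_tmul',
      TensorProduct.tmul_smul, map_add, map_smul]
    module
  | left x x' y e e' =>
    simp only [TensorProduct.add_tmul, map_add, e, e']
    module
  | right x y y' e e' =>
    simp only [TensorProduct.tmul_add, map_add, e, e']
    module

variable {𝒴 : W₁ ⊗[ℂ] W₂ →ₗ[ℂ] (ℂ → ℕ →₀ W₃)}

/-- By the derivative property, the term x 𝒴(L(-1)w₁, x) of the L(0)-bracket is x d/dx of the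
series. Its coefficient at x^a (log x)^k gives the last two terms. -/
theorem IsLogIntertwining.Lzero_logCoeff (h : IsLogIntertwining 𝒲₁ 𝒲₂ 𝒲₃ 𝒴) (k : ℕ) (a : ℂ)
    (w₁ : W₁) (w₂ : W₂) :
    𝒲₃.Lzero (logCoeff 𝒴 k a (w₁ ⊗ₜ w₂)) = logCoeff 𝒴 k a (w₁ ⊗ₜ 𝒲₂.Lzero w₂)
      + logCoeff 𝒴 k a (𝒲₁.Lzero w₁ ⊗ₜ w₂) + a • logCoeff 𝒴 k a (w₁ ⊗ₜ w₂)
      + ((k : ℂ) + 1) • logCoeff 𝒴 (k + 1) a (w₁ ⊗ₜ w₂) := by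
  simp only [logCoeff_tmul]
  have e := h.bracket_zero w₁ w₂ (-a - 1) k
  rw [h.derivative, sub_eq_iff_eq_add, add_sub_cancel_right] at e
  rw [e]
  module

/-- One further power of L(0) - n suffices. This is the step by which the induction for degrees
climbs. -/
theorem GenModule.mem_wt_of_sub_mem {W : Type*} [AddCommGroup W] [Module ℂ W]
    {𝒲 : GenModule 𝒱 W} {n : ℂ} {w : W} (h : 𝒲.Lzero w - n • w ∈ 𝒲.wt n) : w ∈ 𝒲.wt n := by
  obtain ⟨k, hk⟩ := (Module.End.mem_maxGenEigenspace _ _ _).mp h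
  refine (Module.End.mem_maxGenEigenspace _ _ _).mpr ⟨k + 1, ?_⟩
  rw [pow_succ, Module.End.mul_apply]
  exact hk

/-- The coefficient of `x^a (log x)^k` raises weights by `a`. -/
theorem IsLogIntertwining.hasDegrees (h : IsLogIntertwining 𝒲₁ 𝒲₂ 𝒲₃ 𝒴) (k : ℕ) :
    HasDegrees 𝒲₁ 𝒲₂ 𝒲₃ (logCoeff 𝒴 k) := by
  intro a n₁ n₂ w₁ w₂ h₁ h₂
  -- The outer induction is on a bound d for the sum of the nilpotency orders of w₁ and w₂: applying
  -- the nilpotent part to either vector lowers it. For d = 0 the order of w₁ is 0, that is, w₁ = 0.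
  have main : ∀ (d i j : ℕ) (w₁ : W₁) (w₂ : W₂), w₁ ∈ 𝒲₁.wt n₁ → w₂ ∈ 𝒲₂.wt n₂ →
      (𝒲₁.nil ^ i) w₁ = 0 → (𝒲₂.nil ^ j) w₂ = 0 → i + j ≤ d →
      ∀ k, logCoeff 𝒴 k a (w₁ ⊗ₜ w₂) ∈ 𝒲₃.wt (n₁ + n₂ + a) := by
    intro d
    induction d with
    | zero =>
      intro i j w₁ w₂ _ _ hi _ hd k
      obtain rfl : i = 0 := by omega
      obtain rfl : w₁ = 0 := hi
      rw [TensorProduct.zero_tmul, map_zero]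
      exact zero_mem _
    | succ d ih =>
      intro i j w₁ w₂ h₁ h₂ hi hj hd
      have left : ∀ k, logCoeff 𝒴 k a (𝒲₁.nil w₁ ⊗ₜ w₂) ∈ 𝒲₃.wt (n₁ + n₂ + a) := by
        intro k
        cases i with
        | zero =>
          obtain rfl : w₁ = 0 := hi
          rw [map_zero, TensorProduct.zero_tmul, map_zero]
          exact zero_mem _
        | succ i =>
          refine ih i j _ _ (GenModule.nil_mem_wt h₁) h₂ ?_ hj (by omega) k
          rwa [← Module.End.mul_apply, ← pow_succ]
      have right : ∀ k, logCoeff 𝒴 k a (w₁ ⊗ₜ 𝒲₂.nil w₂) ∈ 𝒲₃.wt (n₁ + n₂ + a) := by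
        intro k
        cases j with
        | zero =>
          obtain rfl : w₂ = 0 := hj
          rw [map_zero, TensorProduct.tmul_zero, map_zero]
          exact zero_mem _
        | succ j =>
          refine ih i j _ _ h₁ (GenModule.nil_mem_wt h₂) hi ?_ (by omega) k
          rwa [← Module.End.mul_apply, ← pow_succ]
      -- Finiteness of the powers of log x starts the inner induction, which descends in k: L(0) -
      -- (n₁ + n₂ + a) sends the coefficient at k to terms with smaller d and to the coefficient at
      -- k + 1.
      obtain ⟨K, hK⟩ : ∃ K, ∀ k ≥ K, 𝒴 (w₁ ⊗ₜ w₂) a k = 0 := by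
        refine ⟨(𝒴 (w₁ ⊗ₜ w₂) a).support.sup id + 1, fun k hk => ?_⟩
        by_contra hne
        have := Finset.le_sup (f := id) (Finsupp.mem_support_iff.mpr hne)
        simp only [id_eq] at this
        omega
      have desc : ∀ m k, K ≤ k + m → logCoeff 𝒴 k a (w₁ ⊗ₜ w₂) ∈ 𝒲₃.wt (n₁ + n₂ + a) := by
        intro m
        induction m with
        | zero =>
          intro k hk
          rw [logCoeff_apply, hK k (by omega)]
          exact zero_mem _
        | succ m ihm =>
          intro k hk
          refine GenModule.mem_wt_of_sub_mem ?_
          have e : 𝒲₃.Lzero (logCoeff 𝒴 k a (w₁ ⊗ₜ w₂))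
              - (n₁ + n₂ + a) • logCoeff 𝒴 k a (w₁ ⊗ₜ w₂)
              = logCoeff 𝒴 k a (𝒲₁.nil w₁ ⊗ₜ w₂) + logCoeff 𝒴 k a (w₁ ⊗ₜ 𝒲₂.nil w₂)
                + ((k : ℂ) + 1) • logCoeff 𝒴 (k + 1) a (w₁ ⊗ₜ w₂) := by
            rw [h.Lzero_logCoeff, GenModule.Lzero_apply h₁, GenModule.Lzero_apply h₂]
            simp only [TensorProduct.add_tmul, TensorProduct.tmul_add, ← TensorProduct.smul_tmul',
              TensorProduct.tmul_smul, map_add, map_smul]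
            module
          rw [e]
          exact add_mem (add_mem (left k) (right k))
            (Submodule.smul_mem _ _ (ihm (k + 1) (by omega)))
      exact fun k => desc K k (by omega)
  obtain ⟨i, hi⟩ := 𝒲₁.isLocNilpotent_nil w₁
  obtain ⟨j, hj⟩ := 𝒲₂.isLocNilpotent_nil w₂
  exact main (i + j) i j w₁ w₂ h₁ h₂ (hi i le_rfl) (hj j le_rfl) le_rfl k

/-- All coefficients are determined by those of `(log x)^0`. -/
theorem IsLogIntertwining.logCoeff_eq (h : IsLogIntertwining 𝒲₁ 𝒲₂ 𝒲₃ 𝒴) (k : ℕ) (a : ℂ) :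
    logCoeff 𝒴 k a = divPow (adNil 𝒲₁ 𝒲₂ 𝒲₃) k (logCoeff 𝒴 0 a) := by
  induction k with
  | zero => simp
  | succ k ih =>
    rw [adNil, divPow_adOp_succ, ← adNil, ← ih,
      eq_inv_smul_iff₀ (Nat.cast_add_one_ne_zero (R := ℂ) k)]
    refine TensorProduct.ext' fun w₁ w₂ => ?_
    -- The same commutator with L(0) is computed twice, from the axioms and from the degree;
    -- comparing the two leaves (k+1) times the next coefficient against `adNil` of the present one.
    have e := h.Lzero_logCoeff k a w₁ w₂
    rw [Lzero_apply_of_degree (fun n₁ n₂ w₁ h₁ w₂ h₂ => h.hasDegrees k a n₁ n₂ w₁ w₂ h₁ h₂)] at e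
    exact (add_left_cancel e).symm

/-- The formal series with `(log x)^0`-coefficients `c`. -/
def logOfCoeff (𝒲₁ : GenModule 𝒱 W₁) (𝒲₂ : GenModule 𝒱 W₂) (𝒲₃ : GenModule 𝒱 W₃)
    (c : ℂ → W₁ ⊗[ℂ] W₂ →ₗ[ℂ] W₃) : W₁ ⊗[ℂ] W₂ →ₗ[ℂ] (ℂ → ℕ →₀ W₃) where
  toFun t a := Finsupp.ofSupportFinite (fun k => divPow (adNil 𝒲₁ 𝒲₂ 𝒲₃) k (c a) t)
    (finite_support_divPow_adNil 𝒲₁ 𝒲₂ 𝒲₃ (c a) t)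
  map_add' t t' := by
    funext a
    ext k
    exact (divPow (adNil 𝒲₁ 𝒲₂ 𝒲₃) k (c a)).map_add t t'
  map_smul' s t := by
    funext a
    ext k
    exact (divPow (adNil 𝒲₁ 𝒲₂ 𝒲₃) k (c a)).map_smul s t

theorem logCoeff_logOfCoeff (c : ℂ → W₁ ⊗[ℂ] W₂ →ₗ[ℂ] W₃) (k : ℕ) (a : ℂ) :
    logCoeff (logOfCoeff 𝒲₁ 𝒲₂ 𝒲₃ c) k a = divPow (adNil 𝒲₁ 𝒲₂ 𝒲₃) k (c a) := rfl

theorem logCoeff_ext {𝒴 𝒴' : W₁ ⊗[ℂ] W₂ →ₗ[ℂ] (ℂ → ℕ →₀ W₃)}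
    (h : ∀ k a, logCoeff 𝒴 k a = logCoeff 𝒴' k a) : 𝒴 = 𝒴' := by
  refine LinearMap.ext fun t => funext fun a => Finsupp.ext fun k => ?_
  exact LinearMap.congr_fun (h k a) t

end Degrees

variable {Atilde : Type*} [AddCommGroup Atilde] {A : AddSubgroup Atilde}
  {𝒱 : StronglyGradedVertexAlgebra A V} {𝒲₁ : StronglyGradedGenModule 𝒱 W₁}
  {𝒲₂ : StronglyGradedGenModule 𝒱 W₂} {𝒲₃ : StronglyGradedGenModule 𝒱 W₃}

/-- The `(log x)^0`-coefficients of a logarithmic intertwining operator form a coefficient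
family. -/
theorem isCoeffFamily_logCoeff {𝒴 : W₁ ⊗[ℂ] W₂ →ₗ[ℂ] (ℂ → ℕ →₀ W₃)}
    (h : 𝒴 ∈ LogIntertwiningSpace 𝒲₁ 𝒲₂ 𝒲₃) : IsCoeffFamily 1 𝒲₁ 𝒲₂ 𝒲₃ (logCoeff 𝒴 0) where
  degree := h.1.hasDegrees 0
  mem_gr β γ w₁ w₂ h₁ h₂ a := by
    rw [logCoeff_tmul]
    exact h.2 β γ w₁ w₂ h₁ h₂ _ _
  lower_truncation w₁ w₂ a := by
    obtain ⟨M, hM⟩ := h.1.lower_truncation w₁ w₂ (-a - 1)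
    refine ⟨M, fun m hm => ?_⟩
    rw [← logMode_eq_logCoeff (n := -a - 1 + m) _ _ (by ring)]
    exact hM m hm 0
  jacobi v w₁ w₂ l m a := by
    have e := h.1.jacobi v w₁ w₂ l m (-a - 1) 0
    convert e using 3
    · funext i
      rw [logMode_eq_logCoeff (a := a - i) _ _ (by ring), mul_comm]
    · funext i
      rw [logMode_eq_logCoeff (a := a - l + i) _ _ (by ring), one_zpow, mul_one]
    · rename_i i
      rw [logMode_eq_logCoeff (a := a - m + i) _ _ (by ring), one_zpow, mul_one]
  bracket_neg w₁ w₂ a := by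
    simp only [logCoeff_tmul]
    rw [← h.1.bracket_neg]
    abel
  bracket_zero w₁ w₂ a := by
    have e := h.1.bracket_zero w₁ w₂ (-a - 1) 0
    rw [logMode_eq_logCoeff (a := a - 1) (n := -a - 1 + 1) _ _ (by ring)] at e
    simp only [logCoeff_tmul _ _ a, one_smul]
    rw [← e]
    abel
  bracket_pos w₁ w₂ a := by
    have e := h.1.bracket_pos w₁ w₂ (-a - 1) 0
    rw [logMode_eq_logCoeff (a := a - 1) (n := -a - 1 + 1) _ _ (by ring),
      logMode_eq_logCoeff (a := a - 2) (n := -a - 1 + 2) _ _ (by ring)] at e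
    simp only [logCoeff_tmul _ _ a, one_pow, one_smul, mul_one]
    rw [← e]
    abel

/-- All axioms but two concern a single power of log x and follow from `divPow_adNil`. Lower
truncation must be uniform in k, and the derivative property links k with k + 1. -/
theorem IsCoeffFamily.logOfCoeff_mem {c : ℂ → W₁ ⊗[ℂ] W₂ →ₗ[ℂ] W₃}
    (h : IsCoeffFamily 1 𝒲₁ 𝒲₂ 𝒲₃ c) :
    logOfCoeff 𝒲₁.toGenModule 𝒲₂.toGenModule 𝒲₃.toGenModule c
      ∈ LogIntertwiningSpace 𝒲₁ 𝒲₂ 𝒲₃ := by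
  have e : ∀ (n : ℂ) (k : ℕ) (a : ℂ) (w₁ : W₁) (w₂ : W₂), a = -n - 1 →
      logMode (logOfCoeff 𝒲₁.toGenModule 𝒲₂.toGenModule 𝒲₃.toGenModule c) n k w₁ w₂
        = divPow (_root_.adNil 𝒲₁.toGenModule 𝒲₂.toGenModule 𝒲₃.toGenModule) k (c a)
          (w₁ ⊗ₜ w₂) := by
    intro n k a w₁ w₂ ha
    rw [logMode_eq_logCoeff _ _ ha, logCoeff_logOfCoeff]
  refine ⟨⟨?_, ?_, ?_, ?_, ?_, ?_⟩, ?_⟩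
  · intro w₁ w₂ n
    obtain ⟨M, hM⟩ := h.lower_truncation_uniform (w₁ ⊗ₜ w₂) (-n - 1)
    refine ⟨M, fun m hm k => ?_⟩
    rw [e (n + m) k (-n - 1 - m) w₁ w₂ (by ring)]
    exact hM m hm k
  · intro v w₁ w₂ l m n k
    have j := (h.divPow_adNil k).jacobi v w₁ w₂ l m (-n - 1)
    convert j using 3
    · funext i
      rw [e _ k (-n - 1 - i) _ _ (by ring), mul_comm]
    · funext i
      rw [e _ k (-n - 1 - l + i) _ _ (by ring), one_zpow, mul_one]
    · rename_i i
      rw [e _ k (-n - 1 - m + i) _ _ (by ring), one_zpow, mul_one]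
  · intro w₁ w₂ n k
    have hk := h.divPow_adNil k
    -- The comparison behind `logCoeff_eq` is read backwards: now the recursion in k is known by
    -- construction, and the L(-1)-term of the bracket is solved for. Degree -n is used because the
    -- L(-1)-term sits one degree lower, at -n - 1, the exponent belonging to the index n.
    have b := hk.bracket_zero w₁ w₂ (-n)
    rw [Lzero_apply_of_degree fun n₁ n₂ w₁ h₁ w₂ h₂ => hk.degree (-n) n₁ n₂ w₁ w₂ h₁ h₂,
      one_smul, ← Module.End.mul_apply, mul_divPow] at b
    rw [e n k (-n - 1) _ _ rfl, e (n - 1) k (-n) _ _ (by ring), e (n - 1) (k + 1) (-n) _ _ (by ring)]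
    rw [add_assoc, add_assoc] at b
    exact (add_left_cancel (add_left_cancel b)).symm
  · intro w₁ w₂ n k
    simp only [e n k _ _ _ rfl]
    rw [(h.divPow_adNil k).bracket_neg]
    abel
  · intro w₁ w₂ n k
    simp only [e n k _ _ _ rfl, e (n + 1) k (-n - 1 - 1) _ _ (by ring)]
    rw [(h.divPow_adNil k).bracket_zero, one_smul]
    abel
  · intro w₁ w₂ n k
    simp only [e n k _ _ _ rfl, e (n + 1) k (-n - 1 - 1) _ _ (by ring),
      e (n + 2) k (-n - 1 - 2) _ _ (by ring)]
    rw [(h.divPow_adNil k).bracket_pos, one_pow, one_smul, mul_one]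
    abel
  · intro β γ w₁ w₂ h₁ h₂ n k
    rw [e n k _ _ _ rfl]
    exact (h.divPow_adNil k).mem_gr β γ w₁ w₂ h₁ h₂ _

end LogCoefficients

/-! ### Substitution of e^ζ for x, and powers of L(0) on homogeneous vectors. -/

section Substitution

/-- No finiteness is assumed: both sides have the same support up to the injection b ↦ (a₀, b), so
their default values agree as well. -/
theorem finsum_prod_eq_of_fiber {α β M : Type*} [AddCommMonoid M] (f : α × β → M) (a₀ : α)
    (h : ∀ a b, a ≠ a₀ → f (a, b) = 0) : ∑ᶠ q, f q = ∑ᶠ b, f (a₀, b) := by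
  rw [← finsum_mem_univ f, ← finsum_mem_range (g := fun b => (a₀, b)) (f := f)
    (fun b b' hb => (Prod.mk.inj hb).2)]
  refine finsum_mem_inter_support_eq' _ _ _ fun q hq => ⟨fun _ => ?_, fun _ => trivial⟩
  obtain ⟨a, b⟩ := q
  by_cases ha : a = a₀
  · exact ⟨b, by rw [ha]⟩
  · exact absurd (h a b ha) hq

variable {V W : Type*} [AddCommGroup V] [Module ℂ V] [AddCommGroup W] [Module ℂ W]
  {𝒱 : MCVertexAlgebra V} {𝒲 : GenModule 𝒱 W}

theorem GenModule.SubstExists.add {f g : ℂ → ℕ →₀ W} (hf : 𝒲.SubstExists f)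
    (hg : 𝒲.SubstExists g) : 𝒲.SubstExists (f + g) := by
  intro m
  refine ((hf m).union (hg m)).subset fun q hq => ?_
  by_contra hn
  rw [Set.mem_union, not_or, Function.notMem_support, Function.notMem_support] at hn
  refine hq ?_
  change 𝒲.π m (f q.1 q.2 + g q.1 q.2) = 0
  rw [map_add, hn.1, hn.2, add_zero]

theorem GenModule.SubstExists.subst_add {f g : ℂ → ℕ →₀ W} (hf : 𝒲.SubstExists f)
    (hg : 𝒲.SubstExists g) (ζ : ℂ) : 𝒲.subst ζ (f + g) = 𝒲.subst ζ f + 𝒲.subst ζ g := by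
  have fin : ∀ {f : ℂ → ℕ →₀ W}, 𝒲.SubstExists f → ∀ m, (Function.support fun q : ℂ × ℕ =>
      (Complex.exp (ζ * q.1) * ζ ^ q.2) • 𝒲.π m (f q.1 q.2)).Finite := fun hf m =>
    (hf m).subset fun q hq h0 => hq (by
      change _ • 𝒲.π m _ = 0
      rw [show 𝒲.π m _ = 0 from h0, smul_zero])
  funext m
  simp only [GenModule.subst, Pi.add_apply, Finsupp.add_apply, map_add, smul_add]
  exact finsum_add_distrib (fin hf m) (fin hg m)

/-- Substitution in a series that is homogeneous of weight `n`. -/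
theorem GenModule.substExists_of_mem_wt {f : ℂ → ℕ →₀ W} {n : ℂ}
    (hf : ∀ a k, f a k ∈ 𝒲.wt (n + a)) : 𝒲.SubstExists f := by
  intro m
  refine ((f (m - n)).support.finite_toSet.image fun k => (m - n, k)).subset ?_
  rintro ⟨a, k⟩ hq
  have ha : a = m - n := by
    by_contra hne
    refine hq (𝒲.grading.proj_apply_of_ne (fun h => hne ?_) (hf a k))
    rw [← h, add_sub_cancel_left]
  subst ha
  refine ⟨k, Finsupp.mem_support_iff.mpr fun h0 => hq ?_, rfl⟩
  change 𝒲.π m (f (m - n) k) = 0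
  rw [h0, map_zero]

/-- In weight m only the exponent a = m - n contributes, leaving a sum over powers of ζ alone. -/
theorem GenModule.subst_of_mem_wt {f : ℂ → ℕ →₀ W} {n : ℂ}
    (hf : ∀ a k, f a k ∈ 𝒲.wt (n + a)) (ζ m : ℂ) :
    (𝒲.subst ζ f m : W) = Complex.exp (ζ * (m - n)) • ∑ᶠ k : ℕ, ζ ^ k • f (m - n) k := by
  have hfin : (Function.support fun k : ℕ =>
      (Complex.exp (ζ * (m - n)) * ζ ^ k) • 𝒲.π m (f (m - n) k)).Finite := by
    refine (f (m - n)).support.finite_toSet.subset fun k hk => Finsupp.mem_support_iff.mpr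
      fun h0 => hk ?_
    change _ • 𝒲.π m (f (m - n) k) = 0
    rw [h0, map_zero, smul_zero]
  rw [GenModule.subst, finsum_prod_eq_of_fiber _ (m - n)]
  · change (𝒲.wt m).subtype _ = _
    rw [map_finsum _ hfin, smul_finsum]
    refine finsum_congr fun k => ?_
    have h := hf (m - n) k
    rw [add_sub_cancel] at h
    rw [map_smul, smul_smul]
    congr 1
    exact 𝒲.grading.proj_apply_of_mem h
  · intro a k ha
    change _ • 𝒲.π m (f a k) = 0
    rw [GenModule.π, 𝒲.grading.proj_apply_of_ne (fun h => ha ?_) (hf a k), smul_zero]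
    rw [← h, add_sub_cancel_left]

theorem GenModule.π_apply_of_mem {n m : ℂ} {w : W} (hw : w ∈ 𝒲.wt n) (hm : m = n) :
    (𝒲.π m w : W) = w := by
  rw [hm]
  exact 𝒲.grading.proj_apply_of_mem hw

/-- On weight n the operator L(0) - n is the nilpotent part, which no longer mentions n. -/
theorem GenModule.xPow_eq (ε : ℤˣ) (w : 𝒲.Completion) {a n : ℂ} (hn : ((ε : ℤ) : ℂ) * a = n)
    (i : ℕ) : 𝒲.xPow ε w a i = divPow (((ε : ℤ) : ℂ) • 𝒲.nil) i (w n) := by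
  subst hn
  rw [GenModule.xPow, divPow, smul_pow, ← (GenModule.nil_pow_apply (w _).2 i).2,
    LinearMap.smul_apply, LinearMap.smul_apply, smul_smul, div_eq_inv_mul]

theorem GenModule.locExp_nil_mem_wt {n : ℂ} {w : W} (hw : w ∈ 𝒲.wt n) (c : ℂ) :
    locExp (c • 𝒲.nil) w ∈ 𝒲.wt n := by
  rw [𝒲.isLocNilpotent_nil.locExp_smul_apply]
  exact finsum_induction (· ∈ 𝒲.wt n) (zero_mem _) (fun _ _ => add_mem)
    fun k => Submodule.smul_mem _ _ (GenModule.divPow_nil_mem_wt hw k)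

theorem units_int_mul_self (ε : ℤˣ) : ((ε : ℤ) : ℂ) * ((ε : ℤ) : ℂ) = 1 := by
  rw [← Int.cast_mul, ← Units.val_mul, Int.units_mul_self, Units.val_one, Int.cast_one]

/-- Only the exponent εn contributes, since ε² = 1; the remaining sum is the exponential series of
the nilpotent part. -/
theorem GenModule.yPow_eq (ε : ℤˣ) (ζ : ℂ) {n : ℂ} {w : W} (hw : w ∈ 𝒲.wt n) :
    𝒲.yPow ε ζ w = Complex.exp (ζ * (((ε : ℤ) : ℂ) * n)) •
      locExp ((ζ * ((ε : ℤ) : ℂ)) • 𝒲.nil) w := by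
  have hn : ((ε : ℤ) : ℂ) * (((ε : ℤ) : ℂ) * n) = n := by
    rw [← mul_assoc, units_int_mul_self, one_mul]
  rw [GenModule.yPow, finsum_prod_eq_of_fiber _ (((ε : ℤ) : ℂ) * n),
    𝒲.isLocNilpotent_nil.locExp_smul_apply, smul_finsum]
  · refine finsum_congr fun k => ?_
    rw [GenModule.xPow_eq _ _ hn, GenModule.toCompletion, GenModule.π,
      𝒲.grading.proj_apply_of_mem hw, divPow_smul, LinearMap.smul_apply, smul_smul, smul_smul,
      mul_pow, mul_assoc]
  · intro a k ha
    rw [GenModule.xPow_eq _ _ rfl, GenModule.toCompletion, GenModule.π, 𝒲.grading.proj_apply_of_ne _ hw,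
      ZeroMemClass.coe_zero, map_zero, smul_zero]
    intro h
    refine ha ?_
    rw [h, ← mul_assoc, units_int_mul_self, one_mul]

end Substitution

/-! ### The two correspondences and the equivalence. -/

section Correspondence

variable {V W₁ W₂ W₃ : Type*} [AddCommGroup V] [Module ℂ V] [AddCommGroup W₁] [Module ℂ W₁]
  [AddCommGroup W₂] [Module ℂ W₂] [AddCommGroup W₃] [Module ℂ W₃]

section Conjugate

variable {𝒱 : MCVertexAlgebra V} {𝒲₁ : GenModule 𝒱 W₁} {𝒲₂ : GenModule 𝒱 W₂}
  {𝒲₃ : GenModule 𝒱 W₃}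

/-- A linear map on the tensor product is the sum of its values on homogeneous components. -/
theorem finsum_proj_tmul {P : Type*} [AddCommGroup P] [Module ℂ P] (F : W₁ ⊗[ℂ] W₂ →ₗ[ℂ] P)
    (w₁ : W₁) (w₂ : W₂) :
    ∑ᶠ b : ℂ × ℂ, F ((𝒲₁.π (-b.1) w₁ : W₁) ⊗ₜ (𝒲₂.π (-b.2) w₂ : W₂)) = F (w₁ ⊗ₜ w₂) := by
  have fin : ∀ (w₁ : W₁) (w₂ : W₂), (Function.support fun b : ℂ × ℂ =>
      F ((𝒲₁.π (-b.1) w₁ : W₁) ⊗ₜ (𝒲₂.π (-b.2) w₂ : W₂))).Finite := by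
    intro w₁ w₂
    refine (((𝒲₁.grading.finite_support_proj w₁).image Neg.neg).prod
      ((𝒲₂.grading.finite_support_proj w₂).image Neg.neg)).subset fun b hb => ?_
    refine ⟨⟨-b.1, fun h => hb ?_, neg_neg _⟩, ⟨-b.2, fun h => hb ?_, neg_neg _⟩⟩
    · change F ((𝒲₁.grading.proj (-b.1) w₁ : W₁) ⊗ₜ _) = 0
      rw [h, ZeroMemClass.coe_zero, TensorProduct.zero_tmul, map_zero]
    · change F (_ ⊗ₜ (𝒲₂.grading.proj (-b.2) w₂ : W₂)) = 0
      rw [h, ZeroMemClass.coe_zero, TensorProduct.tmul_zero, map_zero]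
  induction w₁, w₂ using bilinear_induction 𝒲₁ 𝒲₂ with
  | hom n₁ n₂ w₁ h₁ w₂ h₂ =>
    rw [finsum_eq_single _ (-n₁, -n₂)]
    · rw [GenModule.π_apply_of_mem h₁ (neg_neg n₁), GenModule.π_apply_of_mem h₂ (neg_neg n₂)]
    · rintro ⟨b₁, b₂⟩ hb
      by_cases hb₁ : n₁ = -b₁
      · have hb₂ : n₂ ≠ -b₂ := fun hb₂ => hb (by rw [hb₁, hb₂, neg_neg, neg_neg])
        rw [GenModule.π, GenModule.π, 𝒲₂.grading.proj_apply_of_ne hb₂ h₂, ZeroMemClass.coe_zero,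
          TensorProduct.tmul_zero, map_zero]
      · rw [GenModule.π, GenModule.π, 𝒲₁.grading.proj_apply_of_ne hb₁ h₁, ZeroMemClass.coe_zero,
          TensorProduct.zero_tmul, map_zero]
  | left x x' y e e' =>
    rw [TensorProduct.add_tmul, map_add, ← e, ← e', ← finsum_add_distrib (fin x y) (fin x' y)]
    simp only [map_add, Submodule.coe_add, TensorProduct.add_tmul]
  | right x y y' e e' =>
    rw [TensorProduct.tmul_add, map_add, ← e, ← e', ← finsum_add_distrib (fin x y) (fin x y')]
    simp only [map_add, Submodule.coe_add, TensorProduct.tmul_add]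

theorem divPow_adNil_tmul (k : ℕ) (f : W₁ ⊗[ℂ] W₂ →ₗ[ℂ] W₃) (w₁ : W₁) (w₂ : W₂) :
    divPow (adNil 𝒲₁ 𝒲₂ 𝒲₃) k f (w₁ ⊗ₜ w₂) = ∑ s ∈ Finset.HasAntidiagonal.antidiagonal k,
      ∑ t ∈ Finset.HasAntidiagonal.antidiagonal s.1, divPow 𝒲₃.nil s.2
        (f (divPow ((-1 : ℂ) • 𝒲₁.nil) t.1 w₁ ⊗ₜ divPow ((-1 : ℂ) • 𝒲₂.nil) t.2 w₂)) := by
  -- In `divPow_adOp` the exponent on W₃ comes first, in `conjugateCoeff` last.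
  rw [adNil, divPow_adOp, ← Finset.Nat.sum_antidiagonal_swap]
  refine Finset.sum_congr rfl fun s _ => ?_
  rw [Prod.fst_swap, Prod.snd_swap, ← neg_one_smul ℂ, ← tensorOp_smul, divPow_tensorOp_tmul,
    map_sum, map_sum]

/-- The coefficients of `y^L(0) x^L(0) I(y^(-L(0)) x^(-L(0)) w₁ ⊗ y^(-L(0)) x^(-L(0)) w₂)` in terms
of the components of `I`. -/
theorem conjugateCoeff_eq {I : W₁ ⊗[ℂ] W₂ →ₗ[ℂ] 𝒲₃.Completion}
    {J : ℂ → W₁ ⊗[ℂ] W₂ →ₗ[ℂ] W₃} (h : IsComponents 𝒲₁ 𝒲₂ 𝒲₃ I J) (ζ : ℂ) (w₁ : W₁) (w₂ : W₂)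
    (a : ℂ) (k : ℕ) :
    conjugateCoeff 𝒲₁ 𝒲₂ 𝒲₃ ζ I w₁ w₂ a k
      = divPow (adNil 𝒲₁ 𝒲₂ 𝒲₃) k (Complex.exp (ζ * a) • expConj 𝒲₁ 𝒲₂ 𝒲₃ ζ (J a))
        (w₁ ⊗ₜ w₂) := by
  -- The power x^b in x^(-L(0)) w comes from the component of w of weight -b, so both sides become
  -- sums over the same pairs of weights and are compared term by term.
  rw [← finsum_proj_tmul (𝒲₁ := 𝒲₁) (𝒲₂ := 𝒲₂), conjugateCoeff]
  refine finsum_congr fun b => ?_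
  rw [divPow_adNil_tmul]
  refine Finset.sum_congr rfl fun s _ => Finset.sum_congr rfl fun t _ => ?_
  set x : W₁ := (𝒲₁.π (-b.1) w₁ : W₁) with hx
  set y : W₂ := (𝒲₂.π (-b.2) w₂ : W₂) with hy
  have ex : 𝒲₁.xPow (-1) (𝒲₁.toCompletion w₁) b.1 t.1 = divPow ((-1 : ℂ) • 𝒲₁.nil) t.1 x := by
    rw [GenModule.xPow_eq (n := -b.1) _ _ (by simp), GenModule.toCompletion, hx]
    simp
  have ey : 𝒲₂.xPow (-1) (𝒲₂.toCompletion w₂) b.2 t.2 = divPow ((-1 : ℂ) • 𝒲₂.nil) t.2 y := by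
    rw [GenModule.xPow_eq (n := -b.2) _ _ (by simp), GenModule.toCompletion, hy]
    simp
  set x' := divPow ((-1 : ℂ) • 𝒲₁.nil) t.1 x with hx'
  set y' := divPow ((-1 : ℂ) • 𝒲₂.nil) t.2 y with hy'
  have mx : x' ∈ 𝒲₁.wt (-b.1) := by
    rw [hx', divPow_smul]
    exact Submodule.smul_mem _ _ (GenModule.divPow_nil_mem_wt (𝒲₁.π (-b.1) w₁).2 _)
  have my : y' ∈ 𝒲₂.wt (-b.2) := by
    rw [hy', divPow_smul]
    exact Submodule.smul_mem _ _ (GenModule.divPow_nil_mem_wt (𝒲₂.π (-b.2) w₂).2 _)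
  have mX : locExp ((-ζ) • 𝒲₁.nil) x' ∈ 𝒲₁.wt (-b.1) := GenModule.locExp_nil_mem_wt mx _
  have mY : locExp ((-ζ) • 𝒲₂.nil) y' ∈ 𝒲₂.wt (-b.2) := GenModule.locExp_nil_mem_wt my _
  have eX : 𝒲₁.yPow (-1) ζ x' = Complex.exp (ζ * b.1) • locExp ((-ζ) • 𝒲₁.nil) x' := by
    rw [GenModule.yPow_eq _ _ mx]
    simp
  have eY : 𝒲₂.yPow (-1) ζ y' = Complex.exp (ζ * b.2) • locExp ((-ζ) • 𝒲₂.nil) y' := by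
    rw [GenModule.yPow_eq _ _ my]
    simp
  have eI := h.apply_of_eq (m := a - b.1 - b.2) (a := a) mX mY (by ring)
  have mI : J a (locExp ((-ζ) • 𝒲₁.nil) x' ⊗ₜ locExp ((-ζ) • 𝒲₂.nil) y')
      ∈ 𝒲₃.wt (a - b.1 - b.2) := by
    rw [← eI]
    exact (I _ _).2
  have eT : 𝒲₃.xPow 1 (I (𝒲₁.yPow (-1) ζ x' ⊗ₜ 𝒲₂.yPow (-1) ζ y')) (a - b.1 - b.2) s.2
      = (Complex.exp (ζ * b.1) * Complex.exp (ζ * b.2)) • divPow 𝒲₃.nil s.2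
        (J a (locExp ((-ζ) • 𝒲₁.nil) x' ⊗ₜ locExp ((-ζ) • 𝒲₂.nil) y')) := by
    rw [GenModule.xPow_eq (n := a - b.1 - b.2) _ _ (by simp), eX, eY,
      TensorProduct.smul_tmul_smul, map_smul]
    simp only [Units.val_one, Int.cast_one, one_smul, Pi.smul_apply, Submodule.coe_smul,
      map_smul, eI]
  rw [ex, ey, eT, GenModule.yPow_eq 1 ζ (n := a - b.1 - b.2)
    (Submodule.smul_mem _ _ (GenModule.divPow_nil_mem_wt mI _))]
  simp only [Units.val_one, Int.cast_one, one_mul, mul_one, map_smul, smul_smul, expConj,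
    LinearMap.smul_apply, LinearMap.comp_apply, TensorProduct.map_tmul]
  -- The inner factors e^(ζb₁), e^(ζb₂) and the outer e^(ζ(a-b₁-b₂)) multiply to e^(ζa). The other
  -- goal interchanges the outer exponential with a divided power of the same nilpotent operator.
  rw [← Complex.exp_add, ← Complex.exp_add]
  congr 1
  · congr 1
    ring
  · exact locExp_intertwine (𝒲₃.isLocNilpotent_nil.smul ζ) (𝒲₃.isLocNilpotent_nil.smul ζ)
      (divPow 𝒲₃.nil s.2) (fun w => by
        rw [← Module.End.mul_apply, ← Module.End.mul_apply, divPow, smul_mul_smul_comm,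
          smul_mul_smul_comm, mul_comm, ← pow_succ, ← pow_succ']) _ |>.symm

end Conjugate

section ExpConj

variable {𝒱 : MCVertexAlgebra V} (𝒲₁ : GenModule 𝒱 W₁) (𝒲₂ : GenModule 𝒱 W₂)
  (𝒲₃ : GenModule 𝒱 W₃)

theorem expConj_add (ζ : ℂ) (f g : W₁ ⊗[ℂ] W₂ →ₗ[ℂ] W₃) :
    expConj 𝒲₁ 𝒲₂ 𝒲₃ ζ (f + g) = expConj 𝒲₁ 𝒲₂ 𝒲₃ ζ f + expConj 𝒲₁ 𝒲₂ 𝒲₃ ζ g := by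
  simp only [expConj, LinearMap.add_comp, LinearMap.comp_add]

theorem expConj_smul (ζ c : ℂ) (f : W₁ ⊗[ℂ] W₂ →ₗ[ℂ] W₃) :
    expConj 𝒲₁ 𝒲₂ 𝒲₃ ζ (c • f) = c • expConj 𝒲₁ 𝒲₂ 𝒲₃ ζ f := by
  simp only [expConj, LinearMap.smul_comp, LinearMap.comp_smul]

/-- Conjugation by `e^(ζ L(0))` in degree `a`. -/
def expAd (ζ : ℂ) (J : ℂ → W₁ ⊗[ℂ] W₂ →ₗ[ℂ] W₃) (a : ℂ) : W₁ ⊗[ℂ] W₂ →ₗ[ℂ] W₃ :=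
  Complex.exp (ζ * a) • expConj 𝒲₁ 𝒲₂ 𝒲₃ ζ (J a)

theorem expAd_add (ζ : ℂ) (J J' : ℂ → W₁ ⊗[ℂ] W₂ →ₗ[ℂ] W₃) :
    expAd 𝒲₁ 𝒲₂ 𝒲₃ ζ (J + J') = expAd 𝒲₁ 𝒲₂ 𝒲₃ ζ J + expAd 𝒲₁ 𝒲₂ 𝒲₃ ζ J' := by
  funext a
  simp only [expAd, Pi.add_apply, expConj_add, smul_add]

theorem expAd_smul (ζ c : ℂ) (J : ℂ → W₁ ⊗[ℂ] W₂ →ₗ[ℂ] W₃) :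
    expAd 𝒲₁ 𝒲₂ 𝒲₃ ζ (c • J) = c • expAd 𝒲₁ 𝒲₂ 𝒲₃ ζ J := by
  funext a
  simp only [expAd, Pi.smul_apply, expConj_smul, smul_comm c]

theorem expAd_expAd_neg (ζ : ℂ) (J : ℂ → W₁ ⊗[ℂ] W₂ →ₗ[ℂ] W₃) :
    expAd 𝒲₁ 𝒲₂ 𝒲₃ ζ (expAd 𝒲₁ 𝒲₂ 𝒲₃ (-ζ) J) = J := by
  funext a
  rw [expAd, expAd, expConj_smul, expConj_neg_expConj, smul_smul, ← Complex.exp_add, neg_mul,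
    add_neg_cancel, Complex.exp_zero, one_smul]

theorem expAd_neg_expAd (ζ : ℂ) (J : ℂ → W₁ ⊗[ℂ] W₂ →ₗ[ℂ] W₃) :
    expAd 𝒲₁ 𝒲₂ 𝒲₃ (-ζ) (expAd 𝒲₁ 𝒲₂ 𝒲₃ ζ J) = J := by
  have e := expAd_expAd_neg 𝒲₁ 𝒲₂ 𝒲₃ (-ζ) J
  rwa [neg_neg] at e

variable {𝒲₁ 𝒲₂ 𝒲₃} {𝒴 : W₁ ⊗[ℂ] W₂ →ₗ[ℂ] (ℂ → ℕ →₀ W₃)}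

/-- The substitution of `e^ζ` in a logarithmic intertwining operator. -/
theorem IsLogIntertwining.subst_eq (h : IsLogIntertwining 𝒲₁ 𝒲₂ 𝒲₃ 𝒴) {ζ : ℂ}
    {I : W₁ ⊗[ℂ] W₂ →ₗ[ℂ] 𝒲₃.Completion}
    (hI : IsComponents 𝒲₁ 𝒲₂ 𝒲₃ I (expAd 𝒲₁ 𝒲₂ 𝒲₃ ζ (logCoeff 𝒴 0))) (w₁ : W₁) (w₂ : W₂) :
    𝒲₃.SubstExists (𝒴 (w₁ ⊗ₜ w₂)) ∧ I (w₁ ⊗ₜ w₂) = 𝒲₃.subst ζ (𝒴 (w₁ ⊗ₜ w₂)) := by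
  -- Existence and value are proved together, because additivity of the substitution needs existence
  -- for both summands.
  induction w₁, w₂ using bilinear_induction 𝒲₁ 𝒲₂ with
  | hom n₁ n₂ w₁ h₁ w₂ h₂ =>
    have hf : ∀ a k, 𝒴 (w₁ ⊗ₜ w₂) a k ∈ 𝒲₃.wt (n₁ + n₂ + a) := fun a k =>
      h.hasDegrees k a n₁ n₂ w₁ w₂ h₁ h₂
    refine ⟨GenModule.substExists_of_mem_wt hf, funext fun m => Subtype.ext ?_⟩
    rw [GenModule.subst_of_mem_wt hf, hI n₁ n₂ w₁ w₂ h₁ h₂, sub_sub, expAd, LinearMap.smul_apply,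
      ← finsum_divPow_adNil]
    congr 1
    refine finsum_congr fun k => ?_
    rw [← h.logCoeff_eq]
    rfl
  | left x x' y e e' =>
    rw [TensorProduct.add_tmul, map_add, map_add, e.2, e'.2]
    exact ⟨e.1.add e'.1, (e.1.subst_add e'.1 ζ).symm⟩
  | right x y y' e e' =>
    rw [TensorProduct.tmul_add, map_add, map_add, e.2, e'.2]
    exact ⟨e.1.add e'.1, (e.1.subst_add e'.1 ζ).symm⟩

theorem IsComponents.add {I I' : W₁ ⊗[ℂ] W₂ →ₗ[ℂ] 𝒲₃.Completion}
    {J J' : ℂ → W₁ ⊗[ℂ] W₂ →ₗ[ℂ] W₃} (h : IsComponents 𝒲₁ 𝒲₂ 𝒲₃ I J)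
    (h' : IsComponents 𝒲₁ 𝒲₂ 𝒲₃ I' J') : IsComponents 𝒲₁ 𝒲₂ 𝒲₃ (I + I') (J + J') := by
  intro n₁ n₂ w₁ w₂ h₁ h₂ m
  rw [LinearMap.add_apply, Pi.add_apply, Submodule.coe_add, h n₁ n₂ w₁ w₂ h₁ h₂,
    h' n₁ n₂ w₁ w₂ h₁ h₂, Pi.add_apply, LinearMap.add_apply]

theorem IsComponents.smul {I : W₁ ⊗[ℂ] W₂ →ₗ[ℂ] 𝒲₃.Completion}
    {J : ℂ → W₁ ⊗[ℂ] W₂ →ₗ[ℂ] W₃} (h : IsComponents 𝒲₁ 𝒲₂ 𝒲₃ I J) (c : ℂ) :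
    IsComponents 𝒲₁ 𝒲₂ 𝒲₃ (c • I) (c • J) := by
  intro n₁ n₂ w₁ w₂ h₁ h₂ m
  rw [LinearMap.smul_apply, Pi.smul_apply, Submodule.coe_smul, h n₁ n₂ w₁ w₂ h₁ h₂,
    Pi.smul_apply, LinearMap.smul_apply]

end ExpConj

/-- This is the only property of the branch that enters the correspondence. -/
theorem exp_logBranch (p : ℤ) {z : ℂ} (hz : z ≠ 0) : Complex.exp (logBranch p z) = z := by
  rw [logBranch, Complex.exp_add, mul_comm _ (p : ℂ), Complex.exp_int_mul_two_pi_mul_I, mul_one]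
  split_ifs
  · exact Complex.exp_log hz
  · rw [Complex.exp_add, Complex.exp_two_pi_mul_I, mul_one, Complex.exp_log hz]

variable {Atilde : Type*} [AddCommGroup Atilde] {A : AddSubgroup Atilde}
  {𝒱 : StronglyGradedVertexAlgebra A V} {𝒲₁ : StronglyGradedGenModule 𝒱 W₁}
  {𝒲₂ : StronglyGradedGenModule 𝒱 W₂} {𝒲₃ : StronglyGradedGenModule 𝒱 W₃}

/-- Conjugation by the exponential of the nilpotent part leaves u alone; the scalar e^(ζa) moves it.
-/
theorem IsCoeffFamily.expAd {u : ℂ} {J : ℂ → W₁ ⊗[ℂ] W₂ →ₗ[ℂ] W₃}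
    (h : IsCoeffFamily u 𝒲₁ 𝒲₂ 𝒲₃ J) (ζ : ℂ) :
    IsCoeffFamily (u * Complex.exp ζ) 𝒲₁ 𝒲₂ 𝒲₃
      (_root_.expAd 𝒲₁.toGenModule 𝒲₂.toGenModule 𝒲₃.toGenModule ζ J) :=
  (h.expConj ζ).rescale ζ

variable (𝒲₁ 𝒲₂ 𝒲₃) in
/-- Logarithmic intertwining operators correspond to `P(z)`-intertwining maps by the substitution
of `e^ζ = z` for `x`. -/
def logEquiv {z ζ : ℂ} (hζ : Complex.exp ζ = z) :
    LogIntertwiningSpace 𝒲₁ 𝒲₂ 𝒲₃ ≃ₗ[ℂ] PIntertwiningSpace z 𝒲₁ 𝒲₂ 𝒲₃ where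
  toFun 𝒴 := ⟨assemble 𝒲₁.toGenModule 𝒲₂.toGenModule 𝒲₃.toGenModule
      (expAd 𝒲₁.toGenModule 𝒲₂.toGenModule 𝒲₃.toGenModule ζ (logCoeff 𝒴.1 0)), by
    have h := (isCoeffFamily_logCoeff 𝒴.2).expAd ζ
    -- The parameter moves from 1 to e^ζ = z; in the inverse it moves from z back to z e^(-ζ) = 1.
    rw [one_mul, hζ] at h
    exact (isComponents_assemble _ _ _ h.degree).isPIntertwining h⟩
  map_add' 𝒴 𝒴' := by
    refine Subtype.ext ?_
    have c := fun 𝒴 : LogIntertwiningSpace 𝒲₁ 𝒲₂ 𝒲₃ =>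
      isComponents_assemble _ _ _ ((isCoeffFamily_logCoeff 𝒴.2).expAd ζ).degree
    refine (c (𝒴 + 𝒴')).unique_left ?_
    rw [show logCoeff (𝒴 + 𝒴').1 0 = logCoeff 𝒴.1 0 + logCoeff 𝒴'.1 0 from rfl, expAd_add]
    exact (c 𝒴).add (c 𝒴')
  map_smul' s 𝒴 := by
    refine Subtype.ext ?_
    have c := fun 𝒴 : LogIntertwiningSpace 𝒲₁ 𝒲₂ 𝒲₃ =>
      isComponents_assemble _ _ _ ((isCoeffFamily_logCoeff 𝒴.2).expAd ζ).degree
    refine (c (s • 𝒴)).unique_left ?_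
    rw [show logCoeff (s • 𝒴).1 0 = s • logCoeff 𝒴.1 0 from rfl, expAd_smul]
    exact (c 𝒴).smul s
  invFun I := ⟨logOfCoeff 𝒲₁.toGenModule 𝒲₂.toGenModule 𝒲₃.toGenModule
      (expAd 𝒲₁.toGenModule 𝒲₂.toGenModule 𝒲₃.toGenModule (-ζ)
        (components 𝒲₁.toGenModule 𝒲₂.toGenModule 𝒲₃.toGenModule I.1)), by
    have h := ((isComponents_components _ _ _ I.1).isCoeffFamily I.2).expAd (-ζ)
    have e : z * Complex.exp (-ζ) = 1 := by
      rw [← hζ, ← Complex.exp_add, add_neg_cancel, Complex.exp_zero]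
    rw [e] at h
    exact h.logOfCoeff_mem⟩
  left_inv 𝒴 := by
    refine Subtype.ext (logCoeff_ext fun k a => ?_)
    have h := isComponents_assemble _ _ _ ((isCoeffFamily_logCoeff 𝒴.2).expAd ζ).degree
    change logCoeff (logOfCoeff _ _ _ (expAd _ _ _ (-ζ) (components _ _ _ (assemble _ _ _ _))))
      k a = _
    -- After the two conjugations cancel, the (log x)^0-coefficients are recovered, and
    -- `logCoeff_eq` recovers all others from them.
    rw [logCoeff_logOfCoeff, ← h.unique_right (isComponents_components _ _ _ _), expAd_neg_expAd,
      ← 𝒴.2.1.logCoeff_eq]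
  right_inv I := by
    refine Subtype.ext ?_
    have h := isComponents_components 𝒲₁.toGenModule 𝒲₂.toGenModule 𝒲₃.toGenModule I.1
    change assemble _ _ _ (expAd _ _ _ ζ (logCoeff (logOfCoeff _ _ _ _) 0)) = _
    have e : ∀ c : ℂ → W₁ ⊗[ℂ] W₂ →ₗ[ℂ] W₃, logCoeff (logOfCoeff 𝒲₁.toGenModule 𝒲₂.toGenModule
        𝒲₃.toGenModule c) 0 = c := fun c => funext fun a => by
      rw [logCoeff_logOfCoeff, divPow_zero, Module.End.one_apply]
    rw [e, expAd_expAd_neg]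
    exact (isComponents_assemble _ _ _ h.hasDegrees).unique_left h

end Correspondence

end

theorem proposition4p7 {Atilde : Type*} [AddCommGroup Atilde] (A : AddSubgroup Atilde)
    {V W₁ W₂ W₃ : Type*} [AddCommGroup V] [Module ℂ V] [AddCommGroup W₁] [Module ℂ W₁]
    [AddCommGroup W₂] [Module ℂ W₂] [AddCommGroup W₃] [Module ℂ W₃]
    (𝒱 : StronglyGradedVertexAlgebra A V)
    (𝒲₁ : StronglyGradedGenModule 𝒱 W₁) (𝒲₂ : StronglyGradedGenModule 𝒱 W₂)
    (𝒲₃ : StronglyGradedGenModule 𝒱 W₃) (z : ℂ) (hz : z ≠ 0) (p : ℤ) :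
    ∃ e : LogIntertwiningSpace 𝒲₁ 𝒲₂ 𝒲₃ ≃ₗ[ℂ] PIntertwiningSpace z 𝒲₁ 𝒲₂ 𝒲₃,
      (∀ (𝒴 : LogIntertwiningSpace 𝒲₁ 𝒲₂ 𝒲₃) (w₁ : W₁) (w₂ : W₂),
        𝒲₃.SubstExists (𝒴.1 (w₁ ⊗ₜ w₂)) ∧
          (e 𝒴).1 (w₁ ⊗ₜ w₂) = 𝒲₃.subst (logBranch p z) (𝒴.1 (w₁ ⊗ₜ w₂))) ∧
      ∀ (I : PIntertwiningSpace z 𝒲₁ 𝒲₂ 𝒲₃) (w₁ : W₁) (w₂ : W₂) (a : ℂ) (k : ℕ),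
        (e.symm I).1 (w₁ ⊗ₜ w₂) a k
          = conjugateCoeff 𝒲₁.toGenModule 𝒲₂.toGenModule 𝒲₃.toGenModule (-logBranch p z) I.1 w₁ w₂ a k
    := by
  refine ⟨logEquiv 𝒲₁ 𝒲₂ 𝒲₃ (exp_logBranch p hz), fun 𝒴 w₁ w₂ => ?_, fun I w₁ w₂ a k => ?_⟩
  · exact 𝒴.2.1.subst_eq (isComponents_assemble _ _ _
      ((isCoeffFamily_logCoeff 𝒴.2).expAd _).degree) w₁ w₂
  · exact (conjugateCoeff_eq (isComponents_components _ _ _ I.1) _ w₁ w₂ a k).symm
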